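/- Let $A\to M$ be a smooth real vector bundle of rank $n$ over a smooth (finite-dimensional, Hausdorff, second countable, real) manifold, equipped with a Lie algebroid structure: a Lie bracket $[\cdot,\cdot]_A$ on $\Gamma(A)$ and a smooth bundle map (anchor) $a:A\to TM$ with $[X,fY]_A=f[X,Y]_A+(a(X)f)Y$. Let $\mathcal A=\bigoplus_{k}\Gamma(\wedge^kA)$, with the wedge product and with the Schouten bracket $[\cdot,\cdot]$: the bracket of degree $-1$ on $\mathcal A$ such that $[a,b]=-(-1)^{(|a|-1)(|b|-1)}[b,a]$ and $[a,b\wedge c]=[a,b]\wedge c+(-1)^{(|a|-1)|b|}\,b\wedge[a,c]$, with $[X,Y]=[X,Y]_A$ and $[X,f]=a(X)f$ for $X,Y\in\Gamma(A)$ and $f\in C^\infty(M)$. An $A$-connection on $\wedge^nA$ is an $\mathbb R$-bilinear map $(X,s)\mapsto\nabla_Xs$, $\Gamma(A)\times\Gamma(\wedge^nA)\to\Gamma(\wedge^nA)$, with $\nabla_{fX}s=f\nabla_Xs$ and $\nabla_X(fs)=(a(X)f)s+f\nabla_Xs$. Its associated generating operator is the $\mathbb R$-linear operator $\widetilde D:\mathcal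 A\to\mathcal A$ of degree $-1$ with $$[a,b]=(-1)^{|a|}\bigl(\widetilde D(a\wedge b)-\widetilde Da\wedge b-(-1)^{|a|}a\wedge\widetilde Db\bigr)\quad\text{and}\quad(\widetilde DX)\,s=[X,s]-\nabla_Xs$$ for $X\in\Gamma(A)$, $s\in\Gamma(\wedge^nA)$. Put $\partial=(-1)^{n-k}\widetilde D$ on $\Gamma(\wedge^kA)$; if $\nabla$ is flat then $\partial^2=0$, and $H_*(A,\nabla)=\ker\partial/\operatorname{im}\partial$. Let $d$ be the Lie algebroid coboundary on $\bigoplus_k\Gamma(\wedge^kA^*)$, $$d\omega(X_0,\dots,X_k)=\sum_i(-1)^ia(X_i)\bigl(\omega(\dots,\widehat{X_i},\dots)\bigr)+\sum_{i<j}(-1)^{i+j}\omega([X_i,X_j]_A,\dots,\widehat{X_i},\dots,\widehat{X_j},\dots),$$ and let $H^*(A,\mathbb R)=\ker d/\operatorname{im}d$. The contraction of $U\in\Gamma(\wedge^uA)$ by $\omega\in\Gamma(\wedge^pA^*)$ is defined by $\langle\omega\lrcorner U,\theta\rangle=\langle U,\omega\wedge\theta\rangle$. **Theorem.** Let $\nabla_0$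 be an $A$-connection on $\wedge^nA$ that admits a global nowhere vanishing section $\Lambda\in\Gamma(\wedge^nA)$ with $(\nabla_0)_X\Lambda=0$ for all $X\in\Gamma(A)$. Then the operators above (the Schouten bracket, the generating operator $\widetilde D_0$ associated with $\nabla_0$, and $d$) exist, $\nabla_0$ is flat, $\widetilde D_0^2=0$ and $d^2=0$, and $$H_*(A,\nabla_0)\cong H^{n-*}(A,\mathbb R)$$ as real vector spaces: for every $0\le k\le n$ the map $\omega\mapsto\omega\lrcorner\Lambda$ sends closed forms in $\Gamma(\wedge^{n-k}A^*)$ to $\partial$-cycles in $\Gamma(\wedge^kA)$ and induces a linear isomorphism $H^{n-k}(A,\mathbb R)\to H_k(A,\nabla_0)$, and the homology and the cohomology both vanish in all degrees greater than $n$. -/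

import Mathlib

open scoped Manifold ContDiff Bundle

noncomputable section

namespace LieAlgebroidBV

/-! ### Linear algebra in a fibre -/

/-- The exterior algebra of a finite-dimensional real vector space is finite-dimensional. -/
theorem exteriorAlgebra_finite (G : Type*) [AddCommGroup G] [Module ℝ G]
    [FiniteDimensional ℝ G] : Module.Finite ℝ (ExteriorAlgebra ℝ G) := by
  have hzero : ∀ k, Module.finrank ℝ G < k → (⋀[ℝ]^k G : Submodule ℝ (ExteriorAlgebra ℝ G)) = ⊥ := by
    intro k hk
    have h := exteriorPower.finrank_eq ℝ (M := G) (n := k)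
    rw [Nat.choose_eq_zero_of_lt hk] at h
    exact Submodule.finrank_eq_zero.mp h
  have htop : (⨆ k, (⋀[ℝ]^k G : Submodule ℝ (ExteriorAlgebra ℝ G))) = ⊤ :=
    (DirectSum.Decomposition.isInternal
      (fun k : ℕ => (⋀[ℝ]^k G : Submodule ℝ (ExteriorAlgebra ℝ G)))).submodule_iSup_eq_top
  have hfin : (⨆ k ∈ Finset.range (Module.finrank ℝ G + 1),
      (⋀[ℝ]^k G : Submodule ℝ (ExteriorAlgebra ℝ G))) = ⊤ := by
    rw [eq_top_iff, ← htop]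
    refine iSup_le fun k => ?_
    by_cases hk : k < Module.finrank ℝ G + 1
    · exact le_iSup₂_of_le k (Finset.mem_range.mpr hk) le_rfl
    · rw [hzero k (by omega)]
      exact bot_le
  rw [Module.finite_def, ← hfin]
  exact Submodule.fg_biSup _ _ fun k _ =>
    (Module.Finite.iff_fg (N := (⋀[ℝ]^k G : Submodule ℝ (ExteriorAlgebra ℝ G)))).mp inferInstance

/-- The contraction `w ⌟ U` of `U ∈ ∧V` by `w ∈ ∧V*`, as an algebra homomorphism from `∧V*` to the
opposite of `End (∧V)`. For `α ∈ V*`, the operator `α ⌟ ·` is the antiderivation of degree `-1`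
of `∧V` with `α ⌟ v = α v`; the opposite algebra encodes `(w ∧ θ) ⌟ U = θ ⌟ (w ⌟ U)`, that is
`⟨w ⌟ U, θ⟩ = ⟨U, w ∧ θ⟩`. -/
def contractionHom (V : Type*) [AddCommGroup V] [Module ℝ V] :
    ExteriorAlgebra ℝ (Module.Dual ℝ V) →ₐ[ℝ] (Module.End ℝ (ExteriorAlgebra ℝ V))ᵐᵒᵖ :=
  ExteriorAlgebra.lift ℝ
    ⟨(MulOpposite.opLinearEquiv ℝ).toLinearMap ∘ₗ
        CliffordAlgebra.contractLeft (Q := (0 : QuadraticForm ℝ V)), fun α => by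
      apply MulOpposite.unop_injective
      refine LinearMap.ext fun U => ?_
      exact CliffordAlgebra.contractLeft_contractLeft α U⟩

/-- The contraction `w ⌟ U`. -/
def contraction {V : Type*} [AddCommGroup V] [Module ℝ V]
    (w : ExteriorAlgebra ℝ (Module.Dual ℝ V)) (U : ExteriorAlgebra ℝ V) : ExteriorAlgebra ℝ V :=
  MulOpposite.unop (contractionHom V w) U

/-! ### Smooth sections of exterior algebra bundles -/

section Multisections

variable (E : Type*) [NormedAddCommGroup E] [NormedSpace ℝ E]
  {M : Type*} [TopologicalSpace M] [ChartedSpace E M]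
  {G : Type*} [AddCommGroup G] [Module ℝ G] [FiniteDimensional ℝ G]
  {V : M → Type*} [∀ x, AddCommGroup (V x)] [∀ x, Module ℝ (V x)]

/-- Let `V` be a vector bundle over `M` with fibre `G`, and let `c x₀ x : V x → G` be a local
trivialization of `V` defined for `x` near `x₀`. This is the algebra of all sections `s` of the
bundle `∧V` whose local representatives `x ↦ ∧(c x₀ x) (s x)`, with values in the
finite-dimensional space `∧G`, are smooth at `x₀`, for every `x₀` (which is expressed through the
linear functionals on `∧G`). -/
def smoothMultisections (c : M → ∀ x : M, V x →ₗ[ℝ] G) :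
    Subalgebra ℝ (∀ x, ExteriorAlgebra ℝ (V x)) where
  carrier := {s | ∀ (x₀ : M) (φ : Module.Dual ℝ (ExteriorAlgebra ℝ G)),
    ContMDiffAt 𝓘(ℝ, E) 𝓘(ℝ, ℝ) ∞ (fun x => φ (ExteriorAlgebra.map (c x₀ x) (s x))) x₀}
  mul_mem' := by
    intro s t hs ht x₀ φ
    have := exteriorAlgebra_finite G
    let b := Module.finBasis ℝ (ExteriorAlgebra ℝ G)
    have key : ∀ u v : ExteriorAlgebra ℝ G,
        φ (u * v) = ∑ i, ∑ j, (b.coord i u * b.coord j v) * φ (b i * b j) := by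
      intro u v
      conv_lhs => rw [← b.sum_repr u, ← b.sum_repr v, Finset.sum_mul_sum, map_sum]
      refine Finset.sum_congr rfl fun i _ => ?_
      rw [map_sum]
      refine Finset.sum_congr rfl fun j _ => ?_
      rw [smul_mul_smul_comm, map_smul, smul_eq_mul]
      rfl
    have h : (fun x => φ (ExteriorAlgebra.map (c x₀ x) ((s * t) x))) = fun x => ∑ i, ∑ j,
        (b.coord i (ExteriorAlgebra.map (c x₀ x) (s x)) *
          b.coord j (ExteriorAlgebra.map (c x₀ x) (t x))) * φ (b i * b j) := by
      funext x
      rw [Pi.mul_apply, map_mul, key]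
    rw [h]
    exact ContMDiffAt.sum fun i _ => ContMDiffAt.sum fun j _ =>
      ((hs x₀ (b.coord i)).mul (ht x₀ (b.coord j))).mul contMDiffAt_const
  add_mem' := by
    intro s t hs ht x₀ φ
    have h : (fun x => φ (ExteriorAlgebra.map (c x₀ x) ((s + t) x))) = fun x =>
        φ (ExteriorAlgebra.map (c x₀ x) (s x)) + φ (ExteriorAlgebra.map (c x₀ x) (t x)) := by
      funext x
      rw [Pi.add_apply, map_add, map_add]
    rw [h]
    exact (hs x₀ φ).add (ht x₀ φ)
  algebraMap_mem' := by
    intro r x₀ φ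
    have h : (fun x => φ (ExteriorAlgebra.map (c x₀ x)
        (algebraMap ℝ (∀ x, ExteriorAlgebra ℝ (V x)) r x))) = fun _ =>
        φ (algebraMap ℝ (ExteriorAlgebra ℝ G) r) := by
      funext x
      rw [Pi.algebraMap_apply, AlgHom.commutes]
    rw [h]
    exact contMDiffAt_const

/-- The algebra `⊕ₖ Γ(∧^k V)` of smooth sections of `∧V`, as a type. -/
def Multisections (c : M → ∀ x : M, V x →ₗ[ℝ] G) : Type _ := ↥(smoothMultisections E c)

instance (c : M → ∀ x : M, V x →ₗ[ℝ] G) : Ring (Multisections E c) :=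
  inferInstanceAs (Ring ↥(smoothMultisections E c))

instance (c : M → ∀ x : M, V x →ₗ[ℝ] G) : Algebra ℝ (Multisections E c) :=
  inferInstanceAs (Algebra ℝ ↥(smoothMultisections E c))

/-- The smooth sections of `∧^k V`. -/
def degreePart (c : M → ∀ x : M, V x →ₗ[ℝ] G) (k : ℕ) : Submodule ℝ (Multisections E c) where
  carrier := {s | ∀ x, s.1 x ∈ ⋀[ℝ]^k (V x)}
  add_mem' hs ht x := Submodule.add_mem _ (hs x) (ht x)
  zero_mem' _ := Submodule.zero_mem _
  smul_mem' r _ hs x := Submodule.smul_mem _ r (hs x)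

/-- `Γ(∧^k V)`, as a type. -/
def HomogeneousSections (c : M → ∀ x : M, V x →ₗ[ℝ] G) (k : ℕ) : Type _ := ↥(degreePart E c k)

instance (c : M → ∀ x : M, V x →ₗ[ℝ] G) (k : ℕ) : AddCommGroup (HomogeneousSections E c k) :=
  inferInstanceAs (AddCommGroup ↥(degreePart E c k))

instance (c : M → ∀ x : M, V x →ₗ[ℝ] G) (k : ℕ) : Module ℝ (HomogeneousSections E c k) :=
  inferInstanceAs (Module ℝ ↥(degreePart E c k))

end Multisections

/-! ### Lie algebroids

Throughout, `M` is a manifold modelled on `E`, and `A` is a smooth real vector bundle over `M` with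
model fibre `F`. -/

section Algebroid

variable (E : Type*) [NormedAddCommGroup E] [NormedSpace ℝ E]
  (F : Type*) [NormedAddCommGroup F] [NormedSpace ℝ F]
  {M : Type*} [TopologicalSpace M] [ChartedSpace E M] [IsManifold 𝓘(ℝ, E) ∞ M]
  (A : M → Type*) [TopologicalSpace (Bundle.TotalSpace F A)]
  [∀ x, AddCommGroup (A x)] [∀ x, Module ℝ (A x)] [∀ x, TopologicalSpace (A x)]
  [FiberBundle F A] [VectorBundle ℝ F A]

/-- The space `Γ(A)` of smooth sections of `A`. -/
abbrev Sec := ContMDiffSection 𝓘(ℝ, E) F ∞ A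

variable {E F A} in
/-- The product `f X` of a smooth function and a smooth section. -/
def Sec.smulFn (f : C^∞⟮𝓘(ℝ, E), M; 𝓘(ℝ, ℝ), ℝ⟯) (X : Sec E F A) : Sec E F A :=
  ⟨fun x => f x • X x, f.contMDiff.smul_section X.contMDiff⟩

variable {E} in
/-- The derivative of a real function `f` in the direction of a tangent vector. -/
def dirDeriv (f : M → ℝ) (x : M) (v : TangentSpace 𝓘(ℝ, E) x) : ℝ :=
  mfderiv 𝓘(ℝ, E) 𝓘(ℝ, ℝ) f x v

/-- A Lie algebroid structure on the vector bundle `A`: a Lie bracket on `Γ(A)` and a smooth bundle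
map `A → TM` over the identity of `M` (the anchor) that satisfy the Leibniz rule
`[X, f Y] = f [X, Y] + (a(X) f) Y`. -/
structure LieAlgebroid where
  bracket : Sec E F A →ₗ[ℝ] Sec E F A →ₗ[ℝ] Sec E F A
  bracket_self : ∀ X, bracket X X = 0
  jacobi : ∀ X Y Z,
    bracket X (bracket Y Z) = bracket (bracket X Y) Z + bracket Y (bracket X Z)
  anchor : ∀ x : M, A x →ₗ[ℝ] TangentSpace 𝓘(ℝ, E) x
  anchor_smooth : ContMDiff (𝓘(ℝ, E).prod 𝓘(ℝ, F)) 𝓘(ℝ, E).tangent ∞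
    (fun p : Bundle.TotalSpace F A => (⟨p.1, anchor p.1 p.2⟩ : TangentBundle 𝓘(ℝ, E) M))
  leibniz : ∀ (X Y : Sec E F A) (f : C^∞⟮𝓘(ℝ, E), M; 𝓘(ℝ, ℝ), ℝ⟯) (x : M),
    bracket X (Sec.smulFn f Y) x =
      f x • bracket X Y x + dirDeriv f x (anchor x (X x)) • Y x

variable {E F A} in
/-- The derivative `a(X) f` of a function `f` along the anchor of `X`. -/
def LieAlgebroid.deriv (L : LieAlgebroid E F A) (X : Sec E F A) (f : M → ℝ) (x : M) : ℝ :=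
  dirDeriv f x (L.anchor x (X x))

variable [FiniteDimensional ℝ F]

/-- The algebra `𝒜 = ⊕ₖ Γ(∧^k A)` of smooth multisections of `A`, with the wedge product. -/
abbrev Multi : Type _ :=
  Multisections E fun x₀ x : M => (trivializationAt F A x₀).linearMapAt ℝ x

/-- `𝒜^k = Γ(∧^k A)`, as a subspace of `𝒜`. -/
abbrev multiPart (k : ℕ) : Submodule ℝ (Multi E F A) :=
  degreePart E (fun x₀ x : M => (trivializationAt F A x₀).linearMapAt ℝ x) k

/-- `Γ(∧^k A)`. -/
abbrev MultiDeg (k : ℕ) : Type _ :=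
  HomogeneousSections E (fun x₀ x : M => (trivializationAt F A x₀).linearMapAt ℝ x) k

/-- `Γ(∧^k A*)`. The local trivialization of `A*` is the transpose of the inverse of that of `A`. -/
abbrev FormsDeg (k : ℕ) : Type _ :=
  HomogeneousSections E (fun x₀ x : M => ((trivializationAt F A x₀).symmₗ ℝ x).dualMap) k

variable {E F A}

/-- A smooth function, as an element of `𝒜⁰`. -/
def ofFn (f : C^∞⟮𝓘(ℝ, E), M; 𝓘(ℝ, ℝ), ℝ⟯) : Multi E F A :=
  ⟨fun x => algebraMap ℝ (ExteriorAlgebra ℝ (A x)) (f x), fun x₀ φ => by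
    have h : (fun x => φ (ExteriorAlgebra.map ((trivializationAt F A x₀).linearMapAt ℝ x)
        (algebraMap ℝ (ExteriorAlgebra ℝ (A x)) (f x)))) = fun x => f x * φ 1 := by
      funext x
      rw [AlgHom.commutes, Algebra.algebraMap_eq_smul_one, map_smul, smul_eq_mul]
    rw [h]
    exact f.contMDiff.contMDiffAt.mul contMDiffAt_const⟩

/-- A smooth section of `A`, as an element of `𝒜¹`. -/
def ofSec (X : Sec E F A) : Multi E F A :=
  ⟨fun x => ExteriorAlgebra.ι ℝ (X x), fun x₀ φ => by
    let ψ : F →L[ℝ] ℝ := LinearMap.toContinuousLinearMap (φ ∘ₗ ExteriorAlgebra.ι ℝ)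
    have h1 := (Bundle.contMDiffAt_section x₀).mp (X.contMDiff x₀)
    have h2 : ContMDiffAt 𝓘(ℝ, E) 𝓘(ℝ, ℝ) ∞
        (fun x => ψ (trivializationAt F A x₀ ⟨x, X x⟩).2) x₀ :=
      ψ.contMDiff.contMDiffAt.comp x₀ h1
    refine h2.congr_of_eventuallyEq ?_
    filter_upwards [(trivializationAt F A x₀).open_baseSet.mem_nhds
      (FiberBundle.mem_baseSet_trivializationAt F A x₀)] with x hx
    rw [ExteriorAlgebra.map_apply_ι, Bundle.Trivialization.linearMapAt_apply, if_pos hx]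
    rfl⟩

/-- The product `f s` of a smooth function and a section of `∧^k A`. -/
def MultiDeg.smulFn {k : ℕ} (f : C^∞⟮𝓘(ℝ, E), M; 𝓘(ℝ, ℝ), ℝ⟯) (s : MultiDeg E F A k) :
    MultiDeg E F A k :=
  ⟨ofFn f * s.1, fun x => by
    have h : (ofFn f * s.1).1 x = f x • s.1.1 x :=
      (Algebra.smul_def (f x) (s.1.1 x)).symm
    rw [h]
    exact Submodule.smul_mem _ _ (s.2 x)⟩

/-! ### The Schouten bracket -/

/-- `B` is a bracket of degree `-1` on `𝒜` that is graded antisymmetric, satisfies the graded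
Leibniz rule, and extends the bracket of `Γ(A)` and the action of `Γ(A)` on functions. These
properties determine `B`; the graded Jacobi identity is a consequence of them. The exponents
`(p + 1) * (q + 1)` and `(p + 1) * q` have the parity of `(p - 1) (q - 1)` and `(p - 1) q`. -/
structure IsSchoutenBracket (L : LieAlgebroid E F A)
    (B : Multi E F A →ₗ[ℝ] Multi E F A →ₗ[ℝ] Multi E F A) : Prop where
  degree_zero : ∀ a ∈ multiPart E F A 0, ∀ b ∈ multiPart E F A 0, B a b = 0
  degree : ∀ p q r, p + q = r + 1 → ∀ a ∈ multiPart E F A p, ∀ b ∈ multiPart E F A q,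
    B a b ∈ multiPart E F A r
  antisymm : ∀ p q, ∀ a ∈ multiPart E F A p, ∀ b ∈ multiPart E F A q,
    B a b = -((-1 : ℝ) ^ ((p + 1) * (q + 1)) • B b a)
  leibniz : ∀ p q, ∀ a ∈ multiPart E F A p, ∀ b ∈ multiPart E F A q, ∀ c,
    B a (b * c) = B a b * c + (-1 : ℝ) ^ ((p + 1) * q) • (b * B a c)
  sec_sec : ∀ X Y, B (ofSec X) (ofSec Y) = ofSec (L.bracket X Y)
  sec_fn : ∀ X f x, (B (ofSec X) (ofFn f)).1 x =
    algebraMap ℝ (ExteriorAlgebra ℝ (A x)) (L.deriv X f x)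

/-- The (generalized) Schouten bracket of a Lie algebroid. -/
def schoutenBracket (L : LieAlgebroid E F A) :
    Multi E F A →ₗ[ℝ] Multi E F A →ₗ[ℝ] Multi E F A :=
  Classical.epsilon (IsSchoutenBracket L)

/-! ### Connections on the top exterior power and generating operators -/

/-- An `A`-connection on the vector bundle `∧^n A`. -/
structure AConnection (L : LieAlgebroid E F A) (n : ℕ) where
  toFun : Sec E F A →ₗ[ℝ] MultiDeg E F A n →ₗ[ℝ] MultiDeg E F A n
  smul_left : ∀ f X s, toFun (Sec.smulFn f X) s = MultiDeg.smulFn f (toFun X s)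
  leibniz : ∀ (X : Sec E F A) (f : C^∞⟮𝓘(ℝ, E), M; 𝓘(ℝ, ℝ), ℝ⟯) (s : MultiDeg E F A n) (x : M),
    (toFun X (MultiDeg.smulFn f s)).1.1 x =
      L.deriv X f x • s.1.1 x + f x • (toFun X s).1.1 x

/-- The curvature `∇_X ∇_Y - ∇_Y ∇_X - ∇_{[X, Y]}` vanishes for all `X` and `Y`. -/
def AConnection.IsFlat {L : LieAlgebroid E F A} {n : ℕ} (nabla : AConnection L n) : Prop :=
  ∀ X Y s, nabla.toFun X (nabla.toFun Y s) - nabla.toFun Y (nabla.toFun X s)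
    - nabla.toFun (L.bracket X Y) s = 0

/-- `D` is the generating operator of the Schouten bracket that is associated with the
`A`-connection `∇` on `∧^n A`, where `n` is the rank of `A`: it has degree `-1`, generates the
bracket, and satisfies `(D X) s = [X, s] - ∇_X s` for `X ∈ Γ(A)` and `s ∈ Γ(∧^n A)`, where
`[X, s]` is the Lie derivative of `s` along `X`. -/
structure IsGeneratingOperator (L : LieAlgebroid E F A) {n : ℕ} (nabla : AConnection L n)
    (D : Multi E F A →ₗ[ℝ] Multi E F A) : Prop where
  degree_zero : ∀ f ∈ multiPart E F A 0, D f = 0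
  degree_succ : ∀ k, ∀ a ∈ multiPart E F A (k + 1), D a ∈ multiPart E F A k
  generates : ∀ p, ∀ a ∈ multiPart E F A p, ∀ b, schoutenBracket L a b =
    (-1 : ℝ) ^ p • (D (a * b) - D a * b - (-1 : ℝ) ^ p • (a * D b))
  on_sec : ∀ (X : Sec E F A) (s : MultiDeg E F A n),
    D (ofSec X) * s.1 = schoutenBracket L (ofSec X) s.1 - (nabla.toFun X s).1

/-- The generating operator `D̃` associated with `∇`. -/
def generatingOperator (L : LieAlgebroid E F A) {n : ℕ} (nabla : AConnection L n) :
    Multi E F A →ₗ[ℝ] Multi E F A :=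
  Classical.epsilon (IsGeneratingOperator L nabla)

/-! ### Lie algebroid homology -/

/-- The operator `∂ = (-1)^(n-k) D̃` on `Γ(∧^k A)`, for `k ≤ n` (there is nothing in degrees
`k > n` when `n` is the rank of `A`). -/
def boundary (L : LieAlgebroid E F A) {n : ℕ} (nabla : AConnection L n) (k : ℕ) :
    MultiDeg E F A k →ₗ[ℝ] Multi E F A :=
  (-1 : ℝ) ^ (n - k) • (generatingOperator L nabla ∘ₗ (multiPart E F A k).subtype)

/-- The cycles of degree `k`. -/
def cycles (L : LieAlgebroid E F A) {n : ℕ} (nabla : AConnection L n) (k : ℕ) :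
    Submodule ℝ (MultiDeg E F A k) :=
  LinearMap.ker (boundary L nabla k)

/-- The boundaries of degree `k`. -/
def boundaries (L : LieAlgebroid E F A) {n : ℕ} (nabla : AConnection L n) (k : ℕ) :
    Submodule ℝ (MultiDeg E F A k) :=
  (LinearMap.range (boundary L nabla (k + 1))).comap (multiPart E F A k).subtype

/-- The Lie algebroid homology `H_k(A, ∇)`. -/
def Homology (L : LieAlgebroid E F A) {n : ℕ} (nabla : AConnection L n) (k : ℕ) : Type _ :=
  ↥(cycles L nabla k) ⧸ (boundaries L nabla k).submoduleOf (cycles L nabla k)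

instance (L : LieAlgebroid E F A) {n : ℕ} (nabla : AConnection L n) (k : ℕ) :
    AddCommGroup (Homology L nabla k) :=
  Submodule.Quotient.addCommGroup _

instance (L : LieAlgebroid E F A) {n : ℕ} (nabla : AConnection L n) (k : ℕ) :
    Module ℝ (Homology L nabla k) :=
  Submodule.Quotient.module _

/-- The homology class of a cycle. -/
def Homology.mk (L : LieAlgebroid E F A) {n : ℕ} (nabla : AConnection L n) (k : ℕ) :
    cycles L nabla k →ₗ[ℝ] Homology L nabla k :=
  Submodule.mkQ _

/-! ### Lie algebroid cohomology with trivial coefficients -/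

/-- The function `w(X₁, …, X_k)`; for `w = α₁ ∧ ⋯ ∧ α_k` its value at `x` is the determinant of
the matrix of the numbers `αⱼ(Xᵢ)` at `x`. -/
def evalForm {k : ℕ} (w : FormsDeg E F A k) (X : Fin k → Sec E F A) (x : M) : ℝ :=
  exteriorPower.pairingDual ℝ (A x) k ⟨w.1.1 x, w.2 x⟩ (exteriorPower.ιMulti ℝ k fun i => X i x)

/-- `d` is given by the usual formula
`dw(X₀, …, X_k) = ∑ᵢ (-1)^i a(Xᵢ)(w(X₀, …, X̂ᵢ, …, X_k))
  + ∑_{i<j} (-1)^(i+j) w([Xᵢ, Xⱼ], X₀, …, X̂ᵢ, …, X̂ⱼ, …, X_k)`.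
In the second sum `[Xᵢ, Xⱼ]` is written in the slot `i` of `Xᵢ`, which changes the
sign `(-1)^(i+j)` to `(-1)^j`. -/
def IsCoboundary (L : LieAlgebroid E F A)
    (d : ∀ k, FormsDeg E F A k →ₗ[ℝ] FormsDeg E F A (k + 1)) : Prop :=
  ∀ (k : ℕ) (w : FormsDeg E F A k) (X : Fin (k + 1) → Sec E F A) (x : M),
    evalForm (d k w) X x =
      (∑ i : Fin (k + 1),
        (-1 : ℝ) ^ (i : ℕ) * L.deriv (X i) (evalForm w fun l => X (i.succAbove l)) x) +
      ∑ j : Fin (k + 1), ∑ i ∈ Finset.univ.filter (· < j),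
        (-1 : ℝ) ^ (j : ℕ) *
          evalForm w (fun l => Function.update X i (L.bracket (X i) (X j)) (j.succAbove l)) x

/-- The Lie algebroid coboundary `d`. -/
def coboundary (L : LieAlgebroid E F A) :
    ∀ k, FormsDeg E F A k →ₗ[ℝ] FormsDeg E F A (k + 1) :=
  Classical.epsilon (IsCoboundary L)

/-- The closed forms of degree `k`. -/
def cocycles (L : LieAlgebroid E F A) (k : ℕ) : Submodule ℝ (FormsDeg E F A k) :=
  LinearMap.ker (coboundary L k)

/-- The exact forms of degree `k`. -/
def coboundaries (L : LieAlgebroid E F A) : ∀ k, Submodule ℝ (FormsDeg E F A k)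
  | 0 => ⊥
  | k + 1 => LinearMap.range (coboundary L k)

/-- The Lie algebroid cohomology `H^k(A, ℝ)` with trivial coefficients. -/
def Cohomology (L : LieAlgebroid E F A) (k : ℕ) : Type _ :=
  ↥(cocycles L k) ⧸ (coboundaries L k).submoduleOf (cocycles L k)

instance (L : LieAlgebroid E F A) (k : ℕ) : AddCommGroup (Cohomology L k) :=
  Submodule.Quotient.addCommGroup _

instance (L : LieAlgebroid E F A) (k : ℕ) : Module ℝ (Cohomology L k) :=
  Submodule.Quotient.module _

/-- The cohomology class of a closed form. -/
def Cohomology.mk (L : LieAlgebroid E F A) (k : ℕ) : cocycles L k →ₗ[ℝ] Cohomology L k :=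
  Submodule.mkQ _

end Algebroid

end LieAlgebroidBV

end

/-! Write ⋆ω = ω ⌟ Λ. Since Λ vanishes nowhere, ⋆ is a C^∞(M)-linear bijection from forms of degree
p to multisections of degree n - p, and since X ∧ Λ = 0 it turns interior products into exterior
products: X ∧ ⋆ω is ⋆(i_X ω) up to the sign (-1)^p for ω of degree p + 1 (`ι_mul_contraction`,
`duality`). Hence d can be carried over to multisections. Put D(⋆ω) = (-1)^(p+1) ⋆dω (`gen`). Then
D² = 0 because d² = 0. Cartan's formula says that the anticommutator of D with X ∧ · is -⋆L_X⋆⁻¹,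
while the commutator of D with a function f corresponds to the product by df.

Everything else is read off from D. The bracket that D generates acts as a derivation when its first
entry is a section or a function. Multisections are, near each point, sums of products of functions
and sections, so an induction on the degree of the first entry gives the graded Leibniz rule in
general (`VolumeDuality.leibniz`). Thus the generated bracket is a Schouten bracket, and it is the
only one, since a graded derivation that kills functions and sections is zero (`derivation_eq_zero`,
`IsBracket.unique`). Because Λ is horizontal, ∇_X is L_X on functions transported by ⋆. This makes D
a generating operator associated with ∇, and it makes ∇ flat. A generating operator is determined by
its values on sections (`generator_unique`), and these are fixed by the product with Λ. So D is the
operator of the theorem, ∂ is -⋆d⋆⁻¹, and ⋆ matches cycles with closed forms and boundaries with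
exact ones.

The coboundary is constructed, rather than assumed, from one fact: a form of degree k + 1 is the
same as an alternating C^∞(M)-linear family X ↦ i_X θ of forms of degree k (`FormsDeg.exists_form`).
Then L_X and d are defined by recursion on the degree through their interior products, and d² = 0,
the commutation of d with L_X and the usual global formula follow by induction (`lie_spec`,
`diff_spec`, `eval_diff`).

The bracket, the generating operator and the coboundary are `Classical.epsilon` choices, so each of
them needs both an existence proof and a uniqueness proof before it can be identified with its
model. -/

noncomputable section

namespace LieAlgebroidBV

/-! ### Interior products on an exterior algebra -/

section Interior

variable {V W : Type*} [AddCommGroup V] [Module ℝ V] [AddCommGroup W] [Module ℝ W]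

/-- The interior product by a linear functional. -/
def interior : Module.Dual ℝ V →ₗ[ℝ] ExteriorAlgebra ℝ V →ₗ[ℝ] ExteriorAlgebra ℝ V :=
  CliffordAlgebra.contractLeft (Q := (0 : QuadraticForm ℝ V))

theorem interior_ι_mul (ξ : Module.Dual ℝ V) (v : V) (a : ExteriorAlgebra ℝ V) :
    interior ξ (ExteriorAlgebra.ι ℝ v * a) = ξ v • a - ExteriorAlgebra.ι ℝ v * interior ξ a :=
  CliffordAlgebra.contractLeft_ι_mul ξ v a

theorem interior_algebraMap (ξ : Module.Dual ℝ V) (r : ℝ) :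
    interior ξ (algebraMap ℝ (ExteriorAlgebra ℝ V) r) = 0 :=
  CliffordAlgebra.contractLeft_algebraMap _ ξ r

theorem interior_ι (ξ : Module.Dual ℝ V) (v : V) :
    interior ξ (ExteriorAlgebra.ι ℝ v) = algebraMap ℝ _ (ξ v) :=
  CliffordAlgebra.contractLeft_ι _ ξ v

theorem interior_interior_self (ξ : Module.Dual ℝ V) (a : ExteriorAlgebra ℝ V) :
    interior ξ (interior ξ a) = 0 :=
  CliffordAlgebra.contractLeft_contractLeft ξ a

theorem ι_mul_mem {k : ℕ} (v : V) {a : ExteriorAlgebra ℝ V} (ha : a ∈ ⋀[ℝ]^k V) :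
    ExteriorAlgebra.ι ℝ v * a ∈ ⋀[ℝ]^(k + 1) V := by
  change _ ∈ LinearMap.range (ExteriorAlgebra.ι ℝ) ^ (k + 1)
  rw [pow_succ']
  exact Submodule.mul_mem_mul (LinearMap.mem_range_self _ v) ha

theorem algebraMap_mem_exteriorPower_zero (r : ℝ) :
    algebraMap ℝ (ExteriorAlgebra ℝ V) r ∈ ⋀[ℝ]^0 V := by
  change _ ∈ LinearMap.range (ExteriorAlgebra.ι ℝ) ^ 0
  rw [pow_zero]
  exact Submodule.algebraMap_mem r

theorem mem_exteriorPower_zero {a : ExteriorAlgebra ℝ V} :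
    a ∈ ⋀[ℝ]^0 V ↔ ∃ r, algebraMap ℝ _ r = a := by
  change _ ∈ LinearMap.range (ExteriorAlgebra.ι ℝ) ^ 0 ↔ _
  rw [pow_zero, Submodule.mem_one]

/-- Induction on the degree of an element of an exterior power. -/
theorem exteriorPower_induction {P : ∀ k, ∀ a : ExteriorAlgebra ℝ V, a ∈ ⋀[ℝ]^k V → Prop}
    (scalar : ∀ r, P 0 (algebraMap ℝ _ r) (algebraMap_mem_exteriorPower_zero r))
    (add : ∀ k a b ha hb, P k a ha → P k b hb → P k (a + b) (Submodule.add_mem _ ha hb))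
    (ι_mul : ∀ v k a ha, P k a ha → P (k + 1) (ExteriorAlgebra.ι ℝ v * a) (ι_mul_mem v ha)) :
    ∀ k a ha, P k a ha := by
  intro k a ha
  refine Submodule.pow_induction_on_left' (LinearMap.range (ExteriorAlgebra.ι ℝ))
    (C := fun k a ha => P k a ha) scalar (fun a b k ha hb => add k a b ha hb) ?_ ha
  rintro _ ⟨v, rfl⟩ k a ha h
  exact ι_mul v k a ha h

theorem interior_mem {k : ℕ} (ξ : Module.Dual ℝ V) {a : ExteriorAlgebra ℝ V}
    (ha : a ∈ ⋀[ℝ]^(k + 1) V) : interior ξ a ∈ ⋀[ℝ]^k V := by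
  -- The clause for m = 0 is needed in degree one: the term v ∧ (ξ ⌟ a) with a scalar has the wrong
  -- degree unless it vanishes.
  have key : ∀ m a, a ∈ ⋀[ℝ]^m V → (m = 0 → interior ξ a = 0) ∧
      ∀ k, m = k + 1 → interior ξ a ∈ ⋀[ℝ]^k V := by
    refine exteriorPower_induction (fun r => ⟨fun _ => interior_algebraMap ξ r, by simp⟩) ?_ ?_
    · rintro m a b - - ⟨ha, ha'⟩ ⟨hb, hb'⟩
      refine ⟨fun h => by rw [map_add, ha h, hb h, add_zero], fun k h => ?_⟩
      rw [map_add]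
      exact Submodule.add_mem _ (ha' k h) (hb' k h)
    · rintro v m a ham ⟨ha, ha'⟩
      refine ⟨by simp, fun k h => ?_⟩
      obtain rfl : m = k := by omega
      rw [interior_ι_mul]
      refine Submodule.sub_mem _ (Submodule.smul_mem _ _ ham) ?_
      rcases m with _ | m
      · rw [ha rfl, mul_zero]
        exact Submodule.zero_mem _
      · exact ι_mul_mem v (ha' m rfl)
  exact (key _ a ha).2 k rfl

theorem interior_eq_zero (ξ : Module.Dual ℝ V) {a : ExteriorAlgebra ℝ V}
    (ha : a ∈ ⋀[ℝ]^0 V) : interior ξ a = 0 := by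
  obtain ⟨r, rfl⟩ := mem_exteriorPower_zero.mp ha
  exact interior_algebraMap ξ r

/-- Euler's identity `∑ vᵢ ∧ (ξᵢ ⌟ a) = c k a` for `a ∈ ∧^k V` if `∑ ξᵢ(u) vᵢ = c u` for all `u`. -/
theorem sum_ι_mul_interior {I : Type*} [Fintype I] (v : I → V) (ξ : I → Module.Dual ℝ V) (c : ℝ)
    (h : ∀ u, ∑ i, ξ i u • v i = c • u) {k : ℕ} {a : ExteriorAlgebra ℝ V} (ha : a ∈ ⋀[ℝ]^k V) :
    ∑ i, ExteriorAlgebra.ι ℝ (v i) * interior (ξ i) a = (c * k) • a := by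
  induction k, a, ha using exteriorPower_induction with
  | scalar r => simp [interior_algebraMap]
  | add k a b _ _ ha hb =>
    simp only [map_add, mul_add, Finset.sum_add_distrib, smul_add, ha, hb]
  | ι_mul u k a _ ha =>
    -- The antiderivation rule on u ∧ a, after which vᵢ is moved past u. The first terms add up to c
    -- (u ∧ a), the second ones to u ∧ (c k a) by induction.
    have h1 : ∀ i, ExteriorAlgebra.ι ℝ (v i) *
        interior (ξ i) (ExteriorAlgebra.ι ℝ u * a) =
        ExteriorAlgebra.ι ℝ (ξ i u • v i) * a +
          ExteriorAlgebra.ι ℝ u * (ExteriorAlgebra.ι ℝ (v i) * interior (ξ i) a) := by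
      intro i
      have h2 := ExteriorAlgebra.ι_add_mul_swap (R := ℝ) u (v i)
      rw [interior_ι_mul, mul_sub, ← mul_assoc, ← mul_assoc, eq_neg_of_add_eq_zero_left h2, map_smul,
        mul_smul_comm, smul_mul_assoc, neg_mul, sub_eq_add_neg]
    simp only [h1, Finset.sum_add_distrib, ← Finset.sum_mul, ← Finset.mul_sum, ha, ← map_sum, h]
    rw [map_smul, smul_mul_assoc, mul_smul_comm, ← add_smul]
    push_cast
    congr 1
    ring

/-- An element of positive degree all of whose interior products vanish is zero. -/
theorem eq_zero_of_interior [FiniteDimensional ℝ V] {k : ℕ} {a : ExteriorAlgebra ℝ V}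
    (ha : a ∈ ⋀[ℝ]^(k + 1) V) (h : ∀ ξ, interior ξ a = 0) : a = 0 := by
  let b := Module.finBasis ℝ V
  have h1 := sum_ι_mul_interior b b.coord 1 (fun u => by simp [b.sum_repr]) ha
  simp only [h, mul_zero, Finset.sum_const_zero] at h1
  refine (smul_eq_zero.mp h1.symm).resolve_left ?_
  rw [one_mul]
  positivity

/-- An element of degree less than the dimension that is annihilated by all vectors is zero. -/
theorem eq_zero_of_ι_mul [FiniteDimensional ℝ V] {k : ℕ} (hk : k < Module.finrank ℝ V)
    {a : ExteriorAlgebra ℝ V} (ha : a ∈ ⋀[ℝ]^k V)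
    (h : ∀ v, ExteriorAlgebra.ι ℝ v * a = 0) : a = 0 := by
  let b := Module.finBasis ℝ V
  have h1 := sum_ι_mul_interior b b.coord 1 (fun u => by simp [b.sum_repr]) ha
  -- Contracting bᵢ ∧ a = 0 with the dual covector shows that every summand of Euler's identity is a
  -- itself. So (dim V) a = k a, with k < dim V.
  have h2 : ∀ i, ExteriorAlgebra.ι ℝ (b i) * interior (b.coord i) a = a := by
    intro i
    have h3 := interior_ι_mul (b.coord i) (b i) a
    rw [h, map_zero, Module.Basis.coord_apply, Module.Basis.repr_self, Finsupp.single_eq_same,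
      one_smul] at h3
    exact (sub_eq_zero.mp h3.symm).symm
  simp only [h2, Finset.sum_const, Finset.card_univ, Fintype.card_fin, one_mul,
    ← Nat.cast_smul_eq_nsmul ℝ] at h1
  rw [← sub_eq_zero, ← sub_smul] at h1
  refine (smul_eq_zero.mp h1).resolve_left (sub_ne_zero.mpr ?_)
  exact_mod_cast hk.ne'

theorem map_mem_exteriorPower (f : V →ₗ[ℝ] W) {k : ℕ} {a : ExteriorAlgebra ℝ V}
    (ha : a ∈ ⋀[ℝ]^k V) : ExteriorAlgebra.map f a ∈ ⋀[ℝ]^k W := by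
  induction k, a, ha using exteriorPower_induction with
  | scalar r =>
    rw [AlgHom.commutes]
    exact algebraMap_mem_exteriorPower_zero r
  | add k a b _ _ ha hb =>
    rw [map_add]
    exact Submodule.add_mem _ ha hb
  | ι_mul v k a _ ha =>
    rw [map_mul, ExteriorAlgebra.map_apply_ι]
    exact ι_mul_mem _ ha

/-- A single vector is moved past a homogeneous element first; the general case peels the vectors
off the left factor one at a time. -/
theorem mul_comm_exteriorPower {p q : ℕ} {a b : ExteriorAlgebra ℝ V} (ha : a ∈ ⋀[ℝ]^p V)
    (hb : b ∈ ⋀[ℝ]^q V) : a * b = (-1 : ℝ) ^ (p * q) • (b * a) := by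
  have key : ∀ (v : V) k a, a ∈ ⋀[ℝ]^k V →
      ExteriorAlgebra.ι ℝ v * a = (-1 : ℝ) ^ k • (a * ExteriorAlgebra.ι ℝ v) := by
    intro v
    refine exteriorPower_induction (fun r => ?_) ?_ ?_
    · rw [pow_zero, one_smul, Algebra.commutes]
    · intro k a b _ _ ha hb
      rw [mul_add, add_mul, ha, hb, smul_add]
    · intro u k a _ ha
      rw [← mul_assoc, eq_neg_of_add_eq_zero_left (ExteriorAlgebra.ι_add_mul_swap (R := ℝ) v u),
        neg_mul, mul_assoc, ha, mul_smul_comm, ← neg_smul, pow_succ, mul_neg_one, mul_assoc]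
  induction p, a, ha using exteriorPower_induction with
  | scalar r => rw [zero_mul, pow_zero, one_smul, Algebra.commutes]
  | add k a a' _ _ ha ha' => rw [mul_add, add_mul, ha, ha', smul_add]
  | ι_mul u k a _ ha =>
    rw [mul_assoc, ha, mul_smul_comm, ← mul_assoc, key u q b hb, smul_mul_assoc, smul_smul,
      ← pow_add, mul_assoc, add_mul, one_mul]

end Interior

/-! ### Contractions -/

section Contraction

variable {V W : Type*} [AddCommGroup V] [Module ℝ V] [AddCommGroup W] [Module ℝ W]

/-- The contraction as a bilinear map. -/
def contractionₗ (V : Type*) [AddCommGroup V] [Module ℝ V] :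
    ExteriorAlgebra ℝ (Module.Dual ℝ V) →ₗ[ℝ] ExteriorAlgebra ℝ V →ₗ[ℝ] ExteriorAlgebra ℝ V :=
  (MulOpposite.opLinearEquiv ℝ).symm.toLinearMap ∘ₗ (contractionHom V).toLinearMap

theorem contractionₗ_apply (w : ExteriorAlgebra ℝ (Module.Dual ℝ V)) (U : ExteriorAlgebra ℝ V) :
    contractionₗ V w U = contraction w U := rfl

theorem contraction_add_left (w w' : ExteriorAlgebra ℝ (Module.Dual ℝ V))
    (U : ExteriorAlgebra ℝ V) :
    contraction (w + w') U = contraction w U + contraction w' U := by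
  simp only [← contractionₗ_apply, map_add, LinearMap.add_apply]

theorem contraction_smul_left (r : ℝ) (w : ExteriorAlgebra ℝ (Module.Dual ℝ V))
    (U : ExteriorAlgebra ℝ V) : contraction (r • w) U = r • contraction w U := by
  simp only [← contractionₗ_apply, map_smul, LinearMap.smul_apply]

theorem contraction_mul (w θ : ExteriorAlgebra ℝ (Module.Dual ℝ V)) (U : ExteriorAlgebra ℝ V) :
    contraction (w * θ) U = contraction θ (contraction w U) := by
  simp only [contraction, map_mul, MulOpposite.unop_mul, Module.End.mul_apply]

theorem contraction_ι (α : Module.Dual ℝ V) (U : ExteriorAlgebra ℝ V) :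
    contraction (ExteriorAlgebra.ι ℝ α) U = interior α U := by
  simp only [contraction, contractionHom, ExteriorAlgebra.lift_ι_apply]
  rfl

theorem contraction_algebraMap (r : ℝ) (U : ExteriorAlgebra ℝ V) :
    contraction (algebraMap ℝ _ r) U = r • U := by
  simp only [contraction, AlgHom.commutes]
  rfl

theorem contraction_mem {p : ℕ} {w : ExteriorAlgebra ℝ (Module.Dual ℝ V)}
    (hw : w ∈ ⋀[ℝ]^p (Module.Dual ℝ V)) {k : ℕ} {U : ExteriorAlgebra ℝ V}
    (hU : U ∈ ⋀[ℝ]^(p + k) V) : contraction w U ∈ ⋀[ℝ]^k V := by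
  revert p w k U
  -- U and its degree have to vary in the induction, since contracting with the leading covector α
  -- replaces U by α ⌟ U.
  suffices ∀ p w, w ∈ ⋀[ℝ]^p (Module.Dual ℝ V) → ∀ k (U : ExteriorAlgebra ℝ V),
      U ∈ ⋀[ℝ]^(p + k) V → contraction w U ∈ ⋀[ℝ]^k V from fun {p w} hw {k U} => this p w hw k U
  refine exteriorPower_induction (fun r k U hU => ?_) ?_ ?_
  · rw [contraction_algebraMap]
    rw [zero_add] at hU
    exact Submodule.smul_mem _ _ hU
  · intro p w w' _ _ h h' k U hU
    rw [contraction_add_left]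
    exact Submodule.add_mem _ (h k U hU) (h' k U hU)
  · intro α p w _ h k U hU
    rw [contraction_mul, contraction_ι]
    refine h k _ (interior_mem α ?_)
    rwa [add_right_comm] at hU

theorem map_interior (f : V →ₗ[ℝ] W) (ξ : Module.Dual ℝ W) (a : ExteriorAlgebra ℝ V) :
    ExteriorAlgebra.map f (interior (f.dualMap ξ) a) = interior ξ (ExteriorAlgebra.map f a) := by
  induction a using CliffordAlgebra.left_induction with
  | algebraMap r =>
    change ExteriorAlgebra.map f (interior _ (algebraMap ℝ (ExteriorAlgebra ℝ V) r)) =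
      interior ξ (ExteriorAlgebra.map f (algebraMap ℝ (ExteriorAlgebra ℝ V) r))
    rw [AlgHom.commutes, interior_algebraMap, interior_algebraMap, map_zero]
  | add a b ha hb => simp only [map_add, ha, hb]
  | ι_mul a v ha =>
    change ExteriorAlgebra.map f (interior _ (ExteriorAlgebra.ι ℝ v * a)) =
      interior ξ (ExteriorAlgebra.map f (ExteriorAlgebra.ι ℝ v * a))
    rw [interior_ι_mul, map_mul, ExteriorAlgebra.map_apply_ι, interior_ι_mul, map_sub, map_mul,
      ExteriorAlgebra.map_apply_ι, ha, map_smul, LinearMap.dualMap_apply]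

/-- Naturality: a contraction in a fibre, seen in a trivialization, is the fixed contraction of the
model fibre. This is what makes contractions of smooth sections smooth. -/
theorem map_contraction (f : V →ₗ[ℝ] W) (w : ExteriorAlgebra ℝ (Module.Dual ℝ W))
    (U : ExteriorAlgebra ℝ V) :
    ExteriorAlgebra.map f (contraction (ExteriorAlgebra.map f.dualMap w) U) =
      contraction w (ExteriorAlgebra.map f U) := by
  induction w using ExteriorAlgebra.induction generalizing U with
  | algebraMap r => rw [AlgHom.commutes, contraction_algebraMap, contraction_algebraMap, map_smul]
  | ι α => rw [ExteriorAlgebra.map_apply_ι, contraction_ι, contraction_ι, map_interior]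
  | mul a b ha hb => rw [map_mul, contraction_mul, hb, ha, contraction_mul]
  | add a b ha hb => rw [map_add, contraction_add_left, map_add, ha, hb, contraction_add_left]

/-- `v ∧ (w ⌟ U) = (-1)^p (w ⌟ (v ∧ U) - (v ⌟ w) ⌟ U)` for `w ∈ ∧^p V*`. -/
theorem ι_mul_contraction (v : V) {p : ℕ} {w : ExteriorAlgebra ℝ (Module.Dual ℝ V)}
    (hw : w ∈ ⋀[ℝ]^p (Module.Dual ℝ V)) (U : ExteriorAlgebra ℝ V) :
    ExteriorAlgebra.ι ℝ v * contraction w U = (-1 : ℝ) ^ p •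
      (contraction w (ExteriorAlgebra.ι ℝ v * U) -
        contraction (interior (Module.Dual.eval ℝ V v) w) U) := by
  revert p w U
  suffices ∀ p w, w ∈ ⋀[ℝ]^p (Module.Dual ℝ V) → ∀ U : ExteriorAlgebra ℝ V,
      ExteriorAlgebra.ι ℝ v * contraction w U = (-1 : ℝ) ^ p •
        (contraction w (ExteriorAlgebra.ι ℝ v * U) -
          contraction (interior (Module.Dual.eval ℝ V v) w) U) from fun {p w} hw => this p w hw
  refine exteriorPower_induction (fun r U => ?_) ?_ ?_
  · have h0 : contraction (0 : ExteriorAlgebra ℝ (Module.Dual ℝ V)) U = 0 := by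
      simp only [← contractionₗ_apply, map_zero, LinearMap.zero_apply]
    rw [contraction_algebraMap, contraction_algebraMap, interior_algebraMap, pow_zero, one_smul,
      mul_smul_comm, h0, sub_zero]
  · intro p w w' _ _ h h' U
    simp only [contraction_add_left, mul_add, map_add, h, h', ← smul_add]
    congr 1
    abel
  · intro α p w _ h U
    have h1 : contraction (interior (Module.Dual.eval ℝ V v) (ExteriorAlgebra.ι ℝ α * w)) U =
        α v • contraction w U -
          contraction (interior (Module.Dual.eval ℝ V v) w) (interior α U) := by
      rw [interior_ι_mul, Module.Dual.eval_apply, sub_eq_add_neg, contraction_add_left,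
        contraction_smul_left, ← neg_one_smul ℝ, contraction_smul_left, contraction_mul,
        contraction_ι, neg_one_smul, ← sub_eq_add_neg]
    -- The induction hypothesis is used at α ⌟ U, together with v ∧ (α ⌟ U) = α(v) U - α ⌟ (v ∧ U).
    rw [h1, contraction_mul, contraction_mul, contraction_ι, contraction_ι, h, interior_ι_mul,
      ← contractionₗ_apply w (α v • U - _), map_sub, map_smul, contractionₗ_apply,
      contractionₗ_apply, pow_succ, mul_neg_one, neg_smul, ← smul_neg]
    congr 1
    abel

end Contraction

/-! ### The pairing of forms and vectors -/

section Pairing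

variable {V : Type*} [AddCommGroup V] [Module ℝ V]

/-- For decomposable a this is the Laplace expansion of a determinant along its first column, which
holds the numbers α(vᵢ). The general case follows by linearity. -/
theorem pairingDual_ι_mul {k : ℕ} (α : Module.Dual ℝ V) {a : ExteriorAlgebra ℝ (Module.Dual ℝ V)}
    (ha : a ∈ ⋀[ℝ]^k (Module.Dual ℝ V)) (v : Fin (k + 1) → V) :
    exteriorPower.pairingDual ℝ V (k + 1) ⟨ExteriorAlgebra.ι ℝ α * a, ι_mul_mem α ha⟩
      (exteriorPower.ιMulti ℝ (k + 1) v) =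
    ∑ i : Fin (k + 1), (-1 : ℝ) ^ (i : ℕ) * α (v i) *
      exteriorPower.pairingDual ℝ V k ⟨a, ha⟩ (exteriorPower.ιMulti ℝ k fun l => v (i.succAbove l)) := by
  have h1 : (⟨a, ha⟩ : ⋀[ℝ]^k (Module.Dual ℝ V)) ∈
      Submodule.span ℝ (Set.range (exteriorPower.ιMulti ℝ k (M := Module.Dual ℝ V))) := by
    rw [exteriorPower.ιMulti_span]
    trivial
  suffices ∀ b : ⋀[ℝ]^k (Module.Dual ℝ V), b ∈
      Submodule.span ℝ (Set.range (exteriorPower.ιMulti ℝ k (M := Module.Dual ℝ V))) →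
    exteriorPower.pairingDual ℝ V (k + 1) ⟨ExteriorAlgebra.ι ℝ α * b.1, ι_mul_mem α b.2⟩
      (exteriorPower.ιMulti ℝ (k + 1) v) =
    ∑ i : Fin (k + 1), (-1 : ℝ) ^ (i : ℕ) * α (v i) *
      exteriorPower.pairingDual ℝ V k b (exteriorPower.ιMulti ℝ k fun l => v (i.succAbove l)) from
    this _ h1
  intro b hb
  induction hb using Submodule.span_induction with
  | mem b hb =>
    obtain ⟨β, rfl⟩ := hb
    have h2 : (⟨ExteriorAlgebra.ι ℝ α * (exteriorPower.ιMulti ℝ k β).1,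
        ι_mul_mem α (exteriorPower.ιMulti ℝ k β).2⟩ : ⋀[ℝ]^(k + 1) (Module.Dual ℝ V)) =
        exteriorPower.ιMulti ℝ (k + 1) (Fin.cons α β) := by
      apply Subtype.ext
      simp [exteriorPower.ιMulti_apply_coe, ExteriorAlgebra.ιMulti_succ_apply, Matrix.vecTail,
        Function.comp_def]
    rw [h2, exteriorPower.pairingDual_ιMulti_ιMulti, Matrix.det_succ_column_zero]
    refine Finset.sum_congr rfl fun i _ => ?_
    rw [exteriorPower.pairingDual_ιMulti_ιMulti]
    rfl
  | zero =>
    have h2 : (⟨ExteriorAlgebra.ι ℝ α * (0 : ⋀[ℝ]^k (Module.Dual ℝ V)).1,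
        ι_mul_mem α (0 : ⋀[ℝ]^k (Module.Dual ℝ V)).2⟩ : ⋀[ℝ]^(k + 1) (Module.Dual ℝ V)) = 0 :=
      Subtype.ext (mul_zero _)
    rw [h2]
    simp
  | add b c _ _ hb hc =>
    have h2 : (⟨ExteriorAlgebra.ι ℝ α * (b + c).1, ι_mul_mem α (b + c).2⟩ :
        ⋀[ℝ]^(k + 1) (Module.Dual ℝ V)) = ⟨_, ι_mul_mem α b.2⟩ + ⟨_, ι_mul_mem α c.2⟩ :=
      Subtype.ext (mul_add _ _ _)
    rw [h2, map_add, LinearMap.add_apply, hb, hc, ← Finset.sum_add_distrib]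
    simp [mul_add]
  | smul r b _ hb =>
    have h2 : (⟨ExteriorAlgebra.ι ℝ α * (r • b).1, ι_mul_mem α (r • b).2⟩ :
        ⋀[ℝ]^(k + 1) (Module.Dual ℝ V)) = r • ⟨_, ι_mul_mem α b.2⟩ :=
      Subtype.ext (mul_smul_comm _ _ _)
    rw [h2, map_smul, LinearMap.smul_apply, hb, smul_eq_mul, Finset.mul_sum]
    refine Finset.sum_congr rfl fun i _ => ?_
    rw [map_smul, LinearMap.smul_apply, smul_eq_mul]
    ring

/-- Evaluating a form on vectors amounts to taking the interior product by the first one. -/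
theorem pairingDual_cons {k : ℕ} {w : ExteriorAlgebra ℝ (Module.Dual ℝ V)}
    (hw : w ∈ ⋀[ℝ]^(k + 1) (Module.Dual ℝ V)) (u : V) (v : Fin k → V) :
    exteriorPower.pairingDual ℝ V (k + 1) ⟨w, hw⟩
      (exteriorPower.ιMulti ℝ (k + 1) (Fin.cons u v : Fin (k + 1) → V)) =
    exteriorPower.pairingDual ℝ V k ⟨interior (Module.Dual.eval ℝ V u) w, interior_mem _ hw⟩
      (exteriorPower.ιMulti ℝ k v) := by
  -- The degree is made a free variable m, with the equation m = k + 1 carried along, so that the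
  -- induction on exterior powers applies.
  suffices ∀ m w (hw : w ∈ ⋀[ℝ]^m (Module.Dual ℝ V)) k (e : m = k + 1) (v : Fin k → V),
      exteriorPower.pairingDual ℝ V (k + 1) ⟨w, e ▸ hw⟩
        (exteriorPower.ιMulti ℝ (k + 1) (Fin.cons u v : Fin (k + 1) → V)) =
      exteriorPower.pairingDual ℝ V k
        ⟨interior (Module.Dual.eval ℝ V u) w, interior_mem _ (e ▸ hw)⟩
        (exteriorPower.ιMulti ℝ k v) from this _ w hw k rfl v
  clear hw w v k
  refine exteriorPower_induction (by simp) ?_ ?_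
  · intro m a b ha hb h h' k e v
    subst e
    have h1 := congrArg₂ (· + ·) (h k rfl v) (h' k rfl v)
    simp only [← LinearMap.add_apply, ← map_add] at h1
    refine h1.trans ?_
    congr 3
    exact Subtype.ext (map_add _ _ _).symm
  · intro α m a ha h k e v
    obtain rfl : m = k := by omega
    rw [pairingDual_ι_mul α ha, Fin.sum_univ_succ]
    simp only [Fin.cons_zero, Fin.cons_succ, Fin.zero_succAbove, Fin.val_zero, pow_zero, one_mul]
    rcases m with _ | m
    · simp only [Finset.univ_eq_empty, Finset.sum_empty, add_zero]
      have h1 : (⟨interior (Module.Dual.eval ℝ V u) (ExteriorAlgebra.ι ℝ α * a),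
          interior_mem _ (ι_mul_mem α ha)⟩ : ⋀[ℝ]^0 (Module.Dual ℝ V)) = α u • ⟨a, ha⟩ := by
        apply Subtype.ext
        refine (interior_ι_mul _ _ _).trans ?_
        rw [interior_eq_zero _ ha, mul_zero, sub_zero]
        rfl
      rw [h1, map_smul, LinearMap.smul_apply, smul_eq_mul]
    · have h1 : (⟨interior (Module.Dual.eval ℝ V u) (ExteriorAlgebra.ι ℝ α * a),
          interior_mem _ (ι_mul_mem α ha)⟩ : ⋀[ℝ]^(m + 1) (Module.Dual ℝ V)) =
          α u • ⟨a, ha⟩ - ⟨_, ι_mul_mem α (interior_mem (Module.Dual.eval ℝ V u) ha)⟩ := by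
        exact Subtype.ext (interior_ι_mul _ _ _)
      rw [h1, map_sub, map_smul, LinearMap.sub_apply, LinearMap.smul_apply, smul_eq_mul,
        pairingDual_ι_mul α (interior_mem _ ha), sub_eq_add_neg, ← Finset.sum_neg_distrib]
      congr 1
      refine Finset.sum_congr rfl fun i _ => ?_
      -- Omitting a vector other than u leaves u in front, so the induction hypothesis applies to a.
      -- The shift of the index by one supplies the minus sign of the antiderivation rule.
      have h2 : (fun l => (Fin.cons u v : Fin (m + 2) → V) (i.succ.succAbove l)) =
          Fin.cons u fun l => v (i.succAbove l) := by
        funext l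
        refine Fin.cases ?_ (fun l => ?_) l
        · simp
        · simp
      rw [h2, h m rfl, Fin.val_succ, pow_succ]
      ring

theorem pairingDual_algebraMap (r : ℝ) (v : Fin 0 → V) :
    exteriorPower.pairingDual ℝ V 0 ⟨algebraMap ℝ _ r, algebraMap_mem_exteriorPower_zero r⟩
      (exteriorPower.ιMulti ℝ 0 v) = r := by
  have h : (⟨algebraMap ℝ _ r, algebraMap_mem_exteriorPower_zero r⟩ :
      ⋀[ℝ]^0 (Module.Dual ℝ V)) = r • exteriorPower.ιMulti ℝ 0 Fin.elim0 := by
    apply Subtype.ext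
    refine (Algebra.algebraMap_eq_smul_one r).trans ?_
    exact congrArg (r • ·) (ExteriorAlgebra.ιMulti_zero_apply _).symm
  rw [h, map_smul, LinearMap.smul_apply, exteriorPower.pairingDual_ιMulti_ιMulti]
  simp

end Pairing

/-! ### Cartan calculus over a Lie–Rinehart algebra -/

/-- A Lie–Rinehart algebra `Γ` over `R`, together with a graded module `Ω` of forms on which `Γ`
acts by interior products, such that a form of positive degree amounts to an alternating family of
interior products. -/
structure LieRinehartForms (R Γ : Type*) [CommRing R] [Algebra ℝ R] [AddCommGroup Γ] [Module R Γ]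
    (Ω : ℕ → Type*) [∀ k, AddCommGroup (Ω k)] [∀ k, Module R (Ω k)] where
  der : Γ →ₗ[R] Derivation ℝ R R
  br : Γ →+ Γ →+ Γ
  br_self : ∀ X, br X X = 0
  jacobi : ∀ X Y Z, br X (br Y Z) = br (br X Y) Z + br Y (br X Z)
  br_smul : ∀ X f Y, br X (f • Y) = f • br X Y + der X f • Y
  der_br : ∀ X Y f, der (br X Y) f = der X (der Y f) - der Y (der X f)
  int : ∀ k, Γ →ₗ[R] Ω (k + 1) →ₗ[R] Ω k
  int_int_self : ∀ k X w, int k X (int (k + 1) X w) = 0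
  eq_zero_of_int : ∀ k (w : Ω (k + 1)), (∀ X, int k X w = 0) → w = 0
  exists_int_zero : ∀ Φ : Γ →ₗ[R] Ω 0, ∃ θ, ∀ X, int 0 X θ = Φ X
  exists_int_succ : ∀ k, ∀ Φ : Γ →ₗ[R] Ω (k + 1), (∀ X, int k X (Φ X) = 0) →
    ∃ θ, ∀ X, int (k + 1) X θ = Φ X
  fn : Ω 0 ≃ₗ[R] R

namespace LieRinehartForms

variable {R Γ : Type*} [CommRing R] [Algebra ℝ R] [AddCommGroup Γ] [Module R Γ]
  {Ω : ℕ → Type*} [∀ k, AddCommGroup (Ω k)] [∀ k, Module R (Ω k)] (C : LieRinehartForms R Γ Ω)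

theorem ext_int {k : ℕ} {w w' : Ω (k + 1)} (h : ∀ X, C.int k X w = C.int k X w') : w = w' :=
  sub_eq_zero.mp (C.eq_zero_of_int k _ fun X => by rw [map_sub, h, sub_self])

theorem br_skew (X Y : Γ) : C.br X Y = -C.br Y X := by
  have h := C.br_self (X + Y)
  simp only [map_add, AddMonoidHom.add_apply, C.br_self, zero_add, add_zero] at h
  exact eq_neg_of_add_eq_zero_right h

theorem smul_br (f : R) (X Y : Γ) : C.br (f • X) Y = f • C.br X Y - C.der Y f • X := by
  rw [br_skew, br_smul, C.br_skew X Y, neg_add, smul_neg, sub_eq_add_neg]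

theorem int_int_skew {k : ℕ} (X Y : Γ) (w : Ω (k + 2)) :
    C.int k X (C.int (k + 1) Y w) = -C.int k Y (C.int (k + 1) X w) := by
  have h := C.int_int_self k (X + Y) w
  simp only [map_add, LinearMap.add_apply, C.int_int_self, zero_add, add_zero] at h
  exact eq_neg_of_add_eq_zero_right h

/-! #### Lie derivatives -/

/-- The Lie derivative of a form. -/
def lie (X : Γ) : ∀ k, Ω k → Ω k
  | 0, w => C.fn.symm (C.der X (C.fn w))
  | k + 1, w => @Classical.epsilon _ ⟨w⟩ fun θ =>
      ∀ Y, C.int k Y θ = lie X k (C.int k Y w) - C.int k (C.br X Y) w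

theorem fn_lie (X : Γ) (w : Ω 0) : C.fn (C.lie X 0 w) = C.der X (C.fn w) :=
  C.fn.apply_symm_apply _

/-- The three properties feed each other, hence the joint induction. The defining equation in degree
k + 1 is solvable only if its right side is R-linear in Y, which needs additivity and the Leibniz
rule in degree k: the derivative of a coefficient of Y cancels against the extra term of the
bracket. Above degree one the right side must also be alternating, which needs the rule for interior
products one degree lower. -/
theorem lie_spec (X : Γ) (k : ℕ) :
    (∀ w w' : Ω k, C.lie X k (w + w') = C.lie X k w + C.lie X k w') ∧
    (∀ f, ∀ w : Ω k, C.lie X k (f • w) = f • C.lie X k w + C.der X f • w) ∧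
    ∀ Y, ∀ w : Ω (k + 1),
      C.int k Y (C.lie X (k + 1) w) = C.lie X k (C.int k Y w) - C.int k (C.br X Y) w := by
  have linear : ∀ k,
      (∀ w w' : Ω k, C.lie X k (w + w') = C.lie X k w + C.lie X k w') →
      (∀ f, ∀ w : Ω k, C.lie X k (f • w) = f • C.lie X k w + C.der X f • w) → ∀ w : Ω (k + 1),
      ∃ Φ : Γ →ₗ[R] Ω k, ∀ Y, Φ Y = C.lie X k (C.int k Y w) - C.int k (C.br X Y) w := by
    intro k hadd hsmul w
    refine ⟨⟨⟨fun Y => C.lie X k (C.int k Y w) - C.int k (C.br X Y) w, fun Y Z => ?_⟩,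
      fun f Y => ?_⟩, fun Y => rfl⟩
    · simp only [map_add, LinearMap.add_apply, hadd]
      abel
    · simp only [br_smul, map_smul, map_add, LinearMap.smul_apply, LinearMap.add_apply, hsmul,
        RingHom.id_apply, smul_sub]
      abel
  have zero : ∀ k,
      (∀ w w' : Ω k, C.lie X k (w + w') = C.lie X k w + C.lie X k w') → C.lie X k 0 = 0 := by
    intro k hadd
    simpa using hadd 0 0
  induction k with
  | zero =>
    have hadd : ∀ w w' : Ω 0, C.lie X 0 (w + w') = C.lie X 0 w + C.lie X 0 w' := by
      intro w w'
      simp only [lie, map_add]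
    have hsmul : ∀ f, ∀ w : Ω 0, C.lie X 0 (f • w) = f • C.lie X 0 w + C.der X f • w := by
      intro f w
      apply C.fn.injective
      simp only [fn_lie, map_smul, map_add, smul_eq_mul, Derivation.leibniz]
      ring
    refine ⟨hadd, hsmul, fun Y w => ?_⟩
    obtain ⟨Φ, hΦ⟩ := linear 0 hadd hsmul w
    have h := C.exists_int_zero Φ
    simp only [hΦ] at h
    exact Classical.epsilon_spec h Y
  | succ k ih =>
    obtain ⟨hadd, hsmul, hint⟩ := ih
    have hadd' : ∀ w w' : Ω (k + 1),
        C.lie X (k + 1) (w + w') = C.lie X (k + 1) w + C.lie X (k + 1) w' := by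
      intro w w'
      refine C.ext_int fun Y => ?_
      simp only [map_add, hint, hadd]
      abel
    have hsmul' : ∀ f, ∀ w : Ω (k + 1),
        C.lie X (k + 1) (f • w) = f • C.lie X (k + 1) w + C.der X f • w := by
      intro f w
      refine C.ext_int fun Y => ?_
      simp only [map_add, map_smul, hint, hsmul, smul_sub]
      abel
    refine ⟨hadd', hsmul', fun Y w => ?_⟩
    obtain ⟨Φ, hΦ⟩ := linear (k + 1) hadd' hsmul' w
    have h := C.exists_int_succ k Φ fun Y => by
      rw [hΦ, map_sub, hint, C.int_int_self, zero k hadd, C.int_int_skew Y]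
      abel
    simp only [hΦ] at h
    exact Classical.epsilon_spec h Y

theorem lie_add (X : Γ) {k : ℕ} (w w' : Ω k) :
    C.lie X k (w + w') = C.lie X k w + C.lie X k w' := (C.lie_spec X k).1 w w'

theorem lie_smul (X : Γ) {k : ℕ} (f : R) (w : Ω k) :
    C.lie X k (f • w) = f • C.lie X k w + C.der X f • w := (C.lie_spec X k).2.1 f w

theorem int_lie (X Y : Γ) {k : ℕ} (w : Ω (k + 1)) :
    C.int k Y (C.lie X (k + 1) w) = C.lie X k (C.int k Y w) - C.int k (C.br X Y) w :=
  (C.lie_spec X k).2.2 Y w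

theorem lie_zero (X : Γ) {k : ℕ} : C.lie X k (0 : Ω k) = 0 := by
  simpa using C.lie_add X (0 : Ω k) 0

theorem lie_neg (X : Γ) {k : ℕ} (w : Ω k) : C.lie X k (-w) = -C.lie X k w :=
  eq_neg_of_add_eq_zero_left (by rw [← lie_add, neg_add_cancel, lie_zero])

theorem lie_sub (X : Γ) {k : ℕ} (w w' : Ω k) :
    C.lie X k (w - w') = C.lie X k w - C.lie X k w' := by
  rw [sub_eq_add_neg, lie_add, lie_neg, sub_eq_add_neg]

theorem add_lie (X Y : Γ) {k : ℕ} (w : Ω k) :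
    C.lie (X + Y) k w = C.lie X k w + C.lie Y k w := by
  induction k with
  | zero =>
    apply C.fn.injective
    simp only [fn_lie, map_add, Derivation.add_apply]
  | succ k ih =>
    refine C.ext_int fun Z => ?_
    simp only [map_add, int_lie, ih, AddMonoidHom.add_apply, LinearMap.add_apply]
    abel

/-- On functions it says that `der` respects brackets. Interior products lower the degree, and the
terms they leave cancel by the Jacobi identity. -/
theorem lie_br (X Y : Γ) {k : ℕ} (w : Ω k) :
    C.lie (C.br X Y) k w = C.lie X k (C.lie Y k w) - C.lie Y k (C.lie X k w) := by
  induction k with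
  | zero =>
    apply C.fn.injective
    simp only [fn_lie, map_sub, C.der_br]
  | succ k ih =>
    refine C.ext_int fun Z => ?_
    simp only [map_sub, int_lie, ih, lie_sub, C.jacobi X Y Z, map_add, LinearMap.add_apply]
    abel

/-! #### The coboundary -/

/-- The coboundary of a form. -/
def diff : ∀ k, Ω k → Ω (k + 1)
  | 0, w => Classical.epsilon fun θ => ∀ X, C.int 0 X θ = C.lie X 0 w
  | k + 1, w => Classical.epsilon fun θ =>
      ∀ X, C.int (k + 1) X θ = C.lie X (k + 1) w - diff k (C.int k X w)

theorem int_diff_zero (X : Γ) (w : Ω 0) : C.int 0 X (C.diff 0 w) = C.lie X 0 w := by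
  refine @Classical.epsilon_spec _ (fun θ => ∀ X, C.int 0 X θ = _) ?_ X
  refine C.exists_int_zero ⟨⟨fun X => C.lie X 0 w, fun X Y => C.add_lie X Y w⟩, fun f X => ?_⟩
  apply C.fn.injective
  simp [fn_lie]

/-- Again a joint induction. The middle clause, L_{fX} = f L_X + df ∧ i_X with df ∧ · written as the
commutator of d and f, is exactly what makes L_X w - d(i_X w) linear in X over R. Its alternation
follows from i_X L_X = L_X i_X and from Cartan's formula one degree lower. -/
theorem diff_spec (k : ℕ) :
    (∀ w w' : Ω k, C.diff k (w + w') = C.diff k w + C.diff k w') ∧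
    (∀ (f : R) (X : Γ) (w : Ω (k + 1)), C.lie (f • X) (k + 1) w = f • C.lie X (k + 1) w +
      (C.diff k (f • C.int k X w) - f • C.diff k (C.int k X w))) ∧
    ∀ X, ∀ w : Ω (k + 1),
      C.int (k + 1) X (C.diff (k + 1) w) = C.lie X (k + 1) w - C.diff k (C.int k X w) := by
  have linear : ∀ k,
      (∀ w w' : Ω k, C.diff k (w + w') = C.diff k w + C.diff k w') →
      (∀ (f : R) (X : Γ) (w : Ω (k + 1)), C.lie (f • X) (k + 1) w = f • C.lie X (k + 1) w +
        (C.diff k (f • C.int k X w) - f • C.diff k (C.int k X w))) → ∀ w : Ω (k + 1),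
      ∃ Φ : Γ →ₗ[R] Ω (k + 1), ∀ X, Φ X = C.lie X (k + 1) w - C.diff k (C.int k X w) := by
    intro k hadd hsmul w
    refine ⟨⟨⟨fun X => C.lie X (k + 1) w - C.diff k (C.int k X w), fun X Y => ?_⟩,
      fun f X => ?_⟩, fun X => rfl⟩
    · simp only [map_add, LinearMap.add_apply, hadd, add_lie]
      abel
    · simp only [map_smul, LinearMap.smul_apply, hsmul, RingHom.id_apply, smul_sub]
      abel
  induction k with
  | zero =>
    have hadd : ∀ w w' : Ω 0, C.diff 0 (w + w') = C.diff 0 w + C.diff 0 w' := by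
      intro w w'
      refine C.ext_int fun X => ?_
      simp only [map_add, int_diff_zero, lie_add]
    have hsmul : ∀ (f : R) (X : Γ) (w : Ω 1), C.lie (f • X) 1 w = f • C.lie X 1 w +
        (C.diff 0 (f • C.int 0 X w) - f • C.diff 0 (C.int 0 X w)) := by
      intro f X w
      have h0 : ∀ η : Ω 0, C.lie (f • X) 0 η = f • C.lie X 0 η := by
        intro η
        apply C.fn.injective
        simp [fn_lie]
      refine C.ext_int fun Y => ?_
      simp only [map_add, map_sub, map_smul, int_lie, int_diff_zero, lie_smul, h0, smul_br,
        LinearMap.sub_apply, LinearMap.smul_apply, smul_sub]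
      abel
    refine ⟨hadd, hsmul, fun X w => ?_⟩
    obtain ⟨Φ, hΦ⟩ := linear 0 hadd hsmul w
    have h := C.exists_int_succ 0 Φ fun X => by
      rw [hΦ, map_sub, int_lie, int_diff_zero, C.br_self, map_zero, LinearMap.zero_apply]
      abel
    simp only [hΦ] at h
    exact Classical.epsilon_spec h X
  | succ k ih =>
    obtain ⟨hadd, hsmul, hint⟩ := ih
    have hzero : C.diff k 0 = 0 := by simpa using hadd 0 0
    have hneg : ∀ w, C.diff k (-w) = -C.diff k w := fun w =>
      eq_neg_of_add_eq_zero_left (by rw [← hadd, neg_add_cancel, hzero])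
    have hadd' : ∀ w w' : Ω (k + 1),
        C.diff (k + 1) (w + w') = C.diff (k + 1) w + C.diff (k + 1) w' := by
      intro w w'
      refine C.ext_int fun X => ?_
      simp only [map_add, hint, lie_add, hadd]
      abel
    have hsmul' : ∀ (f : R) (X : Γ) (w : Ω (k + 2)), C.lie (f • X) (k + 2) w = f • C.lie X (k + 2) w +
        (C.diff (k + 1) (f • C.int (k + 1) X w) - f • C.diff (k + 1) (C.int (k + 1) X w)) := by
      intro f X w
      refine C.ext_int fun Y => ?_
      simp only [map_add, map_sub, map_smul, int_lie, hint, lie_smul, smul_br, hsmul,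
        LinearMap.sub_apply, LinearMap.smul_apply, smul_sub, C.int_int_skew X Y, smul_neg, hneg]
      abel
    refine ⟨hadd', hsmul', fun X w => ?_⟩
    obtain ⟨Φ, hΦ⟩ := linear (k + 1) hadd' hsmul' w
    have h := C.exists_int_succ (k + 1) Φ fun X => by
      rw [hΦ, map_sub, int_lie, hint, C.br_self, map_zero, LinearMap.zero_apply, C.int_int_self,
        hzero]
      abel
    simp only [hΦ] at h
    exact Classical.epsilon_spec h X

theorem diff_add {k : ℕ} (w w' : Ω k) : C.diff k (w + w') = C.diff k w + C.diff k w' :=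
  (C.diff_spec k).1 w w'

/-- Cartan's formula. -/
theorem int_diff (X : Γ) {k : ℕ} (w : Ω (k + 1)) :
    C.int (k + 1) X (C.diff (k + 1) w) = C.lie X (k + 1) w - C.diff k (C.int k X w) :=
  (C.diff_spec k).2.2 X w

theorem diff_zero {k : ℕ} : C.diff k (0 : Ω k) = 0 := by
  simpa using C.diff_add (0 : Ω k) 0

theorem diff_neg {k : ℕ} (w : Ω k) : C.diff k (-w) = -C.diff k w :=
  eq_neg_of_add_eq_zero_left (by rw [← diff_add, neg_add_cancel, diff_zero])

theorem diff_sub {k : ℕ} (w w' : Ω k) : C.diff k (w - w') = C.diff k w - C.diff k w' := by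
  rw [sub_eq_add_neg, diff_add, diff_neg, sub_eq_add_neg]

/-- Compare interior products with Y: Cartan's formula leaves the identity for i_Y w, known by
induction, and the bracket relation of Lie derivatives. -/
theorem diff_lie (X : Γ) {k : ℕ} (w : Ω k) :
    C.diff k (C.lie X k w) = C.lie X (k + 1) (C.diff k w) := by
  induction k with
  | zero =>
    refine C.ext_int fun Y => ?_
    rw [int_diff_zero, int_lie, int_diff_zero, int_diff_zero, lie_br]
    abel
  | succ k ih =>
    refine C.ext_int fun Y => ?_
    rw [int_diff, int_lie, int_lie, int_diff, int_diff, diff_sub, ih, lie_br, lie_sub]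
    abel

/-- By Cartan's formula i_Y d d = L_Y d - d(L_Y - d i_Y), which vanishes because d commutes with L_Y
and because d d = 0 one degree lower. -/
theorem diff_diff {k : ℕ} (w : Ω k) : C.diff (k + 1) (C.diff k w) = 0 := by
  induction k with
  | zero =>
    refine C.ext_int fun Y => ?_
    rw [int_diff, int_diff_zero, diff_lie, sub_self, map_zero]
  | succ k ih =>
    refine C.ext_int fun Y => ?_
    rw [int_diff, int_diff, diff_sub, ih, diff_lie, sub_zero, sub_self, map_zero]

/-- The commutator of the coboundary with the multiplication by a function. -/
def diffComm (f : R) (k : ℕ) (w : Ω k) : Ω (k + 1) := C.diff k (f • w) - f • C.diff k w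

theorem int_diffComm_zero (f : R) (X : Γ) (w : Ω 0) :
    C.int 0 X (C.diffComm f 0 w) = C.der X f • w := by
  rw [diffComm, map_sub, map_smul, int_diff_zero, int_diff_zero, lie_smul]
  abel

theorem int_diffComm (f : R) (X : Γ) {k : ℕ} (w : Ω (k + 1)) :
    C.int (k + 1) X (C.diffComm f (k + 1) w) =
      C.der X f • w - C.diffComm f k (C.int k X w) := by
  rw [diffComm, map_sub, map_smul, int_diff, int_diff, lie_smul, diffComm, map_smul, smul_sub]
  abel

/-- The commutator is the product by df. Forms carry no product in this setting, so its R-linearity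
is obtained from its interior products. -/
theorem diffComm_smul (f g : R) {k : ℕ} (w : Ω k) :
    C.diffComm f k (g • w) = g • C.diffComm f k w := by
  induction k with
  | zero =>
    refine C.ext_int fun X => ?_
    rw [map_smul, int_diffComm_zero, int_diffComm_zero, smul_comm]
  | succ k ih =>
    refine C.ext_int fun X => ?_
    rw [map_smul, int_diffComm, int_diffComm, map_smul, ih, smul_sub, smul_comm]

/-- Serves for real constants, where it gives the ℝ-linearity of the coboundary. -/
theorem diff_smul_of_der_eq_zero {f : R} (hf : ∀ X, C.der X f = 0) {k : ℕ} (w : Ω k) :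
    C.diff k (f • w) = f • C.diff k w := by
  suffices C.diffComm f k w = 0 from sub_eq_zero.mp this
  induction k with
  | zero =>
    refine C.ext_int fun X => ?_
    rw [int_diffComm_zero, hf, zero_smul, map_zero]
  | succ k ih =>
    refine C.ext_int fun X => ?_
    rw [int_diffComm, ih, hf, zero_smul, map_zero, sub_zero]

/-- The coboundary as a linear map. -/
def diffₗ [∀ k, Module ℝ (Ω k)] [∀ k, IsScalarTower ℝ R (Ω k)] (k : ℕ) :
    Ω k →ₗ[ℝ] Ω (k + 1) where
  toFun := C.diff k
  map_add' := C.diff_add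
  map_smul' r w := by
    rw [← algebraMap_smul R r w, C.diff_smul_of_der_eq_zero (fun X => (C.der X).map_algebraMap r),
      algebraMap_smul, RingHom.id_apply]

end LieRinehartForms

/-! ### Graded algebras generated locally in degrees zero and one -/

/-- A graded commutative algebra whose part of degree zero is `R` and which is generated, locally
at each point of `P`, by `R` and by the image of `Γ` in degree one. The functions in
`nonvanishing x` play the role of those that do not vanish at `x`. -/
structure Multivectors (R Γ : Type*) [CommRing R] [Algebra ℝ R] [AddCommGroup Γ] [Module R Γ]
    {𝒜 : Type*} [Ring 𝒜] [Algebra ℝ 𝒜] (𝒢 : ℕ → Submodule ℝ 𝒜) (P : Type*) where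
  fn : R →ₐ[ℝ] 𝒜
  fn_mem : ∀ f, fn f ∈ 𝒢 0
  exists_fn : ∀ a ∈ 𝒢 0, ∃ f, fn f = a
  fn_comm : ∀ f a, fn f * a = a * fn f
  sec : Γ →+ 𝒜
  sec_mem : ∀ X, sec X ∈ 𝒢 1
  sec_smul : ∀ f X, sec (f • X) = fn f * sec X
  mul_comm : ∀ p q, ∀ a ∈ 𝒢 p, ∀ b ∈ 𝒢 q, a * b = (-1 : ℝ) ^ (p * q) • (b * a)
  nonvanishing : P → Submonoid R
  eq_zero_of_local : ∀ a, (∀ x, ∃ φ ∈ nonvanishing x, fn φ * a = 0) → a = 0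
  -- χ acts as 1 wherever φ does not vanish, so a - χ a is killed by φ while χ a is an honest global
  -- sum of products.
  exists_local : ∀ x, ∃ φ ∈ nonvanishing x, ∃ χ, φ * χ = φ ∧ ∀ p, ∀ a ∈ 𝒢 (p + 1),
    ∃ (m : ℕ) (e : Fin m → Γ) (b : Fin m → 𝒜), (∀ i, b i ∈ 𝒢 p) ∧
      fn χ * a = ∑ i, sec (e i) * b i

namespace Multivectors

variable {R Γ : Type*} [CommRing R] [Algebra ℝ R] [AddCommGroup Γ] [Module R Γ]
  {𝒜 : Type*} [Ring 𝒜] [Algebra ℝ 𝒜] {𝒢 : ℕ → Submodule ℝ 𝒜} {P : Type*}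
  (V : Multivectors R Γ 𝒢 P)

/-- The elements that vanish near `x`. -/
def germZero (x : P) : Submodule ℝ 𝒜 where
  carrier := {u | ∃ φ ∈ V.nonvanishing x, V.fn φ * u = 0}
  zero_mem' := ⟨1, one_mem _, mul_zero _⟩
  add_mem' := by
    rintro u v ⟨φ, hφ, hu⟩ ⟨ψ, hψ, hv⟩
    refine ⟨φ * ψ, mul_mem hφ hψ, ?_⟩
    rw [mul_add, map_mul, mul_assoc, mul_assoc, hv, mul_zero, add_zero, ← mul_assoc,
      V.fn_comm φ (V.fn ψ), mul_assoc, hu, mul_zero]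
  smul_mem' := by
    rintro r u ⟨φ, hφ, hu⟩
    exact ⟨φ, hφ, by rw [mul_smul_comm, hu, smul_zero]⟩

theorem mul_mem_germZero {x : P} (a : 𝒜) {u : 𝒜} (hu : u ∈ V.germZero x) :
    a * u ∈ V.germZero x := by
  obtain ⟨φ, hφ, hu⟩ := hu
  exact ⟨φ, hφ, by rw [← mul_assoc, V.fn_comm, mul_assoc, hu, mul_zero]⟩

theorem mem_germZero_mul {x : P} (a : 𝒜) {u : 𝒜} (hu : u ∈ V.germZero x) :
    u * a ∈ V.germZero x := by
  obtain ⟨φ, hφ, hu⟩ := hu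
  exact ⟨φ, hφ, by rw [← mul_assoc, hu, zero_mul]⟩

theorem eq_zero_of_mem_germZero {a : 𝒜} (h : ∀ x, a ∈ V.germZero x) : a = 0 :=
  V.eq_zero_of_local a h

variable [GradedAlgebra 𝒢]

theorem sec_mul_mem (X : Γ) {p : ℕ} {a : 𝒜} (ha : a ∈ 𝒢 p) : V.sec X * a ∈ 𝒢 (p + 1) := by
  have h := SetLike.mul_mem_graded (V.sec_mem X) ha
  rwa [add_comm] at h

/-- A property of germs at `x` holds for all homogeneous elements if it holds for functions and is
stable under sums and under products with elements of `Γ`. -/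
theorem local_induction (x : P) {Q : ℕ → 𝒜 → Prop} (fn : ∀ f, Q 0 (V.fn f))
    (sec_mul : ∀ X p, ∀ a ∈ 𝒢 p, Q p a → Q (p + 1) (V.sec X * a))
    (add : ∀ p, ∀ a ∈ 𝒢 p, ∀ b ∈ 𝒢 p, Q p a → Q p b → Q p (a + b))
    (germ : ∀ p, ∀ u ∈ 𝒢 p, u ∈ V.germZero x → Q p u) : ∀ p, ∀ a ∈ 𝒢 p, Q p a := by
  intro p
  induction p with
  | zero =>
    intro a ha
    obtain ⟨f, rfl⟩ := V.exists_fn a ha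
    exact fn f
  | succ p ih =>
    intro a ha
    obtain ⟨φ, hφ, χ, hχ, h⟩ := V.exists_local x
    obtain ⟨m, e, b, hb, hab⟩ := h p a ha
    have h1 : ∀ s : Finset (Fin m), (∑ i ∈ s, V.sec (e i) * b i) ∈ 𝒢 (p + 1) ∧
        Q (p + 1) (∑ i ∈ s, V.sec (e i) * b i) := by
      intro s
      induction s using Finset.cons_induction with
      | empty =>
        rw [Finset.sum_empty]
        exact ⟨Submodule.zero_mem _, germ _ _ (Submodule.zero_mem _) (Submodule.zero_mem _)⟩
      | cons i s _ hs =>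
        rw [Finset.sum_cons]
        have hi := V.sec_mul_mem (e i) (hb i)
        exact ⟨Submodule.add_mem _ hi hs.1,
          add _ _ hi _ hs.1 (sec_mul _ _ _ (hb i) (ih _ (hb i))) hs.2⟩
    have h2 := h1 Finset.univ
    rw [← hab] at h2
    -- a is split into χ a, which is a sum of products with elements of Γ, and a remainder that
    -- vanishes near x.
    have h3 : a - V.fn χ * a ∈ 𝒢 (p + 1) := Submodule.sub_mem _ ha h2.1
    have h4 : a - V.fn χ * a ∈ V.germZero x :=
      ⟨φ, hφ, by rw [mul_sub, ← mul_assoc, ← map_mul, hχ, sub_self]⟩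
    have h5 := add _ _ h2.1 _ h3 h2.2 (germ _ _ h3 h4)
    rwa [add_sub_cancel] at h5

theorem linearMap_ext {N : Type*} [AddCommGroup N] [Module ℝ N] {f g : 𝒜 →ₗ[ℝ] N}
    (h : ∀ p, ∀ a ∈ 𝒢 p, f a = g a) : f = g := by
  refine LinearMap.ext fun a => ?_
  induction a using DirectSum.Decomposition.inductionOn 𝒢 with
  | zero => rw [map_zero, map_zero]
  | homogeneous a => exact h _ _ a.2
  | add a b ha hb => rw [map_add, map_add, ha, hb]

/-- A graded derivation that vanishes on the generators is zero. -/
theorem derivation_eq_zero {δ : 𝒜 →ₗ[ℝ] 𝒜} {m : ℕ}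
    (leibniz : ∀ q, ∀ b ∈ 𝒢 q, ∀ c, δ (b * c) = δ b * c + (-1 : ℝ) ^ (m * q) • (b * δ c))
    (hfn : ∀ f, δ (V.fn f) = 0) (hsec : ∀ X, δ (V.sec X) = 0) : δ = 0 := by
  refine linearMap_ext (𝒢 := 𝒢) fun p a ha => V.eq_zero_of_mem_germZero fun x => ?_
  revert p a
  refine V.local_induction x (fun f => ?_) (fun X p a _ h => ?_) (fun p a _ b _ h h' => ?_) ?_
  · rw [hfn]
    exact Submodule.zero_mem _
  · rw [leibniz 1 _ (V.sec_mem X), hsec, zero_mul, zero_add]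
    exact Submodule.smul_mem _ _ (V.mul_mem_germZero _ h)
  · rw [map_add]
    exact Submodule.add_mem _ h h'
  · rintro p u _ ⟨φ, hφ, hu⟩
    refine ⟨φ, hφ, ?_⟩
    -- Derivations are local: apply δ to φ u = 0 and use δ φ = 0.
    have h := leibniz 0 _ (V.fn_mem φ) u
    rwa [hu, hfn, zero_mul, zero_add, mul_zero, pow_zero, one_smul, map_zero, eq_comm] at h

/-! #### Schouten brackets -/

variable {Ω : ℕ → Type*} [∀ k, AddCommGroup (Ω k)] [∀ k, Module R (Ω k)]
  (C : LieRinehartForms R Γ Ω)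

/-- The axioms of the Schouten bracket. -/
structure IsBracket (B : 𝒜 →ₗ[ℝ] 𝒜 →ₗ[ℝ] 𝒜) : Prop where
  degree_zero : ∀ a ∈ 𝒢 0, ∀ b ∈ 𝒢 0, B a b = 0
  degree : ∀ p q r, p + q = r + 1 → ∀ a ∈ 𝒢 p, ∀ b ∈ 𝒢 q, B a b ∈ 𝒢 r
  antisymm : ∀ p q, ∀ a ∈ 𝒢 p, ∀ b ∈ 𝒢 q, B a b = -((-1 : ℝ) ^ ((p + 1) * (q + 1)) • B b a)
  leibniz : ∀ p q, ∀ a ∈ 𝒢 p, ∀ b ∈ 𝒢 q, ∀ c,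
    B a (b * c) = B a b * c + (-1 : ℝ) ^ ((p + 1) * q) • (b * B a c)
  sec_sec : ∀ X Y, B (V.sec X) (V.sec Y) = V.sec (C.br X Y)
  sec_fn : ∀ X f, B (V.sec X) (V.fn f) = V.fn (C.der X f)

variable {V C}

/-- The Schouten bracket is unique. -/
theorem IsBracket.unique {B B' : 𝒜 →ₗ[ℝ] 𝒜 →ₗ[ℝ] 𝒜} (hB : V.IsBracket C B)
    (hB' : V.IsBracket C B') : B = B' := by
  have leib : ∀ p, ∀ a ∈ 𝒢 p, ∀ q, ∀ b ∈ 𝒢 q, ∀ c, (B - B') a (b * c) =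
      (B - B') a b * c + (-1 : ℝ) ^ ((p + 1) * q) • (b * (B - B') a c) := by
    intro p a ha q b hb c
    simp only [LinearMap.sub_apply, hB.leibniz p q a ha b hb, hB'.leibniz p q a ha b hb, sub_mul,
      mul_sub, smul_sub]
    abel
  have anti : ∀ p q, ∀ a ∈ 𝒢 p, ∀ b ∈ 𝒢 q,
      (B - B') a b = -((-1 : ℝ) ^ ((p + 1) * (q + 1)) • (B - B') b a) := by
    intro p q a ha b hb
    simp only [LinearMap.sub_apply, hB.antisymm p q a ha b hb, hB'.antisymm p q a ha b hb, smul_sub]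
    abel
  -- The order matters. Brackets with a section are derivations known on all generators;
  -- antisymmetry then handles functions against sections, and a second use of antisymmetry handles
  -- an arbitrary first entry against the generators.
  have hsec : ∀ X, (B - B') (V.sec X) = 0 := fun X =>
    V.derivation_eq_zero (leib 1 _ (V.sec_mem X))
      (fun f => by simp only [LinearMap.sub_apply, hB.sec_fn, hB'.sec_fn, sub_self])
      (fun Y => by simp only [LinearMap.sub_apply, hB.sec_sec, hB'.sec_sec, sub_self])
  have hfn : ∀ f, (B - B') (V.fn f) = 0 := fun f =>
    V.derivation_eq_zero (leib 0 _ (V.fn_mem f))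
      (fun g => by
        simp only [LinearMap.sub_apply, hB.degree_zero _ (V.fn_mem f) _ (V.fn_mem g),
          hB'.degree_zero _ (V.fn_mem f) _ (V.fn_mem g), sub_self])
      (fun Y => by
        rw [anti 0 1 _ (V.fn_mem f) _ (V.sec_mem Y), hsec, LinearMap.zero_apply, smul_zero,
          neg_zero])
  refine sub_eq_zero.mp (linearMap_ext (𝒢 := 𝒢) fun p a ha => ?_)
  refine V.derivation_eq_zero (leib p a ha) (fun f => ?_) (fun X => ?_)
  · rw [anti p 0 a ha _ (V.fn_mem f), hfn, LinearMap.zero_apply, smul_zero, neg_zero]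
  · rw [anti p 1 a ha _ (V.sec_mem X), hsec, LinearMap.zero_apply, smul_zero, neg_zero]

/-- A generating operator is determined by its values on `Γ`. -/
theorem generator_unique {B : 𝒜 →ₗ[ℝ] 𝒜 →ₗ[ℝ] 𝒜} {D D' : 𝒜 →ₗ[ℝ] 𝒜}
    (hD : ∀ p, ∀ a ∈ 𝒢 p, ∀ b,
      B a b = (-1 : ℝ) ^ p • (D (a * b) - D a * b - (-1 : ℝ) ^ p • (a * D b)))
    (hD' : ∀ p, ∀ a ∈ 𝒢 p, ∀ b,
      B a b = (-1 : ℝ) ^ p • (D' (a * b) - D' a * b - (-1 : ℝ) ^ p • (a * D' b)))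
    (h0 : ∀ a ∈ 𝒢 0, D a = 0) (h0' : ∀ a ∈ 𝒢 0, D' a = 0)
    (hsec : ∀ X, D (V.sec X) = D' (V.sec X)) : D = D' := by
  refine sub_eq_zero.mp (V.derivation_eq_zero (m := 1) (fun p a ha b => ?_) (fun f => ?_)
    (fun X => ?_))
  -- Both operators generate the same B, so in the difference the bracket terms cancel and D - D' is
  -- a graded derivation.
  · have h := (hD p a ha b).symm.trans (hD' p a ha b)
    have h1 : (-1 : ℝ) ^ p ≠ 0 := pow_ne_zero _ (by norm_num)
    have h2 := smul_right_injective 𝒜 h1 h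
    simp only [LinearMap.sub_apply, one_mul, sub_mul, mul_sub, smul_sub]
    rw [sub_sub, sub_sub, sub_eq_iff_eq_add] at h2
    rw [h2]
    abel
  · rw [LinearMap.sub_apply, h0 _ (V.fn_mem f), h0' _ (V.fn_mem f), sub_self]
  · rw [LinearMap.sub_apply, hsec, sub_self]

end Multivectors

/-! ### The duality defined by a volume element -/

/-- A duality between forms of degree `p` and multivectors of degree `n - p` that exchanges interior
products and exterior products. -/
structure VolumeDuality {R Γ : Type*} [CommRing R] [Algebra ℝ R] [AddCommGroup Γ] [Module R Γ]
    {𝒜 : Type*} [Ring 𝒜] [Algebra ℝ 𝒜] {𝒢 : ℕ → Submodule ℝ 𝒜} {P : Type*}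
    (V : Multivectors R Γ 𝒢 P) {Ω : ℕ → Type*} [∀ k, AddCommGroup (Ω k)] [∀ k, Module R (Ω k)]
    [∀ k, Module ℝ (Ω k)] (C : LieRinehartForms R Γ Ω) (n : ℕ) where
  star : ∀ p, Ω p →ₗ[ℝ] 𝒜
  star_smul : ∀ p f w, star p (f • w) = V.fn f * star p w
  star_mem : ∀ p k, p + k = n → ∀ w, star p w ∈ 𝒢 k
  sec_mul_star_zero : ∀ X w, V.sec X * star 0 w = 0
  sec_mul_star_succ : ∀ p X w,
    V.sec X * star (p + 1) w = (-1 : ℝ) ^ p • star p (C.int p X w)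
  star_zero_injective : ∀ w, star 0 w = 0 → w = 0
  exists_star_zero : ∀ a ∈ 𝒢 n, ∃ w, star 0 w = a
  eq_zero_of_sec_mul : ∀ k, k < n → ∀ a ∈ 𝒢 k, (∀ X, V.sec X * a = 0) → a = 0
  form_eq_zero : ∀ p, n < p → ∀ w : Ω p, w = 0
  eq_zero : ∀ k, n < k → ∀ a ∈ 𝒢 k, a = 0

namespace VolumeDuality

variable {R Γ : Type*} [CommRing R] [Algebra ℝ R] [AddCommGroup Γ] [Module R Γ]
  {𝒜 : Type*} [Ring 𝒜] [Algebra ℝ 𝒜] {𝒢 : ℕ → Submodule ℝ 𝒜} {P : Type*}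
  {V : Multivectors R Γ 𝒢 P} {Ω : ℕ → Type*} [∀ k, AddCommGroup (Ω k)] [∀ k, Module R (Ω k)]
  [∀ k, Module ℝ (Ω k)] {C : LieRinehartForms R Γ Ω} {n : ℕ}
  (S : VolumeDuality V C n)

/-- If ⋆w = 0, multiplying by X gives ⋆(i_X w) = 0, and a form of positive degree is determined by
its interior products. -/
theorem star_injective (p : ℕ) : Function.Injective (S.star p) := by
  refine (injective_iff_map_eq_zero _).mpr ?_
  induction p with
  | zero => exact S.star_zero_injective
  | succ p ih =>
    intro w hw
    refine C.eq_zero_of_int p w fun X => ih _ ?_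
    have h := S.sec_mul_star_succ p X w
    rw [hw, mul_zero, eq_comm] at h
    exact (smul_eq_zero.mp h).resolve_left (pow_ne_zero _ (by norm_num))

theorem sec_mul_sec_mul (X Y : Γ) (a : 𝒜) :
    V.sec X * (V.sec Y * a) = -(V.sec Y * (V.sec X * a)) := by
  rw [← mul_assoc, V.mul_comm 1 1 _ (V.sec_mem X) _ (V.sec_mem Y), ← mul_assoc]
  simp

theorem sec_mul_sec_mul_self (X : Γ) (a : 𝒜) : V.sec X * (V.sec X * a) = 0 := by
  have h := sec_mul_sec_mul (V := V) X X a
  have h2 : (2 : ℝ) • (V.sec X * (V.sec X * a)) = 0 := by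
    rw [two_smul]
    nth_rewrite 1 [h]
    exact neg_add_cancel _
  exact (smul_eq_zero.mp h2).resolve_left two_ne_zero

variable [GradedAlgebra 𝒢]

/-- Since k < n in the inductive step, it suffices to match X ∧ a for all X. By induction X ∧ a =
±⋆(Φ X); Φ is R-linear by injectivity of ⋆ and alternating because X ∧ X = 0, so Φ X = i_X θ for
some form θ, and ⋆θ = a. -/
theorem exists_star (p : ℕ) : ∀ k, p + k = n → ∀ a ∈ 𝒢 k, ∃ w, S.star p w = a := by
  induction p with
  | zero =>
    intro k hk a ha
    obtain rfl : k = n := by omega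
    exact S.exists_star_zero a ha
  | succ p ih =>
    intro k hk a ha
    have h1 : ∀ X, ∃ w, S.star p w = (-1 : ℝ) ^ p • (V.sec X * a) := fun X =>
      ih (k + 1) (by omega) _ (Submodule.smul_mem _ _ (V.sec_mul_mem X ha))
    choose Φ hΦ using h1
    have hadd : ∀ X Y, Φ (X + Y) = Φ X + Φ Y := fun X Y => S.star_injective p (by
      rw [map_add, hΦ, hΦ, hΦ, map_add, add_mul, smul_add])
    have hsmul : ∀ (f : R) X, Φ (f • X) = f • Φ X := fun f X => S.star_injective p (by
      rw [S.star_smul, hΦ, hΦ, V.sec_smul, mul_smul_comm, mul_assoc])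
    have h2 : ∃ θ, ∀ X, C.int p X θ = Φ X := by
      let Ψ : Γ →ₗ[R] Ω p := ⟨⟨Φ, hadd⟩, hsmul⟩
      rcases p with _ | p
      · exact C.exists_int_zero Ψ
      · refine C.exists_int_succ p Ψ fun X => S.star_injective p ?_
        have h3 : V.sec X * S.star (p + 1) (Φ X) = 0 := by
          rw [hΦ, mul_smul_comm, sec_mul_sec_mul_self, smul_zero]
        rw [S.sec_mul_star_succ] at h3
        rw [map_zero]
        exact (smul_eq_zero.mp h3).resolve_left (pow_ne_zero _ (by norm_num))
    obtain ⟨θ, hθ⟩ := h2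
    refine ⟨θ, sub_eq_zero.mp (S.eq_zero_of_sec_mul k (by omega) _
      (Submodule.sub_mem _ (S.star_mem _ k hk θ) ha) fun X => ?_)⟩
    rw [mul_sub, S.sec_mul_star_succ, hθ, hΦ, smul_smul, ← mul_pow]
    simp

/-- The duality as a linear equivalence. -/
def starEquiv {p k : ℕ} (h : p + k = n) : Ω p ≃ₗ[ℝ] 𝒢 k :=
  LinearEquiv.ofBijective ((S.star p).codRestrict (𝒢 k) (S.star_mem p k h))
    ⟨fun _ _ hw => S.star_injective p (congrArg Subtype.val hw), fun a => by
      obtain ⟨w, hw⟩ := S.exists_star p k h a a.2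
      exact ⟨w, Subtype.ext hw⟩⟩

theorem star_induction {Q : 𝒜 → Prop} (zero : Q 0) (add : ∀ a b, Q a → Q b → Q (a + b))
    (star : ∀ p w, Q (S.star p w)) (a : 𝒜) : Q a := by
  induction a using DirectSum.Decomposition.inductionOn 𝒢 with
  | zero => exact zero
  | @homogeneous k a =>
    rcases le_or_gt k n with h | h
    · obtain ⟨w, hw⟩ := S.exists_star (n - k) k (by omega) a a.2
      rw [← hw]
      exact star _ w
    · rw [S.eq_zero k h a a.2]
      exact zero
  | add a b ha hb => exact add a b ha hb

/-! #### The generating operator -/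

variable [∀ k, IsScalarTower ℝ R (Ω k)]

/-- The operator that corresponds to the coboundary, up to sign. -/
def gen : 𝒜 →ₗ[ℝ] 𝒜 :=
  DirectSum.toModule ℝ ℕ 𝒜 (fun k => if h : k ≤ n then
    (-1 : ℝ) ^ (n - k + 1) • (S.star (n - k + 1) ∘ₗ C.diffₗ (n - k) ∘ₗ
      (S.starEquiv (Nat.sub_add_cancel h)).symm.toLinearMap) else 0) ∘ₗ
    (DirectSum.decomposeLinearEquiv 𝒢).toLinearMap

/-- The sign (-1)^(p+1) makes the anticommutator with a section equal to -⋆L_X⋆⁻¹ in every degree,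
without a sign that depends on p. -/
theorem gen_star {p : ℕ} (w : Ω p) :
    S.gen (S.star p w) = (-1 : ℝ) ^ (p + 1) • S.star (p + 1) (C.diff p w) := by
  rcases le_or_gt p n with h | h
  · obtain ⟨k, hk⟩ := Nat.exists_eq_add_of_le h
    obtain rfl : p = n - k := by omega
    have h1 : k ≤ n := by omega
    have h2 := DirectSum.decompose_of_mem 𝒢 (S.star_mem (n - k) k (by omega) w)
    rw [gen, LinearMap.comp_apply, LinearEquiv.coe_coe, DirectSum.decomposeLinearEquiv_apply, h2]
    erw [DirectSum.toModule_lof]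
    rw [dif_pos h1]
    have h3 : (S.starEquiv (Nat.sub_add_cancel h1)).symm
        ⟨S.star (n - k) w, S.star_mem (n - k) k (by omega) w⟩ = w :=
      (LinearEquiv.symm_apply_eq _).mpr rfl
    rw [LinearMap.smul_apply, LinearMap.comp_apply, LinearMap.comp_apply, LinearEquiv.coe_coe, h3]
    rfl
  · rw [S.form_eq_zero p h w, map_zero, map_zero, C.diff_zero, map_zero, smul_zero]

theorem gen_mem {k : ℕ} {a : 𝒜} (ha : a ∈ 𝒢 (k + 1)) : S.gen a ∈ 𝒢 k := by
  rcases le_or_gt (k + 1) n with h | h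
  · obtain ⟨w, rfl⟩ := S.exists_star (n - (k + 1)) (k + 1) (by omega) a ha
    rw [gen_star]
    exact Submodule.smul_mem _ _ (S.star_mem _ _ (by omega) _)
  · rw [S.eq_zero _ h a ha, map_zero]
    exact Submodule.zero_mem _

theorem gen_eq_zero {a : 𝒜} (ha : a ∈ 𝒢 0) : S.gen a = 0 := by
  obtain ⟨w, rfl⟩ := S.exists_star n 0 (by omega) a ha
  rw [gen_star, S.form_eq_zero (n + 1) (by omega) (C.diff n w), map_zero, smul_zero]

theorem gen_fn (f : R) : S.gen (V.fn f) = 0 := S.gen_eq_zero (V.fn_mem f)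

theorem gen_one : S.gen 1 = 0 := by
  rw [← map_one V.fn, gen_fn]

theorem gen_gen (a : 𝒜) : S.gen (S.gen a) = 0 := by
  induction a using S.star_induction with
  | zero => rw [map_zero, map_zero]
  | add a b ha hb => rw [map_add, map_add, ha, hb, add_zero]
  | star p w => rw [gen_star, map_smul, gen_star, C.diff_diff, map_zero, smul_zero, smul_zero]

/-- Cartan's formula carried over by ⋆. For p = 0 the term with i_X is absent, in accordance with X
∧ ⋆w = 0. -/
theorem gen_sec_mul_star (X : Γ) {p : ℕ} (w : Ω p) :
    S.gen (V.sec X * S.star p w) + V.sec X * S.gen (S.star p w) = -S.star p (C.lie X p w) := by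
  rw [gen_star, mul_smul_comm, S.sec_mul_star_succ, smul_smul, ← pow_add,
    Odd.neg_one_pow ⟨p, by ring⟩, neg_one_smul]
  rcases p with _ | p
  · rw [S.sec_mul_star_zero, map_zero, zero_add, C.int_diff_zero]
  · rw [S.sec_mul_star_succ, map_smul, gen_star, smul_smul, ← pow_add,
      Odd.neg_one_pow ⟨p, by ring⟩, neg_one_smul, C.int_diff, map_sub]
    abel

/-- The anticommutator of the generating operator with the product by an element of `Γ`. -/
def genSec (X : Γ) : 𝒜 →ₗ[ℝ] 𝒜 :=
  S.gen ∘ₗ LinearMap.mulLeft ℝ (V.sec X) + LinearMap.mulLeft ℝ (V.sec X) ∘ₗ S.gen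

theorem genSec_apply (X : Γ) (a : 𝒜) :
    S.genSec X a = S.gen (V.sec X * a) + V.sec X * S.gen a := rfl

theorem genSec_star (X : Γ) {p : ℕ} (w : Ω p) :
    S.genSec X (S.star p w) = -S.star p (C.lie X p w) := S.gen_sec_mul_star X w

/-- The relation i_Y L_X = L_X i_Y - i_{[X,Y]} carried over by ⋆. -/
theorem genSec_sec_mul (X Y : Γ) (a : 𝒜) :
    S.genSec X (V.sec Y * a) = V.sec Y * S.genSec X a - V.sec (C.br X Y) * a := by
  induction a using S.star_induction with
  | zero => simp
  | add a b ha hb =>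
    simp only [mul_add, map_add, ha, hb]
    abel
  | star p w =>
    rcases p with _ | p
    · rw [genSec_star, mul_neg]
      simp only [S.sec_mul_star_zero, map_zero]
      abel
    · rw [genSec_star, mul_neg]
      simp only [S.sec_mul_star_succ, map_smul, genSec_star, C.int_lie, map_sub, smul_sub, smul_neg]
      abel

theorem genSec_fn_mul (X : Γ) (f : R) (a : 𝒜) :
    S.genSec X (V.fn f * a) = V.fn f * S.genSec X a - V.fn (C.der X f) * a := by
  induction a using S.star_induction with
  | zero => simp
  | add a b ha hb =>
    simp only [mul_add, map_add, ha, hb]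
    abel
  | star p w =>
    rw [← S.star_smul, ← S.star_smul, genSec_star, genSec_star, C.lie_smul, map_add, mul_neg,
      S.star_smul, S.star_smul]
    abel

/-- The commutator of the generating operator with the product by a function. -/
def genFn (f : R) : 𝒜 →ₗ[ℝ] 𝒜 :=
  S.gen ∘ₗ LinearMap.mulLeft ℝ (V.fn f) - LinearMap.mulLeft ℝ (V.fn f) ∘ₗ S.gen

theorem genFn_apply (f : R) (a : 𝒜) :
    S.genFn f a = S.gen (V.fn f * a) - V.fn f * S.gen a := rfl

theorem genFn_star (f : R) {p : ℕ} (w : Ω p) :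
    S.genFn f (S.star p w) = (-1 : ℝ) ^ (p + 1) • S.star (p + 1) (C.diffComm f p w) := by
  rw [genFn_apply, ← S.star_smul, gen_star, gen_star, LieRinehartForms.diffComm, map_sub,
    S.star_smul, smul_sub, mul_smul_comm]

theorem genFn_fn_mul (f g : R) (a : 𝒜) : S.genFn f (V.fn g * a) = V.fn g * S.genFn f a := by
  induction a using S.star_induction with
  | zero => simp
  | add a b ha hb => simp only [mul_add, map_add, ha, hb]
  | star p w =>
    rw [← S.star_smul, genFn_star, genFn_star, C.diffComm_smul, S.star_smul, mul_smul_comm]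

/-- The rule i_Y (df ∧ w) = (Y f) w - df ∧ i_Y w carried over by ⋆. -/
theorem genFn_sec_mul (f : R) (Y : Γ) (a : 𝒜) :
    S.genFn f (V.sec Y * a) = -(V.fn (C.der Y f) * a) - V.sec Y * S.genFn f a := by
  induction a using S.star_induction with
  | zero => simp
  | add a b ha hb =>
    simp only [mul_add, map_add, ha, hb]
    abel
  | star p w =>
    rw [genFn_star, mul_smul_comm, S.sec_mul_star_succ, smul_smul, ← pow_add,
      Odd.neg_one_pow ⟨p, by ring⟩, neg_one_smul, ← S.star_smul]
    rcases p with _ | p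
    · rw [S.sec_mul_star_zero, map_zero, C.int_diffComm_zero]
      abel
    · rw [S.sec_mul_star_succ, map_smul, genFn_star, smul_smul, ← pow_add,
        Odd.neg_one_pow ⟨p, by ring⟩, neg_one_smul, C.int_diffComm, map_sub]
      abel

/-- The operator is local: its commutator with φ is linear over functions, so evaluating it on φ u =
0 gives φ² D u = 0. -/
theorem gen_mem_germZero {x : P} {u : 𝒜} (hu : u ∈ V.germZero x) : S.gen u ∈ V.germZero x := by
  obtain ⟨φ, hφ, hu⟩ := hu
  refine ⟨φ * φ, mul_mem hφ hφ, ?_⟩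
  have h1 := S.genFn_fn_mul φ φ u
  rw [hu, map_zero, genFn_apply, hu, map_zero, zero_sub, mul_neg] at h1
  rw [map_mul, mul_assoc]
  exact neg_eq_zero.mp h1.symm

/-! #### The bracket -/

/-- The operator `(-1)^p` on `𝒢 p`. -/
def parity (𝒢 : ℕ → Submodule ℝ 𝒜) [GradedAlgebra 𝒢] : 𝒜 →ₗ[ℝ] 𝒜 :=
  DirectSum.toModule ℝ ℕ 𝒜 (fun k => (-1 : ℝ) ^ k • (𝒢 k).subtype) ∘ₗ
    (DirectSum.decomposeLinearEquiv 𝒢).toLinearMap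

theorem parity_apply {p : ℕ} {a : 𝒜} (ha : a ∈ 𝒢 p) : parity 𝒢 a = (-1 : ℝ) ^ p • a := by
  rw [parity, LinearMap.comp_apply, LinearEquiv.coe_coe, DirectSum.decomposeLinearEquiv_apply,
    DirectSum.decompose_of_mem 𝒢 ha]
  erw [DirectSum.toModule_lof]
  rfl

/-- The bracket generated by the generating operator. -/
def bracket : 𝒜 →ₗ[ℝ] 𝒜 →ₗ[ℝ] 𝒜 :=
  -- `parity` encodes (-1)^p bilinearly, for elements that need not be homogeneous. The last term
  -- carries no sign, since there (-1)^p occurs twice.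
  ((LinearMap.mul ℝ 𝒜).compr₂ S.gen) ∘ₗ parity 𝒢 -
    (LinearMap.mul ℝ 𝒜) ∘ₗ S.gen ∘ₗ parity 𝒢 - (LinearMap.mul ℝ 𝒜).compl₂ S.gen

theorem bracket_apply {p : ℕ} {a : 𝒜} (ha : a ∈ 𝒢 p) (b : 𝒜) : S.bracket a b =
    (-1 : ℝ) ^ p • (S.gen (a * b) - S.gen a * b - (-1 : ℝ) ^ p • (a * S.gen b)) := by
  simp only [bracket, LinearMap.sub_apply, LinearMap.comp_apply,
    LinearMap.compl₂_apply, LinearMap.mul_apply', parity_apply ha, map_smul, smul_sub, smul_smul,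
    ← mul_pow]
  simp

theorem bracket_fn (f : R) (b : 𝒜) : S.bracket (V.fn f) b = S.genFn f b := by
  rw [S.bracket_apply (V.fn_mem f), gen_fn, genFn_apply]
  simp

theorem bracket_sec (X : Γ) (b : 𝒜) :
    S.bracket (V.sec X) b = S.gen (V.sec X) * b - S.genSec X b := by
  rw [S.bracket_apply (V.sec_mem X), genSec_apply, pow_one]
  simp only [neg_one_smul]
  abel

theorem bracket_mem_germZero {x : P} {p : ℕ} {a : 𝒜} (ha : a ∈ 𝒢 p) {u : 𝒜}
    (hu : u ∈ V.germZero x) : S.bracket a u ∈ V.germZero x := by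
  rw [S.bracket_apply ha]
  refine Submodule.smul_mem _ _ (Submodule.sub_mem _ (Submodule.sub_mem _ ?_ ?_)
    (Submodule.smul_mem _ _ ?_))
  · exact S.gen_mem_germZero (V.mul_mem_germZero _ hu)
  · exact V.mul_mem_germZero _ hu
  · exact V.mul_mem_germZero _ (S.gen_mem_germZero hu)

theorem bracket_germZero_mem {x : P} {p : ℕ} {u : 𝒜} (hu : u ∈ 𝒢 p) (hu' : u ∈ V.germZero x)
    (b : 𝒜) : S.bracket u b ∈ V.germZero x := by
  rw [S.bracket_apply hu]
  refine Submodule.smul_mem _ _ (Submodule.sub_mem _ (Submodule.sub_mem _ ?_ ?_)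
    (Submodule.smul_mem _ _ ?_))
  · exact S.gen_mem_germZero (V.mem_germZero_mul _ hu')
  · exact V.mem_germZero_mul _ (S.gen_mem_germZero hu')
  · exact V.mem_germZero_mul _ hu'

theorem bracket_sec_sec_mul (X Y : Γ) (b : 𝒜) : S.bracket (V.sec X) (V.sec Y * b) =
    V.sec (C.br X Y) * b + V.sec Y * S.bracket (V.sec X) b := by
  -- D X has degree zero, hence is a function and commutes with everything.
  have h : S.gen (V.sec X) * V.sec Y = V.sec Y * S.gen (V.sec X) := by
    obtain ⟨f, hf⟩ := V.exists_fn _ (S.gen_mem (k := 0) (V.sec_mem X))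
    rw [← hf, V.fn_comm]
  rw [bracket_sec, bracket_sec, genSec_sec_mul, ← mul_assoc, h, mul_assoc, mul_sub]
  abel

theorem bracket_sec_fn_mul (X : Γ) (f : R) (b : 𝒜) : S.bracket (V.sec X) (V.fn f * b) =
    V.fn (C.der X f) * b + V.fn f * S.bracket (V.sec X) b := by
  rw [bracket_sec, bracket_sec, genSec_fn_mul, ← mul_assoc, ← V.fn_comm, mul_assoc, mul_sub]
  abel

theorem bracket_sec_one (X : Γ) : S.bracket (V.sec X) 1 = 0 := by
  rw [bracket_sec, genSec_apply, gen_one, mul_one, mul_one, mul_zero, add_zero, sub_self]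

theorem bracket_sec_sec (X Y : Γ) : S.bracket (V.sec X) (V.sec Y) = V.sec (C.br X Y) := by
  have h := S.bracket_sec_sec_mul X Y 1
  rwa [bracket_sec_one, mul_one, mul_one, mul_zero, add_zero] at h

theorem bracket_sec_fn (X : Γ) (f : R) : S.bracket (V.sec X) (V.fn f) = V.fn (C.der X f) := by
  have h := S.bracket_sec_fn_mul X f 1
  rwa [bracket_sec_one, mul_one, mul_one, mul_zero, add_zero] at h

theorem bracket_fn_one (f : R) : S.bracket (V.fn f) 1 = 0 := by
  rw [bracket_fn, genFn_apply, mul_one, gen_fn, gen_one, mul_zero, sub_zero]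

theorem bracket_fn_fn (f g : R) : S.bracket (V.fn f) (V.fn g) = 0 := by
  rw [← mul_one (V.fn g), bracket_fn, genFn_fn_mul, ← bracket_fn, bracket_fn_one, mul_zero]

/-- Local induction on b: the rule is known when b is a function or a section, and it passes to
products with a section and to sums. Locality of the bracket takes care of elements that vanish near
x. -/
theorem leibniz_sec (X : Γ) {q : ℕ} {b : 𝒜} (hb : b ∈ 𝒢 q) (c : 𝒜) : S.bracket (V.sec X) (b * c) =
    S.bracket (V.sec X) b * c + b * S.bracket (V.sec X) c := by
  refine sub_eq_zero.mp (V.eq_zero_of_mem_germZero fun x => ?_)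
  revert q b
  suffices ∀ q, ∀ b ∈ 𝒢 q, S.bracket (V.sec X) (b * c) -
      (S.bracket (V.sec X) b * c + b * S.bracket (V.sec X) c) ∈ V.germZero x from
    fun {q b} hb => this q b hb
  refine V.local_induction x (fun f => ?_) (fun Y q b _ h => ?_) (fun q a _ b _ h h' => ?_)
    (fun q u _ hu => ?_)
  · rw [bracket_sec_fn_mul, bracket_sec_fn, sub_self]
    exact Submodule.zero_mem _
  · rw [mul_assoc, bracket_sec_sec_mul, bracket_sec_sec_mul]
    convert V.mul_mem_germZero (V.sec Y) h using 1
    noncomm_ring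
  · rw [add_mul, map_add, map_add, add_mul, add_mul]
    convert Submodule.add_mem _ h h' using 1
    abel
  · exact Submodule.sub_mem _ (S.bracket_mem_germZero (V.sec_mem X) (V.mem_germZero_mul c hu))
      (Submodule.add_mem _ (V.mem_germZero_mul c (S.bracket_mem_germZero (V.sec_mem X) hu))
        (V.mem_germZero_mul _ hu))

theorem leibniz_fn (f : R) {q : ℕ} {b : 𝒜} (hb : b ∈ 𝒢 q) (c : 𝒜) : S.bracket (V.fn f) (b * c) =
    S.bracket (V.fn f) b * c + (-1 : ℝ) ^ q • (b * S.bracket (V.fn f) c) := by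
  refine sub_eq_zero.mp (V.eq_zero_of_mem_germZero fun x => ?_)
  revert q b
  suffices ∀ q, ∀ b ∈ 𝒢 q, S.bracket (V.fn f) (b * c) -
      (S.bracket (V.fn f) b * c + (-1 : ℝ) ^ q • (b * S.bracket (V.fn f) c)) ∈ V.germZero x from
    fun {q b} hb => this q b hb
  refine V.local_induction x (fun g => ?_) (fun Y q b _ h => ?_) (fun q a _ b _ h h' => ?_)
    (fun q u _ hu => ?_)
  · rw [bracket_fn_fn, bracket_fn, genFn_fn_mul, ← bracket_fn, zero_mul, zero_add, pow_zero,
      one_smul, sub_self]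
    exact Submodule.zero_mem _
  · have h1 := Submodule.neg_mem _ (V.mul_mem_germZero (V.sec Y) h)
    rw [mul_assoc, bracket_fn, bracket_fn, genFn_sec_mul, genFn_sec_mul, ← bracket_fn,
      ← bracket_fn]
    convert h1 using 1
    simp only [sub_mul, neg_mul, mul_sub, mul_add, mul_smul_comm, pow_succ, mul_neg_one, neg_smul,
      mul_assoc]
    abel
  · rw [add_mul, map_add, map_add, add_mul, add_mul, smul_add]
    convert Submodule.add_mem _ h h' using 1
    abel
  · exact Submodule.sub_mem _ (S.bracket_mem_germZero (V.fn_mem f) (V.mem_germZero_mul c hu))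
      (Submodule.add_mem _ (V.mem_germZero_mul c (S.bracket_mem_germZero (V.fn_mem f) hu))
        (Submodule.smul_mem _ _ (V.mem_germZero_mul _ hu)))

/-- Written out in terms of D, this and the Leibniz rule for X in the second argument are, up to the
sign (-1)^p, one and the same identity, which expresses D(X ∧ a ∧ c) through D on products of at
most two factors. -/
theorem bracket_sec_mul (X : Γ) {p : ℕ} {a : 𝒜} (ha : a ∈ 𝒢 p) (c : 𝒜) :
    S.bracket (V.sec X * a) c = V.sec X * S.bracket a c +
      (-1 : ℝ) ^ p • (a * S.bracket (V.sec X) c) := by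
  have h1 := S.leibniz_sec X ha c
  rw [S.bracket_apply (V.sec_mul_mem X ha), S.bracket_apply ha, bracket_sec]
  simp only [bracket_sec, genSec_apply] at h1 ⊢
  rw [← sub_eq_zero] at h1 ⊢
  rcases neg_one_pow_eq_or ℝ p with h | h
  · refine Eq.trans ?_ h1
    simp only [pow_succ, h, one_mul, neg_smul, one_smul, mul_sub, mul_add, sub_mul, add_mul,
      mul_assoc]
    abel
  · refine Eq.trans ?_ ((congrArg Neg.neg h1).trans neg_zero)
    simp only [pow_succ, h, one_mul, neg_smul, one_smul, mul_sub, mul_add, sub_mul, add_mul,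
      mul_assoc, neg_mul, neg_neg, mul_neg]
    abel

/-- Local induction on the degree of the first entry, starting from functions; a section is split
off by the product rule in the first argument. -/
theorem leibniz {p q : ℕ} {a b : 𝒜} (ha : a ∈ 𝒢 p) (hb : b ∈ 𝒢 q) (c : 𝒜) :
    S.bracket a (b * c) =
      S.bracket a b * c + (-1 : ℝ) ^ ((p + 1) * q) • (b * S.bracket a c) := by
  refine sub_eq_zero.mp (V.eq_zero_of_mem_germZero fun x => ?_)
  revert p a
  suffices ∀ p, ∀ a ∈ 𝒢 p, S.bracket a (b * c) -
      (S.bracket a b * c + (-1 : ℝ) ^ ((p + 1) * q) • (b * S.bracket a c)) ∈ V.germZero x from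
    fun {p a} ha => this p a ha
  refine V.local_induction x (fun f => ?_) (fun X p a ha h => ?_) (fun p a _ a' _ h h' => ?_)
    (fun p u hu hu' => ?_)
  · rw [zero_add, one_mul, S.leibniz_fn f hb, sub_self]
    exact Submodule.zero_mem _
  · convert V.mul_mem_germZero (V.sec X) h using 1
    -- `h1` and `h2` move b past X and past a. The remaining equations reduce the resulting signs
    -- modulo two.
    have h1 : b * (V.sec X * S.bracket a c) =
        (-1 : ℝ) ^ q • (V.sec X * (b * S.bracket a c)) := by
      rw [← mul_assoc, V.mul_comm q 1 b hb _ (V.sec_mem X), mul_one, smul_mul_assoc, mul_assoc]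
    have h2 : b * (a * S.bracket (V.sec X) c) =
        (-1 : ℝ) ^ (q * p) • (a * (b * S.bracket (V.sec X) c)) := by
      rw [← mul_assoc, V.mul_comm q p b hb a ha, smul_mul_assoc, mul_assoc]
    have h3 : (-1 : ℝ) ^ ((p + 1 + 1) * q) = (-1) ^ (p * q) := by
      rw [add_assoc, add_mul, pow_add, pow_mul (-1 : ℝ) 2]
      simp
    have h4 : (-1 : ℝ) ^ (p * q) * (-1) ^ p * (-1) ^ (q * p) = (-1) ^ p := by
      rw [mul_comm q p, mul_right_comm, ← mul_pow]
      simp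
    have h5 : (-1 : ℝ) ^ (p * q) * (-1) ^ q = (-1) ^ ((p + 1) * q) := by
      rw [← pow_add]
      congr 1
      ring
    rw [S.bracket_sec_mul X ha, S.bracket_sec_mul X ha, S.bracket_sec_mul X ha,
      S.leibniz_sec X hb, mul_add b, h1, mul_smul_comm, h2, h3, smul_add, smul_smul, smul_smul,
      smul_smul, h4, h5]
    simp only [mul_add, mul_sub, add_mul, smul_mul_assoc, mul_smul_comm, smul_add, mul_assoc]
    abel
  · generalize (-1 : ℝ) ^ ((p + 1) * q) = s at h h' ⊢
    simp only [map_add, LinearMap.add_apply, add_mul, mul_add, smul_add]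
    convert Submodule.add_mem _ h h' using 1
    abel
  · exact Submodule.sub_mem _ (S.bracket_germZero_mem hu hu' _) (Submodule.add_mem _
      (V.mem_germZero_mul c (S.bracket_germZero_mem hu hu' _))
      (Submodule.smul_mem _ _ (V.mul_mem_germZero _ (S.bracket_germZero_mem hu hu' _))))

/-- Graded commutativity for D a, whose degree is p - 1: the exponent uses p + 1, of the same
parity, and for p = 0 both sides vanish. -/
theorem gen_mul_comm {p q : ℕ} {a b : 𝒜} (ha : a ∈ 𝒢 p) (hb : b ∈ 𝒢 q) :
    S.gen a * b = (-1 : ℝ) ^ ((p + 1) * q) • (b * S.gen a) := by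
  rcases p with _ | p
  · rw [S.gen_eq_zero ha, zero_mul, mul_zero, smul_zero]
  · rw [V.mul_comm p q _ (S.gen_mem ha) b hb, add_assoc, add_mul, pow_add,
      pow_mul (-1 : ℝ) (1 + 1)]
    simp

/-- Graded commutativity turns the generating formula for (a, b) into that for (b, a); what remains
is a check of signs over the parities of p q, p and q. -/
theorem antisymm {p q : ℕ} {a b : 𝒜} (ha : a ∈ 𝒢 p) (hb : b ∈ 𝒢 q) :
    S.bracket a b = -((-1 : ℝ) ^ ((p + 1) * (q + 1)) • S.bracket b a) := by
  rw [S.bracket_apply ha, S.bracket_apply hb, S.gen_mul_comm ha hb, S.gen_mul_comm hb ha,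
    V.mul_comm p q a ha b hb, map_smul]
  simp only [add_mul, mul_add, pow_add, one_mul, mul_one, mul_comm q p, pow_one]
  rcases neg_one_pow_eq_or ℝ (p * q) with h | h <;> rcases neg_one_pow_eq_or ℝ p with hp | hp <;>
    rcases neg_one_pow_eq_or ℝ q with hq | hq <;>
    simp only [h, hp, hq, mul_one, neg_neg, mul_neg, neg_smul, one_smul,
      smul_neg] <;> abel

theorem isBracket : V.IsBracket C S.bracket where
  degree_zero a ha b hb := by
    obtain ⟨f, rfl⟩ := V.exists_fn a ha
    obtain ⟨g, rfl⟩ := V.exists_fn b hb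
    exact S.bracket_fn_fn f g
  degree p q r h a ha b hb := by
    rw [S.bracket_apply ha]
    refine Submodule.smul_mem _ _ (Submodule.sub_mem _ (Submodule.sub_mem _ ?_ ?_)
      (Submodule.smul_mem _ _ ?_))
    · refine S.gen_mem ?_
      rw [← h]
      exact SetLike.mul_mem_graded ha hb
    · rcases p with _ | p
      · rw [S.gen_eq_zero ha, zero_mul]
        exact Submodule.zero_mem _
      · obtain rfl : p + q = r := by omega
        exact SetLike.mul_mem_graded (S.gen_mem ha) hb
    · rcases q with _ | q
      · rw [S.gen_eq_zero hb, mul_zero]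
        exact Submodule.zero_mem _
      · obtain rfl : p + q = r := by omega
        exact SetLike.mul_mem_graded ha (S.gen_mem hb)
  antisymm p q a ha b hb := S.antisymm ha hb
  leibniz p q a ha b hb c := S.leibniz ha hb c
  sec_sec := S.bracket_sec_sec
  sec_fn := S.bracket_sec_fn

end VolumeDuality

/-! ### Multisections as modules over the smooth functions -/

/-- The algebra of smooth functions. -/
abbrev Fn (E : Type*) [NormedAddCommGroup E] [NormedSpace ℝ E] (M : Type*) [TopologicalSpace M]
    [ChartedSpace E M] : Type _ := C^∞⟮𝓘(ℝ, E), M; 𝓘(ℝ, ℝ), ℝ⟯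

section MultisectionModule

variable {E : Type*} [NormedAddCommGroup E] [NormedSpace ℝ E]
  {M : Type*} [TopologicalSpace M] [ChartedSpace E M]
  {G : Type*} [AddCommGroup G] [Module ℝ G] [FiniteDimensional ℝ G]
  {V : M → Type*} [∀ x, AddCommGroup (V x)] [∀ x, Module ℝ (V x)]
  {c : M → ∀ x : M, V x →ₗ[ℝ] G}

namespace Multisections

/-- The value of a multisection at a point. -/
def val (s : Multisections E c) (x : M) : ExteriorAlgebra ℝ (V x) := s.1 x

theorem ext {s t : Multisections E c} (h : ∀ x, s.val x = t.val x) : s = t :=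
  Subtype.ext (funext h)

theorem val_add (s t : Multisections E c) (x : M) : (s + t).val x = s.val x + t.val x := rfl

theorem val_mul (s t : Multisections E c) (x : M) : (s * t).val x = s.val x * t.val x := rfl

theorem val_smul (r : ℝ) (s : Multisections E c) (x : M) : (r • s).val x = r • s.val x := rfl

theorem val_sum {I : Type*} (s : Finset I) (f : I → Multisections E c) (x : M) :
    (∑ i ∈ s, f i).val x = ∑ i ∈ s, (f i).val x := by
  induction s using Finset.cons_induction with
  | empty => rfl
  | cons i s hi ih => rw [Finset.sum_cons, Finset.sum_cons, val_add, ih]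

theorem contMDiffAt (s : Multisections E c) (x₀ : M) (φ : Module.Dual ℝ (ExteriorAlgebra ℝ G)) :
    ContMDiffAt 𝓘(ℝ, E) 𝓘(ℝ, ℝ) ∞ (fun x => φ (ExteriorAlgebra.map (c x₀ x) (s.val x))) x₀ :=
  s.2 x₀ φ

theorem mem_degreePart {k : ℕ} {s : Multisections E c} :
    s ∈ degreePart E c k ↔ ∀ x, s.val x ∈ ⋀[ℝ]^k (V x) := Iff.rfl

variable (c) in
/-- A smooth function, as a multisection of degree zero. -/
def ofFnHom : Fn E M →ₐ[ℝ] Multisections E c where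
  toFun f := ⟨fun x => algebraMap ℝ (ExteriorAlgebra ℝ (V x)) (f x), fun x₀ φ => by
    have h : (fun x => φ (ExteriorAlgebra.map (c x₀ x)
        (algebraMap ℝ (ExteriorAlgebra ℝ (V x)) (f x)))) = fun x => f x * φ 1 := by
      funext x
      rw [AlgHom.commutes, Algebra.algebraMap_eq_smul_one, map_smul, smul_eq_mul]
    rw [h]
    exact f.contMDiff.contMDiffAt.mul contMDiffAt_const⟩
  map_one' := ext fun _ => map_one _
  map_mul' _ _ := ext fun _ => map_mul _ _ _
  map_zero' := ext fun _ => map_zero _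
  map_add' _ _ := ext fun _ => map_add _ _ _
  commutes' _ := ext fun _ => rfl

theorem val_ofFnHom (f : Fn E M) (x : M) :
    (ofFnHom c f).val x = algebraMap ℝ (ExteriorAlgebra ℝ (V x)) (f x) := rfl

theorem val_ofFnHom_mul (f : Fn E M) (s : Multisections E c) (x : M) :
    (ofFnHom c f * s).val x = f x • s.val x := by
  rw [val_mul, val_ofFnHom, ← Algebra.smul_def]

theorem ofFnHom_comm (f : Fn E M) (s : Multisections E c) :
    ofFnHom c f * s = s * ofFnHom c f := ext fun x => by
  rw [val_mul, val_mul, val_ofFnHom, Algebra.commutes]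

theorem ofFnHom_mem (f : Fn E M) : ofFnHom c f ∈ degreePart E c 0 :=
  fun _ => algebraMap_mem_exteriorPower_zero _

theorem exists_ofFnHom {s : Multisections E c} (hs : s ∈ degreePart E c 0) :
    ∃ f, ofFnHom c f = s := by
  have h (x : M) : ∃ r, algebraMap ℝ _ r = s.val x := mem_exteriorPower_zero.mp (hs x)
  choose f hf using h
  refine ⟨⟨f, fun x₀ => ?_⟩, ext hf⟩
  -- The scalar part is a linear functional on the exterior algebra of the model fibre and recovers
  -- f in any trivialization.
  convert s.contMDiffAt x₀ ExteriorAlgebra.algebraMapInv.toLinearMap using 2 with x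
  rw [← hf x, AlgHom.commutes, AlgHom.toLinearMap_apply, ExteriorAlgebra.algebraMap_leftInverse]

theorem ofFnHom_mul_mem {k : ℕ} (f : Fn E M) {s : Multisections E c} (hs : s ∈ degreePart E c k) :
    ofFnHom c f * s ∈ degreePart E c k := mem_degreePart.mpr fun x => by
  rw [val_ofFnHom_mul]
  exact Submodule.smul_mem _ _ (hs x)

/-- A section that agrees near each point with a smooth section is smooth. -/
theorem mem_of_eventuallyEq {s : ∀ x, ExteriorAlgebra ℝ (V x)}
    (h : ∀ x₀, ∃ t : Multisections E c, ∀ᶠ x in nhds x₀, s x = t.val x) :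
    s ∈ smoothMultisections E c := fun x₀ φ => by
  obtain ⟨t, ht⟩ := h x₀
  refine (t.contMDiffAt x₀ φ).congr_of_eventuallyEq ?_
  filter_upwards [ht] with x hx
  rw [hx]

end Multisections

namespace HomogeneousSections

variable {k : ℕ}

variable (E c k) in
/-- The inclusion of the sections of degree `k` in the multisections. -/
def incl : HomogeneousSections E c k →ₗ[ℝ] Multisections E c := (degreePart E c k).subtype

/-- The value of a homogeneous section at a point. -/
def val (s : HomogeneousSections E c k) (x : M) : ExteriorAlgebra ℝ (V x) := s.1.1 x

theorem val_mem (s : HomogeneousSections E c k) (x : M) : s.val x ∈ ⋀[ℝ]^k (V x) := s.2 x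

variable (c) in
/-- A homogeneous section, from a multisection of degree `k`. -/
def of (s : Multisections E c) (hs : s ∈ degreePart E c k) : HomogeneousSections E c k := ⟨s, hs⟩

theorem ext {s t : HomogeneousSections E c k} (h : ∀ x, s.val x = t.val x) : s = t :=
  Subtype.ext (Multisections.ext h)

instance : SMul (Fn E M) (HomogeneousSections E c k) :=
  ⟨fun f s => of c (Multisections.ofFnHom c f * incl E c k s)
    (Multisections.ofFnHom_mul_mem f s.2)⟩

theorem val_fn_smul (f : Fn E M) (s : HomogeneousSections E c k) (x : M) :
    (f • s).val x = f x • s.val x := Multisections.val_ofFnHom_mul f (incl E c k s) x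

theorem val_add (s t : HomogeneousSections E c k) (x : M) :
    (s + t).val x = s.val x + t.val x := rfl

theorem val_smul (r : ℝ) (s : HomogeneousSections E c k) (x : M) :
    (r • s).val x = r • s.val x := rfl

theorem val_sum {I : Type*} (s : Finset I) (f : I → HomogeneousSections E c k) (x : M) :
    (∑ i ∈ s, f i).val x = ∑ i ∈ s, (f i).val x := by
  induction s using Finset.cons_induction with
  | empty => rfl
  | cons i s hi ih => rw [Finset.sum_cons, Finset.sum_cons, val_add, ih]

instance : Module (Fn E M) (HomogeneousSections E c k) where
  one_smul s := ext fun x => by rw [val_fn_smul]; exact one_smul _ _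
  mul_smul f g s := ext fun x => by simp only [val_fn_smul]; exact mul_smul _ _ _
  smul_zero f := ext fun x => by rw [val_fn_smul]; exact smul_zero _
  smul_add f s t := ext fun x => by simp only [val_fn_smul, val_add, smul_add]
  add_smul f g s := ext fun x => by simp only [val_fn_smul, val_add]; exact add_smul _ _ _
  zero_smul s := ext fun x => by rw [val_fn_smul]; exact zero_smul _ _

instance : IsScalarTower ℝ (Fn E M) (HomogeneousSections E c k) where
  smul_assoc r f s := ext fun x => by
    rw [val_fn_smul, val_smul, val_fn_smul]
    exact smul_assoc r (f x) _

/-- Sections of degree zero are functions. -/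
def zeroEquiv : HomogeneousSections E c 0 ≃ₗ[Fn E M] Fn E M :=
  (LinearEquiv.ofBijective
    (⟨⟨fun f => of c (Multisections.ofFnHom c f) (Multisections.ofFnHom_mem f), fun f g =>
      ext fun x => map_add (algebraMap ℝ (ExteriorAlgebra ℝ (V x))) (f x) (g x)⟩, fun f g =>
        Subtype.ext (map_mul (Multisections.ofFnHom c) f g)⟩ :
      Fn E M →ₗ[Fn E M] HomogeneousSections E c 0)
    ⟨fun f g h => by
      ext x
      exact (ExteriorAlgebra.algebraMap_inj (V x) _ _).mp
        (congrArg (fun s : HomogeneousSections E c 0 => s.val x) h),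
    fun s => by
      obtain ⟨f, hf⟩ := Multisections.exists_ofFnHom s.2
      exact ⟨f, Subtype.ext hf⟩⟩).symm

theorem algebraMap_zeroEquiv (s : HomogeneousSections E c 0) (x : M) :
    algebraMap ℝ (ExteriorAlgebra ℝ (V x)) (zeroEquiv s x) = s.val x :=
  congrArg (fun s : HomogeneousSections E c 0 => s.val x) (zeroEquiv.symm_apply_apply s)

end HomogeneousSections

/-- Bilinear operations on finite-dimensional spaces preserve smoothness. -/
theorem contMDiffAt_bilinear {W₁ W₂ : Type*} [AddCommGroup W₁] [Module ℝ W₁]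
    [FiniteDimensional ℝ W₁] [AddCommGroup W₂] [Module ℝ W₂] [FiniteDimensional ℝ W₂]
    (β : W₁ →ₗ[ℝ] W₂ →ₗ[ℝ] ℝ) {u : M → W₁} {v : M → W₂} {x₀ : M}
    (hu : ∀ φ : Module.Dual ℝ W₁, ContMDiffAt 𝓘(ℝ, E) 𝓘(ℝ, ℝ) ∞ (fun x => φ (u x)) x₀)
    (hv : ∀ φ : Module.Dual ℝ W₂, ContMDiffAt 𝓘(ℝ, E) 𝓘(ℝ, ℝ) ∞ (fun x => φ (v x)) x₀) :
    ContMDiffAt 𝓘(ℝ, E) 𝓘(ℝ, ℝ) ∞ (fun x => β (u x) (v x)) x₀ := by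
  let b₁ := Module.finBasis ℝ W₁
  let b₂ := Module.finBasis ℝ W₂
  have h : (fun x => β (u x) (v x)) = fun x => ∑ i, ∑ j,
      (b₁.coord i (u x) * b₂.coord j (v x)) * β (b₁ i) (b₂ j) := by
    funext x
    conv_lhs => rw [← b₁.sum_repr (u x), ← b₂.sum_repr (v x)]
    rw [map_sum β, LinearMap.sum_apply]
    refine Finset.sum_congr rfl fun i _ => ?_
    rw [map_sum]
    refine Finset.sum_congr rfl fun j _ => ?_
    rw [map_smul, map_smul, LinearMap.smul_apply, smul_eq_mul, smul_eq_mul,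
      Module.Basis.coord_apply, Module.Basis.coord_apply]
    ring
  rw [h]
  exact ContMDiffAt.sum fun i _ => ContMDiffAt.sum fun j _ =>
    ((hu (b₁.coord i)).mul (hv (b₂.coord j))).mul contMDiffAt_const

end MultisectionModule

theorem eventually_mem_baseSet {F M : Type*} [TopologicalSpace F] [TopologicalSpace M]
    {A : M → Type*} [TopologicalSpace (Bundle.TotalSpace F A)] [∀ x, TopologicalSpace (A x)]
    [FiberBundle F A] (x₀ : M) :
    ∀ᶠ x in nhds x₀, x ∈ (trivializationAt F A x₀).baseSet :=
  (trivializationAt F A x₀).open_baseSet.mem_nhds (FiberBundle.mem_baseSet_trivializationAt' x₀)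

section BundleSections

variable {E : Type*} [NormedAddCommGroup E] [NormedSpace ℝ E]
  {F : Type*} [NormedAddCommGroup F] [NormedSpace ℝ F]
  {M : Type*} [TopologicalSpace M] [ChartedSpace E M]
  {A : M → Type*} [TopologicalSpace (Bundle.TotalSpace F A)]
  [∀ x, AddCommGroup (A x)] [∀ x, Module ℝ (A x)] [∀ x, TopologicalSpace (A x)]
  [FiberBundle F A] [VectorBundle ℝ F A]

/-! ### The module of sections -/

namespace Sec

instance : SMul (Fn E M) (Sec E F A) := ⟨smulFn⟩

theorem smul_apply (f : Fn E M) (X : Sec E F A) (x : M) : (f • X) x = f x • X x := rfl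

instance : Module (Fn E M) (Sec E F A) where
  one_smul X := ContMDiffSection.ext fun x => one_smul ℝ (X x)
  mul_smul f g X := ContMDiffSection.ext fun x => mul_smul (f x) (g x) (X x)
  smul_zero f := ContMDiffSection.ext fun x => smul_zero (f x)
  smul_add f X Y := ContMDiffSection.ext fun x => smul_add (f x) (X x) (Y x)
  add_smul f g X := ContMDiffSection.ext fun x => add_smul (f x) (g x) (X x)
  zero_smul X := ContMDiffSection.ext fun x => zero_smul ℝ (X x)

end Sec

/-! ### Fibres and local trivializations -/

variable (F A) in
/-- The linear isomorphism of a fibre with the model fibre. -/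
def fibreEquiv (x : M) : A x ≃ₗ[ℝ] F :=
  (trivializationAt F A x).linearEquivAt ℝ x (FiberBundle.mem_baseSet_trivializationAt' x)

variable (F A) in
/-- The trivialization of the dual bundle. -/
abbrev dualTriv (x₀ x : M) : Module.Dual ℝ (A x) →ₗ[ℝ] Module.Dual ℝ F :=
  ((trivializationAt F A x₀).symmₗ ℝ x).dualMap

variable (F A) in
/-- The trivialization of the bundle. -/
abbrev triv (x₀ x : M) : A x →ₗ[ℝ] F := (trivializationAt F A x₀).linearMapAt ℝ x

theorem map_dualMap_triv {x₀ x : M} (hx : x ∈ (trivializationAt F A x₀).baseSet)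
    (w : ExteriorAlgebra ℝ (Module.Dual ℝ (A x))) :
    ExteriorAlgebra.map (triv F A x₀ x).dualMap (ExteriorAlgebra.map (dualTriv F A x₀ x) w) = w := by
  have h : (trivializationAt F A x₀).symmₗ ℝ x ∘ₗ triv F A x₀ x = LinearMap.id :=
    LinearMap.ext fun v => (trivializationAt F A x₀).symmₗ_linearMapAt hx v
  rw [← AlgHom.comp_apply, ExteriorAlgebra.map_comp_map, LinearMap.dualMap_comp_dualMap, h,
    LinearMap.dualMap_id, ExteriorAlgebra.map_id, AlgHom.id_apply]

theorem dualMap_dualTriv_eval {x₀ x : M} (hx : x ∈ (trivializationAt F A x₀).baseSet) (v : A x) :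
    (dualTriv F A x₀ x).dualMap (Module.Dual.eval ℝ F (triv F A x₀ x v)) =
      Module.Dual.eval ℝ (A x) v := by
  refine LinearMap.ext fun α => ?_
  exact congrArg α ((trivializationAt F A x₀).symmₗ_linearMapAt hx v)

variable [FiniteDimensional ℝ F]

theorem contMDiffAt_triv (X : Sec E F A) (x₀ : M) (φ : Module.Dual ℝ F) :
    ContMDiffAt 𝓘(ℝ, E) 𝓘(ℝ, ℝ) ∞ (fun x => φ (triv F A x₀ x (X x))) x₀ := by
  have h1 := (Bundle.contMDiffAt_section x₀).mp (X.contMDiff x₀)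
  refine ((LinearMap.toContinuousLinearMap φ).contMDiff.contMDiffAt.comp x₀ h1).congr_of_eventuallyEq
    ?_
  filter_upwards [eventually_mem_baseSet (F := F) (A := A) x₀] with x hx
  rw [Bundle.Trivialization.linearMapAt_apply, if_pos hx]
  rfl

variable (E F A) in
/-- The algebra of forms. -/
abbrev Forms : Type _ := Multisections E (dualTriv F A)

/-- The contraction of a multisection by a form. -/
def contractSection (w : Forms E F A) (U : Multi E F A) : Multi E F A :=
  ⟨fun x => contraction (w.val x) (U.val x), fun x₀ φ => by
    have := exteriorAlgebra_finite F
    have := exteriorAlgebra_finite (Module.Dual ℝ F)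
    -- Near x₀ the local representative is a constant bilinear operation applied to the
    -- representatives of w and U.
    refine (contMDiffAt_bilinear ((contractionₗ F).compr₂ φ) (w.contMDiffAt x₀)
      (U.contMDiffAt x₀)).congr_of_eventuallyEq ?_
    filter_upwards [eventually_mem_baseSet (F := F) (A := A) x₀] with x hx
    rw [LinearMap.compr₂_apply, contractionₗ_apply, ← map_contraction, map_dualMap_triv hx]⟩

theorem val_contractSection (w : Forms E F A) (U : Multi E F A) (x : M) :
    (contractSection w U).val x = contraction (w.val x) (U.val x) := rfl

/-- The interior product of a form by a section. -/
def interiorSection (X : Sec E F A) (w : Forms E F A) : Forms E F A :=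
  ⟨fun x => interior (Module.Dual.eval ℝ (A x) (X x)) (w.val x), fun x₀ φ => by
    have := exteriorAlgebra_finite (Module.Dual ℝ F)
    refine (contMDiffAt_bilinear (((interior (V := Module.Dual ℝ F)).compr₂ φ) ∘ₗ
      Module.Dual.eval ℝ F) (contMDiffAt_triv X x₀) (w.contMDiffAt x₀)).congr_of_eventuallyEq ?_
    filter_upwards [eventually_mem_baseSet (F := F) (A := A) x₀] with x hx
    rw [LinearMap.comp_apply, LinearMap.compr₂_apply, ← map_interior, dualMap_dualTriv_eval hx]⟩

theorem val_interiorSection (X : Sec E F A) (w : Forms E F A) (x : M) :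
    (interiorSection X w).val x = interior (Module.Dual.eval ℝ (A x) (X x)) (w.val x) := rfl

/-- A smooth family of linear functionals, as a form of degree one. -/
def ofDual [ContMDiffVectorBundle ∞ F A 𝓘(ℝ, E)] [IsManifold 𝓘(ℝ, E) ∞ M]
    (α : ∀ x, Module.Dual ℝ (A x))
    (hα : ∀ (x₀ : M) (s : ∀ x, A x), ContMDiffAt 𝓘(ℝ, E) (𝓘(ℝ, E).prod 𝓘(ℝ, F)) ∞
      (fun x => (⟨x, s x⟩ : Bundle.TotalSpace F A)) x₀ →
      ContMDiffAt 𝓘(ℝ, E) 𝓘(ℝ, ℝ) ∞ (fun x => α x (s x)) x₀) : Forms E F A :=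
  ⟨fun x => ExteriorAlgebra.ι ℝ (α x), fun x₀ φ => by
    let b := Module.finBasis ℝ F
    -- Expansion in a dual basis: the coefficients are the values of α on the local frame, which are
    -- smooth by hypothesis.
    have h : (fun x => φ (ExteriorAlgebra.map (dualTriv F A x₀ x) (ExteriorAlgebra.ι ℝ (α x)))) =
        fun x => ∑ j, α x ((trivializationAt F A x₀).symmₗ ℝ x (b j)) *
          φ (ExteriorAlgebra.ι ℝ (b.coord j)) := by
      funext x
      rw [ExteriorAlgebra.map_apply_ι]
      conv_lhs => rw [← b.sum_dual_apply_smul_coord (dualTriv F A x₀ x (α x))]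
      rw [map_sum, map_sum]
      refine Finset.sum_congr rfl fun j _ => ?_
      rw [map_smul, map_smul, smul_eq_mul]
      rfl
    rw [h]
    refine ContMDiffAt.sum fun j _ => (hα x₀ _ ?_).mul contMDiffAt_const
    refine (contMDiffAt_localFrame_of_mem (I := 𝓘(ℝ, E)) ∞ (trivializationAt F A x₀) b j
      (FiberBundle.mem_baseSet_trivializationAt' x₀)).congr_of_eventuallyEq ?_
    filter_upwards [eventually_mem_baseSet (F := F) (A := A) x₀] with x hx
    rw [Bundle.Trivialization.localFrame_apply_of_mem_baseSet _ _ hx,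
      Bundle.Trivialization.symmₗ_apply _ hx]
    rfl⟩

/-! ### Bump functions and local frames -/

theorem exists_bump [FiniteDimensional ℝ E] [T2Space M] [IsManifold 𝓘(ℝ, E) ∞ M] {x₀ : M}
    {s : Set M} (hs : s ∈ nhds x₀) :
    ∃ ψ : Fn E M, (∀ᶠ x in nhds x₀, ψ x = 1) ∧ tsupport ψ ⊆ s := by
  obtain ⟨f, hf, -⟩ := (SmoothBumpFunction.nhds_basis_support (I := 𝓘(ℝ, E)) hs).mem_iff.mp hs
  exact ⟨⟨f, f.contMDiff⟩, f.eventuallyEq_one, hf⟩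

/-- Near each point there are a frame and a dual coframe, cut off by a bump function. -/
theorem exists_frame [FiniteDimensional ℝ E] [T2Space M] [IsManifold 𝓘(ℝ, E) ∞ M]
    [ContMDiffVectorBundle ∞ F A 𝓘(ℝ, E)] (x₀ : M) :
    ∃ (m : ℕ) (e : Fin m → Sec E F A) (α : Fin m → ∀ x, Module.Dual ℝ (A x))
      (ε : Fin m → Forms E F A) (χ : Fn E M),
      (∀ i x, (ε i).val x = ExteriorAlgebra.ι ℝ (α i x)) ∧ (∀ᶠ x in nhds x₀, χ x = 1) ∧
      ∀ x (v : A x), ∑ i, α i x v • e i x = χ x • v := by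
  let t := trivializationAt F A x₀
  let b := Module.finBasis ℝ F
  obtain ⟨ψ, hψ, hs⟩ := exists_bump (E := E) (t.open_baseSet.mem_nhds
    (FiberBundle.mem_baseSet_trivializationAt' x₀))
  -- Outside the domain of the trivialization ψ vanishes in a neighbourhood, so the cut-off frame
  -- and coframe extend smoothly by zero.
  have hzero : ∀ x, x ∉ t.baseSet → ∀ᶠ y in nhds x, ψ y = 0 := fun x hx =>
    notMem_tsupport_iff_eventuallyEq.mp fun h => hx (hs h)
  let e : Fin (Module.finrank ℝ F) → Sec E F A := fun i =>
    ⟨fun x => ψ x • t.localFrame b i x, fun x => by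
      by_cases hx : x ∈ t.baseSet
      · exact ψ.contMDiff.contMDiffAt.smul_section
          (contMDiffAt_localFrame_of_mem (I := 𝓘(ℝ, E)) ∞ t b i hx)
      · refine ((0 : Sec E F A).contMDiff x).congr_of_eventuallyEq ?_
        filter_upwards [hzero x hx] with y hy
        rw [hy, zero_smul]
        rfl⟩
  let α : Fin (Module.finrank ℝ F) → ∀ x, Module.Dual ℝ (A x) := fun i x =>
    ψ x • (b.coord i ∘ₗ triv F A x₀ x)
  have hα : ∀ i (x : M) (s : ∀ x, A x), ContMDiffAt 𝓘(ℝ, E) (𝓘(ℝ, E).prod 𝓘(ℝ, F)) ∞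
      (fun x => (⟨x, s x⟩ : Bundle.TotalSpace F A)) x →
      ContMDiffAt 𝓘(ℝ, E) 𝓘(ℝ, ℝ) ∞ (fun x => α i x (s x)) x := by
    intro i x s h
    by_cases hx : x ∈ t.baseSet
    · have h1 := (t.contMDiffAt_section_iff hx).mp h
      have h2 : ContMDiffAt 𝓘(ℝ, E) 𝓘(ℝ, ℝ) ∞ (fun x => b.coord i (t ⟨x, s x⟩).2) x :=
        (LinearMap.toContinuousLinearMap (b.coord i)).contMDiff.contMDiffAt.comp x h1
      refine (ψ.contMDiff.contMDiffAt.mul h2).congr_of_eventuallyEq ?_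
      filter_upwards [t.open_baseSet.mem_nhds hx] with y hy
      change ψ y * b.coord i (t.linearMapAt ℝ y (s y)) = _
      rw [t.linearMapAt_apply, if_pos hy]
      rfl
    · refine (contMDiffAt_const (c := (0 : ℝ))).congr_of_eventuallyEq ?_
      filter_upwards [hzero x hx] with y hy
      change ψ y * _ = 0
      rw [hy, zero_mul]
  -- The cut-off is ψ², since the frame and the coframe each carry one factor ψ.
  refine ⟨_, e, α, fun i => ofDual (α i) (hα i), ψ * ψ, fun _ _ => rfl, ?_, fun x v => ?_⟩
  · filter_upwards [hψ] with x hx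
    change ψ x * ψ x = 1
    rw [hx, one_mul]
  · change ∑ i, (ψ x * b.repr (triv F A x₀ x v) i) • (ψ x • t.localFrame b i x) =
      (ψ x * ψ x) • v
    by_cases hx : x ∈ t.baseSet
    · have h1 : ∑ i, b.repr (triv F A x₀ x v) i • t.localFrame b i x = v := by
        have h2 : ∀ i, t.localFrame b i x = t.symmₗ ℝ x (b i) := fun i => by
          rw [Bundle.Trivialization.localFrame_apply_of_mem_baseSet _ _ hx,
            Bundle.Trivialization.symmₗ_apply _ hx]
          rfl
        simp only [h2, ← map_smul, ← map_sum, b.sum_repr]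
        exact t.symmₗ_linearMapAt hx v
      conv_rhs => rw [← h1, Finset.smul_sum]
      refine Finset.sum_congr rfl fun i _ => ?_
      rw [smul_smul, smul_smul]
      congr 1
      ring
    · rw [(hzero x hx).self_of_nhds]
      simp

end BundleSections

/-! ### Forms as alternating families of interior products. -/

section FormCalculus

/-! ### Fibres -/

theorem eq_zero_of_finrank_lt {G : Type*} [AddCommGroup G] [Module ℝ G] [FiniteDimensional ℝ G]
    {k : ℕ} (hk : Module.finrank ℝ G < k) {a : ExteriorAlgebra ℝ G} (ha : a ∈ ⋀[ℝ]^k G) :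
    a = 0 := by
  have h := exteriorPower.finrank_eq ℝ (M := G) (n := k)
  rw [Nat.choose_eq_zero_of_lt hk, Submodule.finrank_eq_zero] at h
  rwa [h, Submodule.mem_bot] at ha

variable {E : Type*} [NormedAddCommGroup E] [NormedSpace ℝ E]
  {F : Type*} [NormedAddCommGroup F] [NormedSpace ℝ F]
  {M : Type*} [TopologicalSpace M] [ChartedSpace E M]
  {A : M → Type*} [TopologicalSpace (Bundle.TotalSpace F A)]
  [∀ x, AddCommGroup (A x)] [∀ x, Module ℝ (A x)] [∀ x, TopologicalSpace (A x)]
  [FiberBundle F A] [VectorBundle ℝ F A]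

/-- The evaluation of sections at a point. -/
def Sec.evalHom (x : M) : Sec E F A →+ A x where
  toFun X := X x
  map_zero' := rfl
  map_add' _ _ := rfl

theorem Sec.add_apply (X Y : Sec E F A) (x : M) : (X + Y) x = X x + Y x := rfl

theorem Sec.sum_apply {I : Type*} (s : Finset I) (X : I → Sec E F A) (x : M) :
    (∑ i ∈ s, X i) x = ∑ i ∈ s, X i x := map_sum (Sec.evalHom x) X s

variable [FiniteDimensional ℝ F]

/-! ### Interior products of forms -/

namespace FormsDeg

/-- The interior product of a form of positive degree by a section. -/
def int (k : ℕ) : Sec E F A →ₗ[Fn E M] FormsDeg E F A (k + 1) →ₗ[Fn E M] FormsDeg E F A k :=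
  LinearMap.mk₂ (Fn E M)
    (fun X w => HomogeneousSections.of (dualTriv F A) (interiorSection X w.1)
      fun x => interior_mem _ (w.val_mem x))
    (fun X Y w => HomogeneousSections.ext fun x => by
      change interior (Module.Dual.eval ℝ (A x) (X x + Y x)) (w.val x) = _
      rw [map_add, map_add]
      rfl)
    (fun f X w => HomogeneousSections.ext fun x => by
      rw [HomogeneousSections.val_fn_smul]
      change interior (Module.Dual.eval ℝ (A x) (f x • X x)) (w.val x) = _
      rw [map_smul, map_smul]
      rfl)
    (fun X w w' => HomogeneousSections.ext fun x => map_add (interior _) _ _)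
    (fun f X w => HomogeneousSections.ext fun x => by
      rw [HomogeneousSections.val_fn_smul]
      change interior (Module.Dual.eval ℝ (A x) (X x)) ((f • w).val x) = _
      rw [HomogeneousSections.val_fn_smul, map_smul]
      rfl)

end FormsDeg

variable [FiniteDimensional ℝ E] [T2Space M] [IsManifold 𝓘(ℝ, E) ∞ M]
  [ContMDiffVectorBundle ∞ F A 𝓘(ℝ, E)]

variable (E F) in
/-- Every vector extends to a section. -/
theorem exists_sec (x : M) (v : A x) : ∃ X : Sec E F A, X x = v := by
  obtain ⟨m, e, α, ε, χ, -, hχ, h⟩ := exists_frame (E := E) (F := F) (A := A) x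
  refine ⟨∑ i, α i x v • e i, ?_⟩
  rw [Sec.sum_apply]
  refine (h x v).trans ?_
  rw [hχ.self_of_nhds, one_smul]

/-- In finite dimension every functional on the dual of the fibre is evaluation at a vector, and
every vector is the value of a section. -/
theorem eq_zero_of_interior_sec {k : ℕ} {x : M} {w : ExteriorAlgebra ℝ (Module.Dual ℝ (A x))}
    (hw : w ∈ ⋀[ℝ]^(k + 1) (Module.Dual ℝ (A x)))
    (h : ∀ X : Sec E F A, interior (Module.Dual.eval ℝ (A x) (X x)) w = 0) : w = 0 := by
  have : FiniteDimensional ℝ (A x) := (fibreEquiv F A x).symm.finiteDimensional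
  refine eq_zero_of_interior hw fun ξ => ?_
  obtain ⟨v, rfl⟩ := (Module.evalEquiv ℝ (A x)).surjective ξ
  obtain ⟨X, rfl⟩ := exists_sec E F x v
  exact h X

namespace FormsDeg

theorem eq_zero_of_int {k : ℕ} {w : FormsDeg E F A (k + 1)} (h : ∀ X, int k X w = 0) : w = 0 :=
  HomogeneousSections.ext fun x => eq_zero_of_interior_sec (E := E) (F := F) (w.val_mem x) fun X =>
    congrArg (fun s : FormsDeg E F A k => s.val x) (h X)

/-- Euler's identity suggests θ = (k+1)⁻¹ ∑ αᵢ ∧ Φ(eᵢ). Its interior product with X is (k+1)⁻¹ times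
∑ αᵢ(X) Φ(eᵢ) - ∑ αᵢ ∧ i_X Φ(eᵢ). The first sum is χ Φ(X) by linearity; the second is -k χ Φ(X) by
skewness and Euler's identity for Φ(X). The total is Φ(X) where χ = 1. -/
theorem exists_local_form {k : ℕ} (Φ : Sec E F A →ₗ[Fn E M] FormsDeg E F A k)
    (hΦ : ∀ X x, interior (Module.Dual.eval ℝ (A x) (X x)) ((Φ X).val x) = 0) (x₀ : M) :
    ∃ θ : Forms E F A, (∀ x, θ.val x ∈ ⋀[ℝ]^(k + 1) (Module.Dual ℝ (A x))) ∧
      ∀ᶠ x in nhds x₀, ∀ X : Sec E F A,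
        interior (Module.Dual.eval ℝ (A x) (X x)) (θ.val x) = (Φ X).val x := by
  obtain ⟨m, e, α, ε, χ, hε, hχ, h⟩ := exists_frame (E := E) (F := F) (A := A) x₀
  have hskew : ∀ X Y x, interior (Module.Dual.eval ℝ (A x) (X x)) ((Φ Y).val x) =
      -interior (Module.Dual.eval ℝ (A x) (Y x)) ((Φ X).val x) := by
    intro X Y x
    have h1 := hΦ (X + Y) x
    rw [map_add, HomogeneousSections.val_add, Sec.add_apply, map_add, map_add, map_add,
      LinearMap.add_apply, LinearMap.add_apply, hΦ, hΦ, zero_add, add_zero] at h1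
    exact eq_neg_of_add_eq_zero_right h1
  have hsum : ∀ (X : Sec E F A) x, ∑ i, α i x (X x) • (Φ (e i)).val x = χ x • (Φ X).val x := by
    intro X x
    -- Φ is linear over smooth functions only, so the coefficients αᵢ(X) must be realized as such;
    -- they are the interior products of the smooth forms εᵢ.
    have h1 : ∀ i, ∃ f : Fn E M, ∀ y, f y = α i y (X y) := by
      intro i
      have h2 : interiorSection X (ε i) ∈ degreePart E (dualTriv F A) 0 := fun y => by
        change interior _ ((ε i).val y) ∈ _
        rw [hε, interior_ι]
        exact algebraMap_mem_exteriorPower_zero _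
      obtain ⟨f, hf⟩ := Multisections.exists_ofFnHom h2
      refine ⟨f, fun y => ?_⟩
      have h3 := congrArg (fun s : Forms E F A => s.val y) hf
      rw [val_interiorSection, hε, interior_ι, Multisections.val_ofFnHom] at h3
      exact (ExteriorAlgebra.algebraMap_inj _ _ _).mp h3
    choose f hf using h1
    have h4 : ∑ i, f i • e i = χ • X := ContMDiffSection.ext fun y => by
      rw [Sec.sum_apply]
      refine Eq.trans (Finset.sum_congr rfl fun i _ => ?_) (h y (X y))
      rw [Sec.smul_apply, hf]
    have h5 := congrArg (fun s : FormsDeg E F A k => s.val x) (congrArg Φ h4)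
    rw [map_sum, map_smul, HomogeneousSections.val_sum, HomogeneousSections.val_fn_smul] at h5
    rw [← h5]
    refine Finset.sum_congr rfl fun i _ => ?_
    rw [map_smul, HomogeneousSections.val_fn_smul, hf]
  let c : ℝ := (k + 1 : ℝ)⁻¹
  let θ : Forms E F A := c • ∑ i, ε i * (Φ (e i)).1
  have hθ : ∀ x, θ.val x = c • ∑ i, ExteriorAlgebra.ι ℝ (α i x) * (Φ (e i)).val x := fun x => by
    change (c • ∑ i, ε i * (Φ (e i)).1 : Forms E F A).val x = _
    rw [Multisections.val_smul, Multisections.val_sum]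
    congr 1
    refine Finset.sum_congr rfl fun i _ => ?_
    rw [Multisections.val_mul, hε]
    rfl
  refine ⟨θ, fun x => ?_, ?_⟩
  · rw [hθ]
    exact Submodule.smul_mem _ _ (Submodule.sum_mem _ fun i _ => ι_mul_mem _ ((Φ (e i)).val_mem x))
  · filter_upwards [hχ] with x hx X
    have h6 := sum_ι_mul_interior (fun i => α i x) (fun i => Module.Dual.eval ℝ (A x) (e i x))
      (χ x) (fun β => LinearMap.ext fun v => by
        have := congrArg β (h x v)
        simp only [map_sum, map_smul] at this
        simp only [LinearMap.sum_apply, LinearMap.smul_apply, ← this, Module.Dual.eval_apply,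
          smul_eq_mul, mul_comm]) ((Φ X).val_mem x)
    have h7 : ∑ i, ExteriorAlgebra.ι ℝ (α i x) *
        interior (Module.Dual.eval ℝ (A x) (X x)) ((Φ (e i)).val x) =
          -((χ x * k) • (Φ X).val x) := by
      rw [← h6, ← Finset.sum_neg_distrib]
      refine Finset.sum_congr rfl fun i _ => ?_
      rw [hskew, mul_neg]
    rw [hθ, map_smul, map_sum]
    simp only [interior_ι_mul, Finset.sum_sub_distrib]
    rw [h7]
    simp only [Module.Dual.eval_apply]
    rw [hsum, hx, one_smul, one_mul, sub_neg_eq_add]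
    nth_rewrite 1 [← one_smul ℝ ((Φ X).val x)]
    rw [← add_smul, smul_smul]
    have : c * (1 + (k : ℝ)) = 1 := by
      rw [add_comm]
      exact inv_mul_cancel₀ (by positivity)
    rw [this, one_smul]

/-- An alternating family of forms of degree `k` consists of the interior products of a form of
degree `k + 1`. -/
theorem exists_form {k : ℕ} (Φ : Sec E F A →ₗ[Fn E M] FormsDeg E F A k)
    (hΦ : ∀ X x, interior (Module.Dual.eval ℝ (A x) (X x)) ((Φ X).val x) = 0) :
    ∃ θ : FormsDeg E F A (k + 1), ∀ X, int k X θ = Φ X := by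
  choose θ hθ h using exists_local_form Φ hΦ
  -- Gluing without a partition of unity: a form is determined by its interior products, so near x₀
  -- the value at x of the form chosen for x agrees with that of the form chosen for x₀.
  have hsm : (fun x => (θ x).val x) ∈ smoothMultisections E (dualTriv F A) := by
    refine Multisections.mem_of_eventuallyEq fun x₀ => ⟨θ x₀, ?_⟩
    filter_upwards [h x₀] with x hx
    refine sub_eq_zero.mp (eq_zero_of_interior_sec (E := E) (F := F)
      (Submodule.sub_mem _ (hθ x x) (hθ x₀ x)) fun X => ?_)
    rw [map_sub, (h x).self_of_nhds, hx, sub_self]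
  exact ⟨HomogeneousSections.of (dualTriv F A) ⟨_, hsm⟩ fun x => hθ x x, fun X =>
    HomogeneousSections.ext fun x => (h x).self_of_nhds X⟩

end FormsDeg

end FormCalculus

/-! ### The action of a Lie algebroid on functions and its Cartan calculus. -/

section AlgebroidCalculus

variable {E : Type*} [NormedAddCommGroup E] [NormedSpace ℝ E]
  {M : Type*} [TopologicalSpace M] [ChartedSpace E M]

theorem fn_sum_apply {I : Type*} (s : Finset I) (f : I → Fn E M) (x : M) :
    (∑ i ∈ s, f i) x = ∑ i ∈ s, f i x := map_sum (ContMDiffMap.evalRingHom x) f s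

theorem mdifferentiableAt_fn (f : Fn E M) (x : M) : MDifferentiableAt 𝓘(ℝ, E) 𝓘(ℝ, ℝ) f x :=
  f.contMDiff.mdifferentiableAt (by simp)

theorem dirDeriv_add (f g : Fn E M) (x : M) (v : TangentSpace 𝓘(ℝ, E) x) :
    dirDeriv (f + g : Fn E M) x v = dirDeriv f x v + dirDeriv g x v :=
  congrArg (fun T : E →L[ℝ] ℝ => T v)
    (mfderiv_add (mdifferentiableAt_fn f x) (mdifferentiableAt_fn g x))

theorem dirDeriv_mul (f g : Fn E M) (x : M) (v : TangentSpace 𝓘(ℝ, E) x) :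
    dirDeriv (f * g : Fn E M) x v = f x * dirDeriv g x v + g x * dirDeriv f x v :=
  congrArg (fun T : E →L[ℝ] ℝ => T v)
    ((mdifferentiableAt_fn f x).hasMFDerivAt.mul (mdifferentiableAt_fn g x).hasMFDerivAt).mfderiv

theorem dirDeriv_smul (r : ℝ) (f : Fn E M) (x : M) (v : TangentSpace 𝓘(ℝ, E) x) :
    dirDeriv (r • f : Fn E M) x v = r * dirDeriv f x v :=
  congrArg (fun T : E →L[ℝ] ℝ => T v) (const_smul_mfderiv (mdifferentiableAt_fn f x) r)

theorem dirDeriv_map_add (f : M → ℝ) (x : M) (v v' : TangentSpace 𝓘(ℝ, E) x) :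
    dirDeriv f x (v + v') = dirDeriv f x v + dirDeriv f x v' :=
  map_add (mfderiv 𝓘(ℝ, E) 𝓘(ℝ, ℝ) f x) v v'

theorem dirDeriv_map_smul (f : M → ℝ) (x : M) (r : ℝ) (v : TangentSpace 𝓘(ℝ, E) x) :
    dirDeriv f x (r • v) = r * dirDeriv f x v :=
  map_smul (mfderiv 𝓘(ℝ, E) 𝓘(ℝ, ℝ) f x) r v

variable [IsManifold 𝓘(ℝ, E) ∞ M]
  {F : Type*} [NormedAddCommGroup F] [NormedSpace ℝ F]
  {A : M → Type*} [TopologicalSpace (Bundle.TotalSpace F A)]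
  [∀ x, AddCommGroup (A x)] [∀ x, Module ℝ (A x)] [∀ x, TopologicalSpace (A x)]
  [FiberBundle F A] [VectorBundle ℝ F A]

namespace LieAlgebroid

variable (L : LieAlgebroid E F A)

/-- The function is the fibre component of the tangent map of f composed with the smooth map x ↦
a(X)(x). -/
theorem contMDiff_deriv (X : Sec E F A) (f : Fn E M) :
    ContMDiff 𝓘(ℝ, E) 𝓘(ℝ, ℝ) ∞ (L.deriv X f) := by
  have h1 := L.anchor_smooth.comp X.contMDiff
  have h2 := (f.contMDiff.contMDiff_tangentMap (m := ∞) (by simp)).comp h1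
  exact (contMDiff_snd_tangentBundle_modelSpace ℝ 𝓘(ℝ, ℝ)).comp h2

/-- The derivation of the algebra of smooth functions defined by a section. -/
def derivation (X : Sec E F A) : Derivation ℝ (Fn E M) (Fn E M) :=
  Derivation.mk'
    { toFun := fun f => ⟨L.deriv X f, L.contMDiff_deriv X f⟩
      map_add' := fun f g => ContMDiffMap.ext fun x => dirDeriv_add f g x _
      map_smul' := fun r f => ContMDiffMap.ext fun x => dirDeriv_smul r f x _ }
    fun f g => ContMDiffMap.ext fun x => dirDeriv_mul f g x _

/-- The action of the sections on the smooth functions. -/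
def der : Sec E F A →ₗ[Fn E M] Derivation ℝ (Fn E M) (Fn E M) where
  toFun := L.derivation
  map_add' X Y := Derivation.ext fun f => ContMDiffMap.ext fun x => by
    change dirDeriv f x (L.anchor x (X x + Y x)) = _
    rw [map_add, dirDeriv_map_add]
    rfl
  map_smul' g X := Derivation.ext fun f => ContMDiffMap.ext fun x => by
    change dirDeriv f x (L.anchor x (g x • X x)) = _
    rw [map_smul, dirDeriv_map_smul]
    rfl

theorem der_apply (X : Sec E F A) (f : Fn E M) (x : M) : L.der X f x = L.deriv X f x := rfl

theorem bracket_smul (X : Sec E F A) (f : Fn E M) (Y : Sec E F A) :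
    L.bracket X (f • Y) = f • L.bracket X Y + L.der X f • Y :=
  ContMDiffSection.ext fun x => L.leibniz X Y f x

/-- Expand the Jacobi identity for X, Y, f Z by the Leibniz rule: all terms cancel except the
failure of the anchor to respect brackets, multiplied by Z. -/
theorem der_bracket_sub_smul (X Y Z : Sec E F A) (f : Fn E M) :
    (L.der X (L.der Y f) - L.der Y (L.der X f) - L.der (L.bracket X Y) f) • Z = 0 := by
  have h := L.jacobi X Y (f • Z)
  simp only [bracket_smul, map_add] at h
  rw [L.jacobi X Y Z] at h
  rw [sub_smul, sub_smul, sub_sub, sub_eq_zero]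
  rw [smul_add] at h
  have h1 := sub_eq_zero.mpr h
  rw [← sub_eq_zero, ← h1]
  abel

variable [FiniteDimensional ℝ E] [T2Space M] [FiniteDimensional ℝ F]
  [ContMDiffVectorBundle ∞ F A 𝓘(ℝ, E)]

theorem der_bracket (X Y : Sec E F A) (f : Fn E M) :
    L.der (L.bracket X Y) f = L.der X (L.der Y f) - L.der Y (L.der X f) := by
  refine (sub_eq_zero.mp (ContMDiffMap.ext fun x => ?_)).symm
  -- Compatibility of the anchor with brackets is not an axiom. Where the fibre is nonzero, choose Z
  -- nonvanishing at x and cancel it; where it is zero, the anchor vanishes and so do all three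
  -- terms.
  rcases subsingleton_or_nontrivial (A x) with h | h
  · have hz : ∀ (W : Sec E F A) (g : Fn E M), L.der W g x = 0 := fun W g => by
      rw [der_apply, LieAlgebroid.deriv, Subsingleton.elim (W x) 0, map_zero]
      exact map_zero (mfderiv 𝓘(ℝ, E) 𝓘(ℝ, ℝ) g x)
    rw [ContMDiffMap.coe_sub, ContMDiffMap.coe_sub, Pi.sub_apply, Pi.sub_apply, hz, hz, hz,
      sub_zero, sub_zero]
    rfl
  · obtain ⟨v, hv⟩ := exists_ne (0 : A x)
    obtain ⟨Z, rfl⟩ := exists_sec E F x v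
    have h1 := congrArg (fun W : Sec E F A => W x) (L.der_bracket_sub_smul X Y Z f)
    exact (smul_eq_zero.mp h1).resolve_right hv

/-- The Cartan calculus of a Lie algebroid. -/
def cartan : LieRinehartForms (Fn E M) (Sec E F A) (fun k => FormsDeg E F A k) where
  der := L.der
  br := LinearMap.toAddMonoidHom'.comp L.bracket.toAddMonoidHom
  br_self := L.bracket_self
  jacobi := L.jacobi
  br_smul := L.bracket_smul
  der_br := L.der_bracket
  int := FormsDeg.int
  int_int_self _ _ w := HomogeneousSections.ext fun x => interior_interior_self _ (w.val x)
  eq_zero_of_int _ _ h := FormsDeg.eq_zero_of_int h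
  exists_int_zero Φ := FormsDeg.exists_form Φ fun X x => interior_eq_zero _ ((Φ X).val_mem x)
  exists_int_succ k Φ h := FormsDeg.exists_form Φ fun X x =>
    congrArg (fun s : FormsDeg E F A k => s.val x) (h X)
  fn := HomogeneousSections.zeroEquiv

theorem cartan_br (X Y : Sec E F A) : (cartan L).br X Y = L.bracket X Y := rfl

end LieAlgebroid

end AlgebroidCalculus

/-! ### The grading of the algebra of multisections -/

section ExteriorProjection

variable {V W : Type*} [AddCommGroup V] [Module ℝ V] [AddCommGroup W] [Module ℝ W]

/-- The projection of the exterior algebra to the part of degree `k`. -/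
def exteriorProj (V : Type*) [AddCommGroup V] [Module ℝ V] (k : ℕ) :
    ExteriorAlgebra ℝ V →ₗ[ℝ] ExteriorAlgebra ℝ V :=
  GradedAlgebra.proj (fun i : ℕ => ⋀[ℝ]^i V) k

theorem exteriorProj_mem (k : ℕ) (a : ExteriorAlgebra ℝ V) : exteriorProj V k a ∈ ⋀[ℝ]^k V :=
  (DirectSum.decompose (fun i : ℕ => ⋀[ℝ]^i V) a k).2

theorem exteriorProj_of_mem {i : ℕ} {a : ExteriorAlgebra ℝ V} (ha : a ∈ ⋀[ℝ]^i V) (k : ℕ) :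
    exteriorProj V k a = if i = k then a else 0 := by
  split_ifs with h
  · subst h
    exact DirectSum.decompose_of_mem_same (fun i : ℕ => ⋀[ℝ]^i V) ha
  · exact DirectSum.decompose_of_mem_ne (fun i : ℕ => ⋀[ℝ]^i V) ha h

/-- Trivializations preserve the degree, so the homogeneous components of a smooth multisection are
smooth. -/
theorem exteriorProj_map (f : V →ₗ[ℝ] W) (k : ℕ) (a : ExteriorAlgebra ℝ V) :
    exteriorProj W k (ExteriorAlgebra.map f a) = ExteriorAlgebra.map f (exteriorProj V k a) := by
  induction a using DirectSum.Decomposition.inductionOn (fun i : ℕ => ⋀[ℝ]^i V) with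
  | zero => simp only [map_zero]
  | @homogeneous i a =>
    rw [exteriorProj_of_mem a.2, exteriorProj_of_mem (map_mem_exteriorPower f a.2)]
    split_ifs
    · rfl
    · rw [map_zero]
  | add a b ha hb => simp only [map_add, ha, hb]

theorem sum_exteriorProj [FiniteDimensional ℝ V] {n : ℕ} (hn : Module.finrank ℝ V ≤ n)
    (a : ExteriorAlgebra ℝ V) : ∑ k ∈ Finset.range (n + 1), exteriorProj V k a = a := by
  induction a using DirectSum.Decomposition.inductionOn (fun i : ℕ => ⋀[ℝ]^i V) with
  | zero => simp only [map_zero, Finset.sum_const_zero]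
  | @homogeneous i a =>
    simp only [exteriorProj_of_mem a.2]
    rw [Finset.sum_ite_eq]
    split_ifs with h
    · rfl
    · rw [Finset.mem_range] at h
      exact (eq_zero_of_finrank_lt (by omega) a.2).symm
  | add a b ha hb => simp only [map_add, Finset.sum_add_distrib, ha, hb]

end ExteriorProjection

section Grading

variable {E : Type*} [NormedAddCommGroup E] [NormedSpace ℝ E]
  {M : Type*} [TopologicalSpace M] [ChartedSpace E M]

namespace Multisections

variable {G : Type*} [AddCommGroup G] [Module ℝ G] [FiniteDimensional ℝ G]
  {V : M → Type*} [∀ x, AddCommGroup (V x)] [∀ x, Module ℝ (V x)]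
  {c : M → ∀ x : M, V x →ₗ[ℝ] G}

variable (c) in
/-- The projection of the multisections to those of degree `k`. -/
def proj (k : ℕ) : Multisections E c →ₗ[ℝ] degreePart E c k where
  toFun s := ⟨⟨fun x => exteriorProj (V x) k (s.val x), fun x₀ φ => by
    refine (s.contMDiffAt x₀ (φ ∘ₗ exteriorProj G k)).congr_of_eventuallyEq
      (Filter.Eventually.of_forall fun x => ?_)
    exact congrArg φ (exteriorProj_map (c x₀ x) k (s.val x)).symm⟩, fun x => exteriorProj_mem k _⟩
  map_add' s t := HomogeneousSections.ext fun x => map_add (exteriorProj (V x) k) _ _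
  map_smul' r s := HomogeneousSections.ext fun x => map_smul (exteriorProj (V x) k) _ _

theorem val_proj (k : ℕ) (s : Multisections E c) (x : M) :
    val (proj c k s : Multisections E c) x = exteriorProj (V x) k (s.val x) := rfl

instance : SetLike.GradedMonoid (degreePart E c) where
  one_mem _ := SetLike.GradedOne.one_mem (A := fun i : ℕ => ⋀[ℝ]^i (V _))
  mul_mem _ _ _ _ ha hb x := SetLike.mul_mem_graded (A := fun i : ℕ => ⋀[ℝ]^i (V x)) (ha x) (hb x)

/-- The algebra of multisections is graded if the ranks of the fibres are bounded. -/
@[reducible]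
def gradedAlgebra (n : ℕ) [∀ x, FiniteDimensional ℝ (V x)]
    (hn : ∀ x, Module.finrank ℝ (V x) ≤ n) : GradedAlgebra (degreePart E c) where
  toDecomposition := DirectSum.Decomposition.ofLinearMap (degreePart E c)
    -- The bound on the ranks makes this a finite sum; in degrees above n all sections vanish.
    (∑ k ∈ Finset.range (n + 1), DirectSum.lof ℝ ℕ (fun k => degreePart E c k) k ∘ₗ proj c k)
    (LinearMap.ext fun s => ext fun x => by
      simp only [LinearMap.comp_apply, LinearMap.sum_apply, map_sum, DirectSum.coeLinearMap_lof,
        val_sum, val_proj, LinearMap.id_apply]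
      exact sum_exteriorProj (hn x) _)
    (DirectSum.linearMap_ext _ fun i => LinearMap.ext fun s => by
      simp only [LinearMap.comp_apply, LinearMap.sum_apply, DirectSum.coeLinearMap_lof,
        LinearMap.id_apply]
      have h : ∀ k, proj c k (s : Multisections E c) = if h : i = k then h ▸ s else 0 := by
        intro k
        split_ifs with h
        · subst h
          exact HomogeneousSections.ext fun x => (exteriorProj_of_mem (s.2 x) i).trans (if_pos rfl)
        · exact HomogeneousSections.ext fun x => (exteriorProj_of_mem (s.2 x) k).trans (if_neg h)
      rw [Finset.sum_eq_single i]
      · rw [h, dif_pos rfl]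
      · intro k _ hk
        rw [h, dif_neg (Ne.symm hk), map_zero]
      · intro hi
        have : s = 0 := HomogeneousSections.ext fun x => by
          have h2 := hn x
          rw [Finset.mem_range] at hi
          exact eq_zero_of_finrank_lt (by omega) (s.2 x)
        rw [this]
        simp only [Submodule.coe_zero, map_zero])

end Multisections

variable {F : Type*} [NormedAddCommGroup F] [NormedSpace ℝ F] [FiniteDimensional ℝ F]
  {A : M → Type*} [TopologicalSpace (Bundle.TotalSpace F A)]
  [∀ x, AddCommGroup (A x)] [∀ x, Module ℝ (A x)] [∀ x, TopologicalSpace (A x)]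
  [FiberBundle F A] [VectorBundle ℝ F A]

instance : GradedAlgebra (multiPart E F A) :=
  have (x : M) : FiniteDimensional ℝ (A x) := (fibreEquiv F A x).symm.finiteDimensional
  Multisections.gradedAlgebra (Module.finrank ℝ F) fun x => (fibreEquiv F A x).finrank_eq.le

end Grading

/-! ### Sections of the top exterior power. -/

section TopDegree

variable {n : ℕ}

theorem exists_smul_eq {G : Type*} [AddCommGroup G] [Module ℝ G] [FiniteDimensional ℝ G]
    (hn : Module.finrank ℝ G = n) {a u : ExteriorAlgebra ℝ G} (hu : u ∈ ⋀[ℝ]^n G) (hu0 : u ≠ 0)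
    (ha : a ∈ ⋀[ℝ]^n G) : ∃ r : ℝ, r • u = a := by
  have h : Module.finrank ℝ (⋀[ℝ]^n G) = 1 := by
    rw [exteriorPower.finrank_eq, hn, Nat.choose_self]
  obtain ⟨r, hr⟩ := (finrank_eq_one_iff_of_nonzero' (⟨u, hu⟩ : ⋀[ℝ]^n G)
    fun h => hu0 (congrArg Subtype.val h)).mp h ⟨a, ha⟩
  exact ⟨r, congrArg Subtype.val hr⟩

variable {E : Type*} [NormedAddCommGroup E] [NormedSpace ℝ E]
  {F : Type*} [NormedAddCommGroup F] [NormedSpace ℝ F] [FiniteDimensional ℝ F]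
  {M : Type*} [TopologicalSpace M] [ChartedSpace E M]
  {A : M → Type*} [TopologicalSpace (Bundle.TotalSpace F A)]
  [∀ x, AddCommGroup (A x)] [∀ x, Module ℝ (A x)] [∀ x, TopologicalSpace (A x)]
  [FiberBundle F A] [VectorBundle ℝ F A]

/-- A section of the top exterior power is a multiple of a nowhere vanishing one. -/
theorem exists_fn_mul_eq (hn : Module.finrank ℝ F = n) (Lam : MultiDeg E F A n)
    (hLam : ∀ x, Lam.val x ≠ 0) {a : Multi E F A} (ha : a ∈ multiPart E F A n) :
    ∃ f : Fn E M, ∀ x, f x • Lam.val x = a.val x := by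
  have h (x : M) : ∃ r : ℝ, r • Lam.val x = a.val x := by
    have : FiniteDimensional ℝ (A x) := (fibreEquiv F A x).symm.finiteDimensional
    exact exists_smul_eq ((fibreEquiv F A x).finrank_eq.trans hn) (Lam.val_mem x) (hLam x) (ha x)
  choose r hr using h
  refine ⟨⟨r, fun x₀ => ?_⟩, hr⟩
  -- A linear functional that is nonzero on the representative of Λ at x₀ exhibits the coefficient
  -- near x₀ as a quotient of smooth functions.
  have h1 : ExteriorAlgebra.map (triv F A x₀ x₀) (Lam.val x₀) ≠ 0 := by
    have hinj : Function.LeftInverse (ExteriorAlgebra.map ((trivializationAt F A x₀).symmₗ ℝ x₀))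
        (ExteriorAlgebra.map (triv F A x₀ x₀)) := fun w => by
      have h2 : (trivializationAt F A x₀).symmₗ ℝ x₀ ∘ₗ triv F A x₀ x₀ = LinearMap.id :=
        LinearMap.ext fun v => (trivializationAt F A x₀).symmₗ_linearMapAt
          (FiberBundle.mem_baseSet_trivializationAt' x₀) v
      rw [← AlgHom.comp_apply, ExteriorAlgebra.map_comp_map, h2, ExteriorAlgebra.map_id,
        AlgHom.id_apply]
    rw [← map_zero (ExteriorAlgebra.map (triv F A x₀ x₀))]
    exact hinj.injective.ne (hLam x₀)
  obtain ⟨φ, hφ⟩ := Module.Projective.exists_dual_ne_zero ℝ h1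
  have h3 : ContMDiffAt 𝓘(ℝ, E) 𝓘(ℝ, ℝ) ∞
      (fun x => φ (ExteriorAlgebra.map (triv F A x₀ x) (Lam.val x))) x₀ := Lam.1.contMDiffAt x₀ φ
  refine ((a.contMDiffAt x₀ φ).div₀ h3 hφ).congr_of_eventuallyEq ?_
  filter_upwards [h3.continuousAt.eventually_ne hφ] with x hx
  rw [Pi.div_apply, ← hr x, map_smul, map_smul, smul_eq_mul]
  exact (mul_div_cancel_right₀ _ hx).symm

end TopDegree

section Realization

variable {E : Type*} [NormedAddCommGroup E] [NormedSpace ℝ E] [FiniteDimensional ℝ E]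
  {F : Type*} [NormedAddCommGroup F] [NormedSpace ℝ F] [FiniteDimensional ℝ F]
  {M : Type*} [TopologicalSpace M] [T2Space M] [ChartedSpace E M] [IsManifold 𝓘(ℝ, E) ∞ M]
  {A : M → Type*} [TopologicalSpace (Bundle.TotalSpace F A)]
  [∀ x, AddCommGroup (A x)] [∀ x, Module ℝ (A x)] [∀ x, TopologicalSpace (A x)]
  [FiberBundle F A] [VectorBundle ℝ F A] [ContMDiffVectorBundle ∞ F A 𝓘(ℝ, E)]

/-! ### The algebra of multivectors -/

/-- Euler's identity for the cut-off frame eᵢ and coframe αᵢ gives χ a = (p+1)⁻¹ ∑ eᵢ ∧ (αᵢ ⌟ a).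
The function φ is a bump supported where χ = 1. -/
theorem exists_local_decomposition (x₀ : M) :
    ∃ φ : Fn E M, φ x₀ ≠ 0 ∧ ∃ χ : Fn E M, φ * χ = φ ∧ ∀ p, ∀ a ∈ multiPart E F A (p + 1),
      ∃ (m : ℕ) (e : Fin m → Sec E F A) (b : Fin m → Multi E F A),
        (∀ i, b i ∈ multiPart E F A p) ∧
          Multisections.ofFnHom (triv F A) χ * a = ∑ i, ofSec (e i) * b i := by
  obtain ⟨m, e, α, ε, χ, hε, hχ, h⟩ := exists_frame (E := E) (F := F) (A := A) x₀
  obtain ⟨φ, hφ, hs⟩ := exists_bump (E := E) hχ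
  refine ⟨φ, by rw [hφ.self_of_nhds]; exact one_ne_zero, χ, ContMDiffMap.ext fun x => ?_,
    fun p a ha => ?_⟩
  · change φ x * χ x = φ x
    by_cases hx : φ x = 0
    · rw [hx, zero_mul]
    · rw [show χ x = 1 from hs (subset_tsupport φ hx), mul_one]
  · have hb : ∀ i x, (contractSection (ε i) a).val x = interior (α i x) (a.val x) := fun i x => by
      rw [val_contractSection, hε, contraction_ι]
    refine ⟨m, e, fun i => ((p : ℝ) + 1)⁻¹ • contractSection (ε i) a,
      fun i => Submodule.smul_mem _ _ fun x => ?_, Multisections.ext fun x => ?_⟩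
    · change (contractSection (ε i) a).val x ∈ _
      rw [hb]
      exact interior_mem _ (ha x)
    · rw [Multisections.val_ofFnHom_mul, Multisections.val_sum]
      simp only [Multisections.val_mul, Multisections.val_smul, hb, mul_smul_comm]
      rw [← Finset.smul_sum]
      have h1 := sum_ι_mul_interior (fun i => e i x) (fun i => α i x) (χ x) (h x) (ha x)
      change _ = ((p : ℝ) + 1)⁻¹ • ∑ i, ExteriorAlgebra.ι ℝ (e i x) * _
      refine Eq.trans ?_ (congrArg (((p : ℝ) + 1)⁻¹ • ·) h1.symm)
      change _ = ((p : ℝ) + 1)⁻¹ • ((χ x * ((p + 1 : ℕ) : ℝ)) • a.val x)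
      rw [smul_smul]
      congr 1
      push_cast
      field_simp

variable (E F A) in
/-- The multisections of a vector bundle form an algebra generated locally by functions and
sections. -/
def multivectors : Multivectors (Fn E M) (Sec E F A) (multiPart E F A) M where
  fn := Multisections.ofFnHom (triv F A)
  fn_mem := Multisections.ofFnHom_mem
  exists_fn _ := Multisections.exists_ofFnHom
  fn_comm := Multisections.ofFnHom_comm
  sec :=
    { toFun := ofSec
      map_zero' := Multisections.ext fun x => map_zero (ExteriorAlgebra.ι ℝ)
      map_add' := fun X Y => Multisections.ext fun x => map_add (ExteriorAlgebra.ι ℝ) (X x) (Y x) }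
  sec_mem X x := by
    have h := ι_mul_mem (X x) (algebraMap_mem_exteriorPower_zero (V := A x) 1)
    rwa [map_one, mul_one] at h
  sec_smul f X := Multisections.ext fun x =>
    (map_smul (ExteriorAlgebra.ι ℝ) (f x) (X x)).trans
      (Multisections.val_ofFnHom_mul (c := triv F A) f (ofSec X) x).symm
  mul_comm p q a ha b hb := Multisections.ext fun x => mul_comm_exteriorPower (ha x) (hb x)
  nonvanishing x :=
    { carrier := {f | f x ≠ 0}
      one_mem' := one_ne_zero
      mul_mem' := fun hf hg => mul_ne_zero hf hg }
  eq_zero_of_local a h := Multisections.ext fun x => by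
    obtain ⟨φ, hφ, h1⟩ := h x
    have h2 := congrArg (fun s : Multi E F A => s.val x) h1
    rw [Multisections.val_ofFnHom_mul] at h2
    exact (smul_eq_zero.mp h2).resolve_left hφ
  exists_local := exists_local_decomposition

/-! ### The duality defined by a nowhere vanishing section of the top exterior power -/

variable {n : ℕ}

/-- The duality between forms and multivectors defined by a volume element. -/
def duality (L : LieAlgebroid E F A) (hn : Module.finrank ℝ F = n) (Lam : MultiDeg E F A n)
    (hLam : ∀ x, Lam.val x ≠ 0) : VolumeDuality (multivectors E F A) (LieAlgebroid.cartan L) n where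
  star p :=
    { toFun := fun w => contractSection w.1 Lam.1
      map_add' := fun w w' => Multisections.ext fun x => contraction_add_left _ _ _
      map_smul' := fun r w => Multisections.ext fun x => contraction_smul_left _ _ _ }
  star_smul p f w := Multisections.ext fun x => by
    refine Eq.trans ?_ (Multisections.val_ofFnHom_mul (c := triv F A) f _ x).symm
    change contraction ((f • w).val x) _ = _
    rw [HomogeneousSections.val_fn_smul, contraction_smul_left]
    rfl
  star_mem p k h w x := contraction_mem (w.val_mem x) (h ▸ Lam.val_mem x)
  sec_mul_star_zero X w := Multisections.ext fun x => by
    have : FiniteDimensional ℝ (A x) := (fibreEquiv F A x).symm.finiteDimensional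
    obtain ⟨r, hr⟩ := mem_exteriorPower_zero.mp (w.val_mem x)
    change ExteriorAlgebra.ι ℝ (X x) * contraction (w.val x) (Lam.val x) = 0
    rw [← hr, contraction_algebraMap, mul_smul_comm, eq_zero_of_finrank_lt (k := n + 1)
      (by rw [(fibreEquiv F A x).finrank_eq]; omega) (ι_mul_mem (X x) (Lam.val_mem x)), smul_zero]
  sec_mul_star_succ p X w := Multisections.ext fun x => by
    have : FiniteDimensional ℝ (A x) := (fibreEquiv F A x).symm.finiteDimensional
    change ExteriorAlgebra.ι ℝ (X x) * contraction (w.val x) (Lam.val x) = (-1 : ℝ) ^ p •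
      contraction (interior (Module.Dual.eval ℝ (A x) (X x)) (w.val x)) (Lam.val x)
    -- Of the two terms, the one with X ∧ Λ vanishes because its degree is n + 1; the other has the
    -- sign -(-1)^(p+1).
    rw [ι_mul_contraction _ (w.val_mem x), eq_zero_of_finrank_lt (k := n + 1)
      (by rw [(fibreEquiv F A x).finrank_eq]; omega) (ι_mul_mem (X x) (Lam.val_mem x)),
      ← contractionₗ_apply (w.val x) 0, map_zero, zero_sub, smul_neg, pow_succ, mul_neg_one,
      neg_smul, neg_neg]
  star_zero_injective w h := HomogeneousSections.ext fun x => by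
    have h1 : contraction (w.val x) (Lam.val x) = 0 :=
      congrArg (fun s : Multi E F A => s.val x) h
    obtain ⟨r, hr⟩ := mem_exteriorPower_zero.mp (w.val_mem x)
    rw [← hr, contraction_algebraMap] at h1
    rw [← hr, (smul_eq_zero.mp h1).resolve_right (hLam x), map_zero]
    rfl
  exists_star_zero a ha := by
    obtain ⟨f, hf⟩ := exists_fn_mul_eq hn Lam hLam ha
    refine ⟨HomogeneousSections.of (dualTriv F A) (Multisections.ofFnHom _ f)
      (Multisections.ofFnHom_mem f), Multisections.ext fun x => ?_⟩
    exact (contraction_algebraMap _ _).trans (hf x)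
  eq_zero_of_sec_mul k hk a ha h := Multisections.ext fun x => by
    have : FiniteDimensional ℝ (A x) := (fibreEquiv F A x).symm.finiteDimensional
    refine eq_zero_of_ι_mul (by rw [(fibreEquiv F A x).finrank_eq]; omega) (ha x) fun v => ?_
    obtain ⟨X, rfl⟩ := exists_sec E F x v
    exact congrArg (fun s : Multi E F A => s.val x) (h X)
  form_eq_zero p hp w := HomogeneousSections.ext fun x => by
    have : FiniteDimensional ℝ (A x) := (fibreEquiv F A x).symm.finiteDimensional
    refine eq_zero_of_finrank_lt ?_ (w.val_mem x)
    rw [Subspace.dual_finrank_eq, (fibreEquiv F A x).finrank_eq]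
    omega
  eq_zero k hk a ha := Multisections.ext fun x => by
    have : FiniteDimensional ℝ (A x) := (fibreEquiv F A x).symm.finiteDimensional
    exact eq_zero_of_finrank_lt (by rw [(fibreEquiv F A x).finrank_eq]; omega) (ha x)

end Realization

namespace LieRinehartForms

/-! #### The formula of Koszul for the differential -/

variable {R Γ : Type*} [CommRing R] [Algebra ℝ R] [AddCommGroup Γ] [Module R Γ]
  {Ω : ℕ → Type*} [∀ k, AddCommGroup (Ω k)] [∀ k, Module R (Ω k)] (C : LieRinehartForms R Γ Ω)

/-- The value of a form on a family of elements of `Γ`. -/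
def eval : ∀ k, Ω k →+ ((Fin k → Γ) → R)
  | 0 => AddMonoidHom.mk' (fun w _ => C.fn w) fun _ _ => funext fun _ => map_add C.fn _ _
  | k + 1 => AddMonoidHom.mk' (fun w X => eval k (C.int k (X 0) w) (Fin.tail X)) fun w w' =>
      funext fun X => by rw [map_add, map_add, Pi.add_apply, Pi.add_apply]

theorem eval_zero_apply (w : Ω 0) (X : Fin 0 → Γ) : C.eval 0 w X = C.fn w := rfl

theorem eval_succ {k : ℕ} (w : Ω (k + 1)) (X : Fin (k + 1) → Γ) :
    C.eval (k + 1) w X = C.eval k (C.int k (X 0) w) (Fin.tail X) := rfl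

theorem eval_cons {k : ℕ} (w : Ω (k + 1)) (X : Γ) (Y : Fin k → Γ) :
    C.eval (k + 1) w (Fin.cons X Y : Fin (k + 1) → Γ) = C.eval k (C.int k X w) Y := rfl

theorem eq_zero_of_eval {k : ℕ} {w : Ω k} (h : ∀ X, C.eval k w X = 0) : w = 0 := by
  induction k with
  | zero => exact C.fn.map_eq_zero_iff.mp (h Fin.elim0)
  | succ k ih => exact C.eq_zero_of_int k w fun X => ih fun Y => h (Fin.cons X Y : Fin (k + 1) → Γ)

/-- Moving the argument in position j to the front takes j transpositions. -/
theorem eval_insertNth {k : ℕ} (w : Ω (k + 1)) (j : Fin (k + 1)) (X : Γ) (Y : Fin k → Γ) :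
    C.eval (k + 1) w (j.insertNth X Y : Fin (k + 1) → Γ) =
      (-1) ^ (j : ℕ) * C.eval k (C.int k X w) Y := by
  induction k with
  | zero =>
    obtain rfl : j = 0 := Fin.eq_zero j
    rw [Fin.insertNth_zero', eval_cons, Fin.val_zero, pow_zero, one_mul]
  | succ k ih =>
    induction j using Fin.cases with
    | zero => rw [Fin.insertNth_zero', eval_cons, Fin.val_zero, pow_zero, one_mul]
    | succ j =>
      have h : (j.succ.insertNth X Y : Fin (k + 2) → Γ) =
          Fin.cons (Y 0) (j.insertNth X (Fin.tail Y) : Fin (k + 1) → Γ) := by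
        rw [← Fin.insertNth_succ_cons, Fin.cons_self_tail]
      rw [h, eval_cons, ih, int_int_skew, map_neg, Pi.neg_apply, eval_succ, Fin.val_succ, pow_succ]
      ring

theorem eval_lie (X : Γ) {k : ℕ} (w : Ω k) (Y : Fin k → Γ) :
    C.eval k (C.lie X k w) Y = C.der X (C.eval k w Y) -
      ∑ i, C.eval k w (Function.update Y i (C.br X (Y i))) := by
  induction k with
  | zero =>
    rw [eval_zero_apply, fn_lie, Finset.univ_eq_empty, Finset.sum_empty, sub_zero]
    rfl
  | succ k ih =>
    rw [eval_succ, int_lie, map_sub, Pi.sub_apply, ih, Fin.sum_univ_succ, ← eval_succ, sub_sub]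
    rw [add_comm (∑ i, _)]
    congr 2
    refine Finset.sum_congr rfl fun i _ => ?_
    rw [eval_succ, Fin.tail_update_succ, Function.update_of_ne (Fin.succ_ne_zero i).symm]
    rfl

/-- Induction by Cartan's formula for X₀. The Lie derivative yields the term X₀(w(…)) and the
brackets of X₀ with the other arguments; d(i_{X₀} w) yields the rest, where the shift of the indices
by one accounts for the minus sign. -/
theorem eval_diff {k : ℕ} (w : Ω k) (X : Fin (k + 1) → Γ) :
    C.eval (k + 1) (C.diff k w) X =
      (∑ i : Fin (k + 1), (-1) ^ (i : ℕ) * C.der (X i) (C.eval k w fun l => X (i.succAbove l))) +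
      ∑ j : Fin (k + 1), ∑ i ∈ Finset.univ.filter (· < j), (-1) ^ (j : ℕ) *
        C.eval k w (fun l => Function.update X i (C.br (X i) (X j)) (j.succAbove l)) := by
  simp only [Finset.sum_filter]
  induction k with
  | zero =>
    rw [eval_succ, int_diff_zero, eval_zero_apply, fn_lie]
    simp [eval_zero_apply]
  | succ k ih =>
    have h1 : ∀ (Y : Fin (k + 2) → Γ) (j : Fin (k + 1)), C.eval (k + 1) w
        (fun l => Y (j.succ.succAbove l)) =
          C.eval k (C.int k (Y 0) w) fun l => Fin.tail Y (j.succAbove l) := by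
      intro Y j
      rw [eval_succ, Fin.succ_succAbove_zero]
      refine congrArg (C.eval k _) (funext fun l => ?_)
      rw [Fin.tail, Fin.succ_succAbove_succ]
      rfl
    -- The Lie derivative leaves [X₀, Xⱼ] in the slot of Xⱼ, while the formula has it in the slot of
    -- X₀; moving it to the front produces the sign.
    have h2 : ∀ j : Fin (k + 1), C.eval (k + 1) w
        (Function.update (Fin.tail X) j (C.br (X 0) (Fin.tail X j))) =
          (-1) ^ (j : ℕ) * C.eval k (C.int k (C.br (X 0) (X j.succ)) w)
            fun l => Fin.tail X (j.succAbove l) := by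
      intro j
      rw [← eval_insertNth]
      exact congrArg (C.eval (k + 1) w) (Fin.insertNth_removeNth _ _ _).symm
    have h3 : ∀ i : Fin (k + 1), (0 : Fin (k + 2)) ≠ i.succ := fun i => (Fin.succ_ne_zero i).symm
    have h4 : ∀ P : Fin (k + 1) → Fin (k + 1) → R, (∑ j : Fin (k + 1), ∑ i : Fin (k + 1),
        if i < j then -P i j else 0) = -∑ j : Fin (k + 1), ∑ i : Fin (k + 1),
          if i < j then P i j else 0 := fun P => by
      simp only [← Finset.sum_neg_distrib]
      refine Finset.sum_congr rfl fun j _ => Finset.sum_congr rfl fun i _ => ?_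
      split_ifs
      · rfl
      · exact neg_zero.symm
    rw [eval_succ, int_diff, map_sub, Pi.sub_apply, eval_lie, ih]
    simp only [Fin.sum_univ_succ (n := k + 1), h1, h2, Fin.succ_lt_succ_iff, Fin.not_lt_zero,
      if_false, Fin.succ_pos, if_true, Fin.val_succ, Fin.val_zero, Function.update_self,
      Function.update_of_ne (h3 _), Fin.tail_update_zero, Fin.tail_update_succ, pow_succ, pow_zero,
      mul_neg_one, neg_mul, Finset.sum_neg_distrib, Finset.sum_add_distrib, h4, one_mul,
      Fin.zero_succAbove, Finset.sum_const_zero, add_zero, zero_add]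
    change C.der (X 0) (C.eval (k + 1) w (Fin.tail X)) - _ - (_ + _) =
      C.der (X 0) (C.eval (k + 1) w (Fin.tail X)) + -_ + (-_ + -_)
    simp only [Fin.tail]
    ring

end LieRinehartForms

/-! ### Identification of the coboundary, the bracket and the generating operator with their models.
-/

section Comparison

variable {E : Type*} [NormedAddCommGroup E] [NormedSpace ℝ E] [FiniteDimensional ℝ E]
  {F : Type*} [NormedAddCommGroup F] [NormedSpace ℝ F] [FiniteDimensional ℝ F]
  {M : Type*} [TopologicalSpace M] [T2Space M] [ChartedSpace E M] [IsManifold 𝓘(ℝ, E) ∞ M]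
  {A : M → Type*} [TopologicalSpace (Bundle.TotalSpace F A)]
  [∀ x, AddCommGroup (A x)] [∀ x, Module ℝ (A x)] [∀ x, TopologicalSpace (A x)]
  [FiberBundle F A] [VectorBundle ℝ F A] [ContMDiffVectorBundle ∞ F A 𝓘(ℝ, E)]
  (L : LieAlgebroid E F A)

/-! ### The coboundary -/

/-- Evaluation by determinants agrees with iterated interior products, one argument at a time, by
`pairingDual_cons`. -/
theorem evalForm_eq_eval {k : ℕ} (w : FormsDeg E F A k) (X : Fin k → Sec E F A) :
    evalForm w X = (LieAlgebroid.cartan L).eval k w X := by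
  funext x
  induction k with
  | zero =>
    have h := HomogeneousSections.algebraMap_zeroEquiv w x
    have h1 : (⟨w.val x, w.val_mem x⟩ : ⋀[ℝ]^0 (Module.Dual ℝ (A x))) =
        ⟨algebraMap ℝ _ (HomogeneousSections.zeroEquiv w x),
          algebraMap_mem_exteriorPower_zero _⟩ := Subtype.ext h.symm
    change exteriorPower.pairingDual ℝ (A x) 0 ⟨w.val x, w.val_mem x⟩ _ = _
    rw [h1]
    exact pairingDual_algebraMap _ _
  | succ k ih =>
    rw [LieRinehartForms.eval_succ, ← ih]
    have h := pairingDual_cons (w.val_mem x) (X 0 x) fun i => Fin.tail X i x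
    have h1 : (Fin.cons (X 0 x) (fun i => Fin.tail X i x) : Fin (k + 1) → A x) =
        fun i => X i x := by
      funext i
      induction i using Fin.cases <;> rfl
    rw [h1] at h
    exact h

theorem isCoboundary_diffₗ : IsCoboundary L fun k => (LieAlgebroid.cartan L).diffₗ k := by
  intro k w X x
  have hsign : ∀ (i : ℕ) (f : Fn E M), ((-1) ^ i * f) x = (-1 : ℝ) ^ i * f x := fun i f => by
    have h := map_mul (ContMDiffMap.evalRingHom x) ((-1) ^ i) f
    rw [map_pow, map_neg, map_one] at h
    exact h
  simp only [evalForm_eq_eval L]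
  refine (congrArg (fun f : Fn E M => f x)
    ((LieAlgebroid.cartan L).eval_diff w X)).trans ?_
  change ((∑ i, _ : Fn E M) x) + ((∑ i, _ : Fn E M) x) = _
  simp only [fn_sum_apply, hsign]
  rfl

/-- The global formula fixes all values on sections, and these determine a form. -/
theorem coboundary_eq : coboundary L = fun k => (LieAlgebroid.cartan L).diffₗ k := by
  have h := Classical.epsilon_spec (p := IsCoboundary L) ⟨_, isCoboundary_diffₗ L⟩
  funext k
  refine LinearMap.ext fun w => ?_
  refine sub_eq_zero.mp ((LieAlgebroid.cartan L).eq_zero_of_eval fun X => ?_)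
  rw [map_sub, Pi.sub_apply, sub_eq_zero]
  refine ContMDiffMap.ext fun x => ?_
  rw [← evalForm_eq_eval, ← evalForm_eq_eval]
  exact (h k w X x).trans (isCoboundary_diffₗ L k w X x).symm

/-! ### The Schouten bracket and the generating operator -/

theorem isSchoutenBracket_iff (B : Multi E F A →ₗ[ℝ] Multi E F A →ₗ[ℝ] Multi E F A) :
    IsSchoutenBracket L B ↔ (multivectors E F A).IsBracket (LieAlgebroid.cartan L) B :=
  ⟨fun h => ⟨h.degree_zero, h.degree, h.antisymm, h.leibniz, h.sec_sec,
    fun X f => Multisections.ext (h.sec_fn X f)⟩,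
   fun h => ⟨h.degree_zero, h.degree, h.antisymm, h.leibniz, h.sec_sec,
    fun X f x => congrArg (fun s : Multi E F A => s.val x) (h.sec_fn X f)⟩⟩

variable {n : ℕ} (hn : Module.finrank ℝ F = n) (Lam : MultiDeg E F A n)
  (hLam : ∀ x, Lam.val x ≠ 0)

theorem isSchoutenBracket_bracket : IsSchoutenBracket L (duality L hn Lam hLam).bracket :=
  (isSchoutenBracket_iff L _).mpr (duality L hn Lam hLam).isBracket

/-- Uniqueness: although constructed from Λ, the generated bracket is the Schouten bracket. -/
theorem schoutenBracket_eq : schoutenBracket L = (duality L hn Lam hLam).bracket := by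
  have h := Classical.epsilon_spec (p := IsSchoutenBracket L)
    ⟨_, isSchoutenBracket_bracket L hn Lam hLam⟩
  exact ((isSchoutenBracket_iff L _).mp h).unique (duality L hn Lam hLam).isBracket

variable (nabla : AConnection L n)

/-- The identification of the sections of the top exterior power with functions. -/
def volumeEquiv : FormsDeg E F A 0 ≃ₗ[ℝ] MultiDeg E F A n :=
  (duality L hn Lam hLam).starEquiv (zero_add n)

theorem coe_volumeEquiv (w : FormsDeg E F A 0) :
    (volumeEquiv L hn Lam hLam w).1 = (duality L hn Lam hLam).star 0 w := rfl

/-- The connection corresponds to the Lie derivative of functions. -/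
theorem connection_volumeEquiv (hhor : ∀ X, nabla.toFun X Lam = 0) (X : Sec E F A) (w : FormsDeg E F A 0) :
    nabla.toFun X (volumeEquiv L hn Lam hLam w) =
      volumeEquiv L hn Lam hLam ((LieAlgebroid.cartan L).lie X 0 w) := by
  let f : Fn E M := HomogeneousSections.zeroEquiv w
  have key : ∀ (v : FormsDeg E F A 0) (x : M), (volumeEquiv L hn Lam hLam v).val x =
      (HomogeneousSections.zeroEquiv v : Fn E M) x • Lam.val x := fun v x => by
    change contraction (v.val x) (Lam.val x) = _
    rw [← HomogeneousSections.algebraMap_zeroEquiv, contraction_algebraMap]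
  have h1 : volumeEquiv L hn Lam hLam w = MultiDeg.smulFn f Lam :=
    HomogeneousSections.ext fun x => (key w x).trans
      (Multisections.val_ofFnHom_mul (c := triv F A) f Lam.1 x).symm
  refine HomogeneousSections.ext fun x => ?_
  have h2 := nabla.leibniz X f Lam x
  rw [hhor] at h2
  rw [h1, key]
  refine h2.trans ?_
  change L.deriv X f x • Lam.val x + f x • (0 : ExteriorAlgebra ℝ (A x)) = _
  rw [smul_zero, add_zero]
  congr 1
  have h3 := (LieAlgebroid.cartan L).fn_lie X w
  exact (congrArg (fun g : Fn E M => g x) h3).symm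

theorem isGeneratingOperator_gen (hhor : ∀ X, nabla.toFun X Lam = 0) :
    IsGeneratingOperator L nabla (duality L hn Lam hLam).gen where
  degree_zero f hf := (duality L hn Lam hLam).gen_eq_zero hf
  degree_succ k a ha := (duality L hn Lam hLam).gen_mem ha
  generates p a ha b := by
    rw [schoutenBracket_eq L hn Lam hLam]
    exact (duality L hn Lam hLam).bracket_apply ha b
  on_sec X s := by
    obtain ⟨w, rfl⟩ := (volumeEquiv L hn Lam hLam).surjective s
    rw [schoutenBracket_eq L hn Lam hLam, connection_volumeEquiv L hn Lam hLam nabla hhor,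
      coe_volumeEquiv, coe_volumeEquiv]
    -- For s = ⋆w this reads [X, s] = (D X) s + ⋆(L_X w), and the last term is ∇_X s.
    have h := (duality L hn Lam hLam).bracket_sec X ((duality L hn Lam hLam).star 0 w)
    rw [VolumeDuality.genSec_star, sub_neg_eq_add] at h
    exact eq_sub_of_add_eq h.symm

/-- The condition on (D X) Λ determines the function D X, since Λ vanishes nowhere; the values on
sections determine the operator. -/
theorem generatingOperator_eq (hhor : ∀ X, nabla.toFun X Lam = 0) :
    generatingOperator L nabla = (duality L hn Lam hLam).gen := by
  have h' := isGeneratingOperator_gen L hn Lam hLam nabla hhor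
  have h := Classical.epsilon_spec (p := IsGeneratingOperator L nabla) ⟨_, h'⟩
  refine (multivectors E F A).generator_unique h.generates h'.generates h.degree_zero
    h'.degree_zero fun X => ?_
  have hs := (h.on_sec X Lam).trans (h'.on_sec X Lam).symm
  refine sub_eq_zero.mp (Multisections.ext fun x => ?_)
  have hmem := Submodule.sub_mem _ (h.degree_succ 0 _ ((multivectors E F A).sec_mem X))
    (h'.degree_succ 0 _ ((multivectors E F A).sec_mem X))
  obtain ⟨r, hr⟩ := mem_exteriorPower_zero.mp (hmem x)
  have h1 := congrArg (fun s : Multi E F A => s.val x) (sub_eq_zero.mpr hs)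
  rw [← sub_mul] at h1
  have h2 : algebraMap ℝ _ r * Lam.val x = 0 := by
    rw [hr]
    exact h1
  rw [← Algebra.smul_def] at h2
  refine hr.symm.trans ?_
  rw [(smul_eq_zero.mp h2).resolve_right (hLam x), map_zero]
  rfl

/-- Under ⋆ the connection is the Lie derivative of functions, whose curvature is zero. -/
theorem isFlat_of_horizontal (hn : Module.finrank ℝ F = n) (hLam : ∀ x, Lam.val x ≠ 0)
    (hhor : ∀ X, nabla.toFun X Lam = 0) : nabla.IsFlat := by
  intro X Y s
  obtain ⟨w, rfl⟩ := (volumeEquiv L hn Lam hLam).surjective s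
  have h := connection_volumeEquiv L hn Lam hLam nabla hhor
  rw [h, h, h, h, h, ← map_sub, ← map_sub, ← LieAlgebroid.cartan_br, LieRinehartForms.lie_br,
    sub_self, map_zero]

end Comparison

/-! ### Homology and cohomology -/

/-- A linear equivalence that matches cycles and boundaries induces one in homology. -/
theorem exists_quotient_equiv {N N' : Type*} [AddCommGroup N] [Module ℝ N] [AddCommGroup N']
    [Module ℝ N'] (e : N ≃ₗ[ℝ] N') {Z B : Submodule ℝ N} {Z' B' : Submodule ℝ N'}
    (hZ : ∀ w, e w ∈ Z' ↔ w ∈ Z) (hB : ∀ w, e w ∈ B' ↔ w ∈ B) :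
    ∃ q : (Z ⧸ B.submoduleOf Z) ≃ₗ[ℝ] (Z' ⧸ B'.submoduleOf Z'), ∀ w : Z,
      q (Submodule.mkQ _ w) = Submodule.mkQ _ ⟨e w, (hZ w).mpr w.2⟩ := by
  have h1 : Z.map (e : N →ₗ[ℝ] N') = Z' := Submodule.ext fun z => by
    rw [Submodule.mem_map_equiv, ← hZ, e.apply_symm_apply]
  have h2 : (B.submoduleOf Z).map (e.ofSubmodules Z Z' h1 : Z →ₗ[ℝ] Z') = B'.submoduleOf Z' :=
    Submodule.ext fun z => by
      rw [Submodule.mem_map_equiv]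
      refine (hB _).symm.trans ?_
      rw [Submodule.subtype_apply, LinearEquiv.ofSubmodules_symm_apply, e.apply_symm_apply]
      rfl
  exact ⟨Submodule.Quotient.equiv _ _ _ h2, fun w => rfl⟩

/-! ### Vanishing above the rank. -/

section Vanishing

variable {E : Type*} [NormedAddCommGroup E] [NormedSpace ℝ E]
  {F : Type*} [NormedAddCommGroup F] [NormedSpace ℝ F] [FiniteDimensional ℝ F]
  {M : Type*} [TopologicalSpace M] [ChartedSpace E M] [IsManifold 𝓘(ℝ, E) ∞ M]
  {A : M → Type*} [TopologicalSpace (Bundle.TotalSpace F A)]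
  [∀ x, AddCommGroup (A x)] [∀ x, Module ℝ (A x)] [∀ x, TopologicalSpace (A x)]
  [FiberBundle F A] [VectorBundle ℝ F A]
  (L : LieAlgebroid E F A) {n : ℕ} (nabla : AConnection L n)

theorem subsingleton_homology (hn : Module.finrank ℝ F = n) {k : ℕ} (hk : n < k) :
    Subsingleton (Homology L nabla k) := by
  have : Subsingleton (MultiDeg E F A k) := ⟨fun a b => HomogeneousSections.ext fun x => by
    have : FiniteDimensional ℝ (A x) := (fibreEquiv F A x).symm.finiteDimensional
    have h : ∀ c : MultiDeg E F A k, c.val x = 0 := fun c =>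
      eq_zero_of_finrank_lt (by rw [(fibreEquiv F A x).finrank_eq]; omega) (c.val_mem x)
    rw [h, h]⟩
  exact (Submodule.mkQ_surjective ((boundaries L nabla k).submoduleOf (cycles L nabla k))).subsingleton

theorem subsingleton_cohomology (hn : Module.finrank ℝ F = n) {k : ℕ} (hk : n < k) :
    Subsingleton (Cohomology L k) := by
  have : Subsingleton (FormsDeg E F A k) := ⟨fun a b => HomogeneousSections.ext fun x => by
    have : FiniteDimensional ℝ (A x) := (fibreEquiv F A x).symm.finiteDimensional
    have h : ∀ c : FormsDeg E F A k, c.val x = 0 := fun c =>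
      eq_zero_of_finrank_lt (by rw [Subspace.dual_finrank_eq, (fibreEquiv F A x).finrank_eq]; omega)
        (c.val_mem x)
    rw [h, h]⟩
  exact (Submodule.mkQ_surjective ((coboundaries L k).submoduleOf (cocycles L k))).subsingleton

end Vanishing

/-! ### The isomorphism of homology and cohomology. -/

section Duality

variable {E : Type*} [NormedAddCommGroup E] [NormedSpace ℝ E] [FiniteDimensional ℝ E]
  {F : Type*} [NormedAddCommGroup F] [NormedSpace ℝ F] [FiniteDimensional ℝ F]
  {M : Type*} [TopologicalSpace M] [T2Space M] [ChartedSpace E M] [IsManifold 𝓘(ℝ, E) ∞ M]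
  {A : M → Type*} [TopologicalSpace (Bundle.TotalSpace F A)]
  [∀ x, AddCommGroup (A x)] [∀ x, Module ℝ (A x)] [∀ x, TopologicalSpace (A x)]
  [FiberBundle F A] [VectorBundle ℝ F A] [ContMDiffVectorBundle ∞ F A 𝓘(ℝ, E)]
  (L : LieAlgebroid E F A) {n : ℕ} (hn : Module.finrank ℝ F = n) (Lam : MultiDeg E F A n)
  (hLam : ∀ x, Lam.val x ≠ 0) (nabla : AConnection L n)

/-- Contraction with the volume element. -/
def contractVolume {p k : ℕ} (h : p + k = n) : FormsDeg E F A p ≃ₗ[ℝ] MultiDeg E F A k :=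
  (duality L hn Lam hLam).starEquiv h

theorem boundary_apply (hhor : ∀ X, nabla.toFun X Lam = 0) {k : ℕ} (a : MultiDeg E F A k) :
    boundary L nabla k a = (-1 : ℝ) ^ (n - k) • (duality L hn Lam hLam).gen a.1 := by
  rw [← generatingOperator_eq L hn Lam hLam nabla hhor]
  rfl

/-- ∂⋆w is ⋆dw up to sign, and ⋆ is injective. -/
theorem mem_cycles_iff (hhor : ∀ X, nabla.toFun X Lam = 0) {p k : ℕ} (h : p + k = n)
    (w : FormsDeg E F A p) :
    contractVolume L hn Lam hLam h w ∈ cycles L nabla k ↔ w ∈ cocycles L p := by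
  let S := duality L hn Lam hLam
  have h1 : S.gen (S.star p w) = 0 ↔ (LieAlgebroid.cartan L).diff p w = 0 := by
    rw [S.gen_star, smul_eq_zero_iff_right (pow_ne_zero _ (by norm_num)),
      map_eq_zero_iff _ (S.star_injective (p + 1))]
  rw [cycles, LinearMap.mem_ker, boundary_apply L hn Lam hLam nabla hhor,
    smul_eq_zero_iff_right (pow_ne_zero _ (by norm_num)), cocycles, LinearMap.mem_ker,
    coboundary_eq]
  exact h1

theorem mem_boundaries_iff (hhor : ∀ X, nabla.toFun X Lam = 0) {p k : ℕ} (h : p + k = n)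
    (w : FormsDeg E F A p) :
    contractVolume L hn Lam hLam h w ∈ boundaries L nabla k ↔ w ∈ coboundaries L p := by
  let S := duality L hn Lam hLam
  have h1 : contractVolume L hn Lam hLam h w ∈ boundaries L nabla k ↔
      ∃ a : MultiDeg E F A (k + 1), (-1 : ℝ) ^ (n - (k + 1)) • S.gen a.1 = S.star p w :=
    exists_congr fun a => by rw [boundary_apply L hn Lam hLam nabla hhor]; rfl
  rw [h1]
  rcases p with _ | p
  · refine Iff.trans ?_ (Submodule.mem_bot ℝ).symm
    constructor
    · rintro ⟨a, ha⟩
      -- Here k = n: there is nothing in degree n + 1, so the only boundary is zero, as is the only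
      -- exact form of degree zero.
      rw [S.eq_zero (k + 1) (by omega) a.1 a.2, map_zero, smul_zero] at ha
      exact S.star_zero_injective w ha.symm
    · rintro rfl
      exact ⟨0, (congrArg _ (map_zero S.gen)).trans ((smul_zero _).trans (map_zero _).symm)⟩
  · change _ ↔ ∃ θ, coboundary L p θ = w
    rw [coboundary_eq]
    change _ ↔ ∃ θ, (LieAlgebroid.cartan L).diff p θ = w
    -- The signs (-1)^p and (-1)^(p+1) combine to ∂⋆θ = -⋆dθ, which is why -θ appears as the witness
    -- in both directions.
    have h2 : ∀ θ : FormsDeg E F A p, (-1 : ℝ) ^ (n - (k + 1)) • S.gen (S.star p θ) =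
        -S.star (p + 1) ((LieAlgebroid.cartan L).diff p θ) := fun θ => by
      rw [S.gen_star, smul_smul, show n - (k + 1) = p by omega, ← pow_add,
        Odd.neg_one_pow ⟨p, by ring⟩, neg_one_smul]
    constructor
    · rintro ⟨a, ha⟩
      obtain ⟨θ, hθ⟩ := S.exists_star p (k + 1) (by omega) a.1 a.2
      rw [← hθ, h2, ← map_neg] at ha
      refine ⟨-θ, ?_⟩
      rw [LieRinehartForms.diff_neg]
      exact S.star_injective (p + 1) ha
    · rintro ⟨θ, rfl⟩
      refine ⟨contractVolume L hn Lam hLam (by omega) (-θ), (h2 (-θ)).trans ?_⟩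
      rw [LieRinehartForms.diff_neg, map_neg, neg_neg]

theorem exists_homology_equiv (hn : Module.finrank ℝ F = n) (hLam : ∀ x, Lam.val x ≠ 0)
    (hhor : ∀ X, nabla.toFun X Lam = 0) {p k : ℕ} (h : p + k = n) :
    ∃ e : Cohomology L p ≃ₗ[ℝ] Homology L nabla k,
      ∀ w : cocycles L p, ∃ z : cycles L nabla k,
        (∀ x, z.1.1.1 x = contraction (w.1.1.1 x) (Lam.1.1 x)) ∧
        e (Cohomology.mk L p w) = Homology.mk L nabla k z := by
  obtain ⟨q, hq⟩ := exists_quotient_equiv (contractVolume L hn Lam hLam h)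
    (mem_cycles_iff L hn Lam hLam nabla hhor h) (mem_boundaries_iff L hn Lam hLam nabla hhor h)
  exact ⟨q, fun w => ⟨_, fun x => rfl, hq w⟩⟩

end Duality

end LieAlgebroidBV

end

/-! ### The main theorem. -/

theorem mainTheorem4
    {E : Type*} [NormedAddCommGroup E] [NormedSpace ℝ E] [FiniteDimensional ℝ E]
    {M : Type*} [TopologicalSpace M] [T2Space M] [SecondCountableTopology M]
    [ChartedSpace E M] [IsManifold 𝓘(ℝ, E) ∞ M]
    {F : Type*} [NormedAddCommGroup F] [NormedSpace ℝ F] [FiniteDimensional ℝ F]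
    {A : M → Type*} [TopologicalSpace (Bundle.TotalSpace F A)]
    [∀ x, AddCommGroup (A x)] [∀ x, Module ℝ (A x)] [∀ x, TopologicalSpace (A x)]
    [FiberBundle F A] [VectorBundle ℝ F A] [ContMDiffVectorBundle ∞ F A 𝓘(ℝ, E)]
    (L : LieAlgebroidBV.LieAlgebroid E F A)
    (n : ℕ) (hn : Module.finrank ℝ F = n)
    (nabla : LieAlgebroidBV.AConnection L n)
    (Lam : LieAlgebroidBV.MultiDeg E F A n)
    (hLam : ∀ x, Lam.1.1 x ≠ 0)
    (hhor : ∀ X, nabla.toFun X Lam = 0) :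
    -- the Schouten bracket, the associated generating operator and the coboundary exist
    LieAlgebroidBV.IsSchoutenBracket L (LieAlgebroidBV.schoutenBracket L) ∧
    LieAlgebroidBV.IsGeneratingOperator L nabla (LieAlgebroidBV.generatingOperator L nabla) ∧
    LieAlgebroidBV.IsCoboundary L (LieAlgebroidBV.coboundary L) ∧
    -- the connection is flat and both sequences of operators are complexes
    nabla.IsFlat ∧
    (∀ a, LieAlgebroidBV.generatingOperator L nabla
      (LieAlgebroidBV.generatingOperator L nabla a) = 0) ∧
    (∀ k w, LieAlgebroidBV.coboundary L (k + 1) (LieAlgebroidBV.coboundary L k w) = 0) ∧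
    -- contraction with the horizontal section induces an isomorphism in each degree
    (∀ k p, p + k = n →
      ∃ e : LieAlgebroidBV.Cohomology L p ≃ₗ[ℝ] LieAlgebroidBV.Homology L nabla k,
        ∀ w : LieAlgebroidBV.cocycles L p, ∃ z : LieAlgebroidBV.cycles L nabla k,
          (∀ x, z.1.1.1 x = LieAlgebroidBV.contraction (w.1.1.1 x) (Lam.1.1 x)) ∧
          e (LieAlgebroidBV.Cohomology.mk L p w) = LieAlgebroidBV.Homology.mk L nabla k z) ∧
    -- both sides vanish in the remaining degrees
    (∀ k, n < k → Subsingleton (LieAlgebroidBV.Homology L nabla k) ∧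
      Subsingleton (LieAlgebroidBV.Cohomology L k)) := by
  have hS := LieAlgebroidBV.isSchoutenBracket_bracket L hn Lam hLam
  have hD := LieAlgebroidBV.isGeneratingOperator_gen L hn Lam hLam nabla hhor
  have hd := LieAlgebroidBV.coboundary_eq L
  refine ⟨?_, ?_, ?_, LieAlgebroidBV.isFlat_of_horizontal L Lam nabla hn hLam hhor, fun a => ?_,
    fun k w => ?_, fun k p h =>
      LieAlgebroidBV.exists_homology_equiv L Lam nabla hn hLam hhor h, fun k hk =>
    ⟨LieAlgebroidBV.subsingleton_homology L nabla hn hk,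
      LieAlgebroidBV.subsingleton_cohomology L hn hk⟩⟩
  · rwa [LieAlgebroidBV.schoutenBracket_eq L hn Lam hLam]
  · rwa [LieAlgebroidBV.generatingOperator_eq L hn Lam hLam nabla hhor]
  · rw [hd]
    exact LieAlgebroidBV.isCoboundary_diffₗ L
  · rw [LieAlgebroidBV.generatingOperator_eq L hn Lam hLam nabla hhor]
    exact (LieAlgebroidBV.duality L hn Lam hLam).gen_gen a
  · rw [hd]
    exact (LieAlgebroidBV.LieAlgebroid.cartan L).diff_diff w
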